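/- Let $(\Omega,\mathcal F,\mathbb P)$ be a complete probability space with a filtration $(\mathcal F_t)_{t\ge 0}$ satisfying the usual conditions (right continuous, and $\mathcal F_0$ contains all subsets of $\mathbb P$-null sets), let $H$ and $G$ be separable real Hilbert spaces, $U$ a topological space and $\mathcal R\subseteq\mathcal B(U)$ a ring of sets generating $\mathcal B(U)$. Let $M=(M(t,A):t\ge 0,A\in\mathcal R)$ be a cylindrical martingale-valued measure: each $M(t,A)$ is a linear map from $H$ into $L^0(\Omega,\mathcal F,\mathbb P)$, and, with $M((s,t],A)=M(t,A)-M(s,A)$, 1. $M(0,A)(h)=0$ a.s. for all $A\in\mathcal R$, $h\in H$; 2. $M(t,\emptyset)(h)=0$ a.s., and $M(t,A\cup B)(h)=M(t,A)(h)+M(t,B)(h)$ a.s. for disjoint $A,B\in\mathcal R$, all $t\ge 0$ and $h\in H$; 3. for each $A\in\mathcal R$ and $h\in H$, $(M(t,A)(h))_{t\ge0}$ is a mean-zero square integrable martingale, and each $M(t,A):H\to L^0$ is continuous for convergence in probability; 4. $\mathbb E\big(M(t,A)(h_1)M(s,B)(h_2)\big)=0$ for disjoint $A,B\in\mathcal R$,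 all $s,t\ge 0$, $h_1,h_2\in H$; 5. for $0\le s<t$, $A,B\in\mathcal R$ and $h_1,h_2\in H$, the pair $\big(M((s,t],A)(h_1),M((s,t],B)(h_2)\big)$ is independent of $\mathcal F_s$; 6. $\mathbb E|M((s,t],A)(h)|^2=\int_{(s,t]}\int_A q_{r,u}(h)^2\,\mu(du)\,\lambda(dr)$ for $0\le s<t$, $A\in\mathcal R$, $h\in H$. Here $\mu$ is a $\sigma$-finite Borel measure on $U$, finite on $\mathcal R$, such that $U$ is up to a $\mu$-null set a countable union of sets of $\mathcal R$; $\lambda$ is a Borel measure on $\mathbb R_+$, finite on bounded intervals; and $(q_{r,u})_{r\ge 0,u\in U}$ are continuous Hilbertian seminorms on $H$ whose bilinear forms $q_{r,u}(\cdot,\cdot)$ are such that $(r,u)\mapsto q_{r,u}(h_1,h_2)$ is Borel measurable and bounded on $[0,T]\times U$ for all $h_1,h_2\in H$ and $T>0$. Let $H_{q_{r,u}}$ be the completion of $H/\ker q_{r,u}$, $i_{q_{r,u}}:H\to H_{q_{r,u}}$ the canonical map, $\mathcal L_2$ the Hilbert–Schmidt operators, and $T>0$; write $\int_0^t$ for the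 integral over $(0,t]$. Let $\mathcal P_T$ be the predictable $\sigma$-algebra on $[0,T]\times\Omega$. Let $\Lambda^2(M,T)$ be the space of families $\Phi(r,\omega,u)\in\mathcal L_2(H_{q_{r,u}},G)$, $(r,\omega,u)\in[0,T]\times\Omega\times U$, such that $(r,\omega,u)\mapsto q_{r,u}(\Phi(r,\omega,u)^*g,i_{q_{r,u}}h)$ is $\mathcal P_T\otimes\mathcal B(U)$-measurable for all $h\in H$, $g\in G$, and $$\|\Phi\|^2_{\Lambda^2(M,T)}=\mathbb E\int_0^T\!\int_U\|\Phi(r,u)\|^2_{\mathcal L_2(H_{q_{r,u}},G)}\,\mu(du)\,\lambda(dr)<\infty .$$ Let $\mathcal M^2_T(G)$ be the space of $G$-valued càdlàg square integrable martingales on $[0,T]$, with norm $(\mathbb E\sup_{t\le T}\|X_t\|^2)^{1/2}$, indistinguishable processes being identified. For $0\le s<t\le T$, $A\in\mathcal R$ and $S\in\mathcal L_2(H,G)$ there is $Y(s,t,A,S)\in\mathcal M^2_T(G)$, unique up to indistinguishability, with $\langle Y_r(s,t,A,S),g\rangle=M((s\wedge r,t\wedge r],A)(S^*g)$ a.s.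 for all $r\in[0,T]$, $g\in G$. A simple integrand is a family $$\Phi(r,\omega,u)=\sum_{i=1}^n\sum_{j=1}^m 1_{]s_i,t_i]}(r)\,1_{F_i}(\omega)\,1_{A_j}(u)\,S_{i,j}\circ i_{q_{r,u}}^*,$$ with $0\le s_i<t_i\le T$, $F_i\in\mathcal F_{s_i}$, $A_j\in\mathcal R$, $S_{i,j}\in\mathcal L_2(H,G)$; its stochastic integral is $I_t(\Phi)=\sum_{i,j}1_{F_i}Y_t(s_i,t_i,A_j,S_{i,j})$. Then simple integrands belong to $\Lambda^2(M,T)$, and the map $\Phi\mapsto I(\Phi)$ on simple integrands has a continuous linear extension $I:\Lambda^2(M,T)\to\mathcal M^2_T(G)$ such that for every $\Phi\in\Lambda^2(M,T)$ and $t\in[0,T]$ $$\mathbb E(I_t(\Phi))=0,\qquad \mathbb E\|I_t(\Phi)\|^2=\mathbb E\int_0^t\!\int_U\|\Phi(r,u)\|^2_{\mathcal L_2(H_{q_{r,u}},G)}\,\mu(du)\,\lambda(dr).$$ -/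

import Mathlib

open MeasureTheory ProbabilityTheory Filter Topology TopologicalSpace
open scoped NNReal ENNReal

noncomputable section

/-! ### Hilbert–Schmidt operators -/

/-- The squared Hilbert–Schmidt norm `∑ ‖S eₙ‖²` over a complete orthonormal system `(eₙ)` of `K`
(its value, possibly `∞`, does not depend on the system). -/
def hsNormSq {K G : Type*} [NormedAddCommGroup K] [InnerProductSpace ℝ K] [CompleteSpace K]
    [NormedAddCommGroup G] [InnerProductSpace ℝ G] (S : K →L[ℝ] G) : ℝ≥0∞ :=
  ∑' e : (exists_hilbertBasis ℝ K).choose, ‖S (e : K)‖ₑ ^ 2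

/-- `S ∈ L₂(K, G)`. -/
def IsHilbertSchmidt {K G : Type*} [NormedAddCommGroup K] [InnerProductSpace ℝ K]
    [CompleteSpace K] [NormedAddCommGroup G] [InnerProductSpace ℝ G] (S : K →L[ℝ] G) : Prop :=
  hsNormSq S < ∞

/-! ### Hilbertian seminorms and the Hilbert spaces `H_q` -/

/-- A continuous Hilbertian seminorm `q` on `H`, given by its continuous, positive, symmetric
bilinear form `q(·,·)`; the seminorm is `q(h) = q(h,h)^{1/2}`. -/
structure HilbertianSeminorm (H : Type*) [NormedAddCommGroup H] [InnerProductSpace ℝ H] where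
  form : H →L[ℝ] H →L[ℝ] ℝ
  symm : ∀ x y, form x y = form y x
  nonneg : ∀ x, 0 ≤ form x x

namespace HilbertianSeminorm

variable {H : Type*} [NormedAddCommGroup H] [InnerProductSpace ℝ H]

/-- `H` equipped with the semi-inner product `q(·,·)`. -/
@[nolint unusedArguments]
def Pre (_q : HilbertianSeminorm H) : Type _ := H

instance (q : HilbertianSeminorm H) : AddCommGroup q.Pre := inferInstanceAs (AddCommGroup H)
instance (q : HilbertianSeminorm H) : Module ℝ q.Pre := inferInstanceAs (Module ℝ H)

/-- The identity map from `H` to `H` with the semi-inner product `q(·,·)`. -/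
def toPre (q : HilbertianSeminorm H) : H ≃ₗ[ℝ] q.Pre := LinearEquiv.refl ℝ _

/-- The semi-inner product `q(·,·)`. -/
abbrev preCore (q : HilbertianSeminorm H) : PreInnerProductSpace.Core ℝ q.Pre where
  inner x y := q.form (q.toPre.symm x) (q.toPre.symm y)
  conj_inner_symm x y := by simpa using q.symm _ _
  re_inner_nonneg x := by simpa using q.nonneg _
  add_left x y z := by simp
  smul_left x y r := by simp

instance (q : HilbertianSeminorm H) : SeminormedAddCommGroup q.Pre :=
  InnerProductSpace.Core.toSeminormedAddCommGroup (c := q.preCore)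

instance (q : HilbertianSeminorm H) : InnerProductSpace ℝ q.Pre :=
  InnerProductSpace.ofCore q.preCore

lemma norm_toPre (q : HilbertianSeminorm H) (h : H) : ‖q.toPre h‖ = √(q.form h h) := rfl

/-- The Hilbert space `H_q`: the (Hausdorff) completion of `H` for `q`, that is, the completion
of `H / ker q`. -/
abbrev Space (q : HilbertianSeminorm H) : Type _ := UniformSpace.Completion q.Pre

/-- The canonical map `H → H` with the seminorm `q` on the target, which is continuous. -/
def toPreL (q : HilbertianSeminorm H) : H →L[ℝ] q.Pre :=
  q.toPre.toLinearMap.mkContinuous (√‖q.form‖) fun h => by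
    have h1 : q.form h h ≤ ‖q.form‖ * ‖h‖ * ‖h‖ :=
      (le_abs_self _).trans (q.form.le_opNorm₂ h h)
    change √(q.form h h) ≤ _
    refine (Real.sqrt_le_sqrt h1).trans (le_of_eq ?_)
    rw [mul_assoc, Real.sqrt_mul (norm_nonneg q.form), Real.sqrt_mul_self (norm_nonneg h)]

/-- The canonical map `i_q : H → H_q`. -/
def incl (q : HilbertianSeminorm H) : H →L[ℝ] q.Space :=
  (UniformSpace.Completion.toComplL (𝕜 := ℝ) (E := q.Pre)).comp q.toPreL

lemma inner_incl (q : HilbertianSeminorm H) (x y : H) :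
    inner ℝ (q.incl x) (q.incl y) = q.form x y :=
  UniformSpace.Completion.inner_coe (𝕜 := ℝ) (q.toPreL x) (q.toPreL y)

end HilbertianSeminorm

/-! ### Filtrations and square integrable martingales on `[0, T]` -/

/-- The usual conditions: right continuity, and `ℱ₀` contains every subset of a null set. -/
structure UsualConditions {Ω : Type*} {mΩ : MeasurableSpace Ω} (ℱ : Filtration ℝ≥0 mΩ)
    (P : Measure Ω) : Prop where
  rightContinuous : ℱ.IsRightContinuous
  complete : ∀ s : Set Ω, P s = 0 → MeasurableSet[ℱ 0] s

/-- The filtration `(ℱ_t)` with `t` restricted to `[0, T]`. -/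
def restrictFiltration {Ω : Type*} {mΩ : MeasurableSpace Ω} (ℱ : Filtration ℝ≥0 mΩ) (T : ℝ≥0) :
    Filtration (Set.Icc (0 : ℝ≥0) T) mΩ where
  seq t := ℱ t
  mono' _ _ h := ℱ.mono h
  le' t := ℱ.le t

/-- The predictable `σ`-algebra restricted to `[0, T] × Ω`. -/
@[reducible]
def predictableOn {Ω : Type*} {mΩ : MeasurableSpace Ω} (ℱ : Filtration ℝ≥0 mΩ) (T : ℝ≥0) :
    MeasurableSpace (Set.Icc (0 : ℝ≥0) T × Ω) :=
  MeasurableSpace.comap (fun p => ((p.1 : ℝ≥0), p.2)) ℱ.predictable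

/-- `X ∈ M²_T(G)`: `X` is a `G`-valued càdlàg square integrable martingale on `[0, T]`. -/
structure IsCadlagL2Martingale {Ω G : Type*} {mΩ : MeasurableSpace Ω} [NormedAddCommGroup G]
    [InnerProductSpace ℝ G] (ℱ : Filtration ℝ≥0 mΩ) (P : Measure Ω) (T : ℝ≥0)
    (X : Set.Icc (0 : ℝ≥0) T → Ω → G) : Prop where
  martingale : Martingale X (restrictFiltration ℱ T) P
  memLp : ∀ t, MemLp (X t) 2 P
  right_continuous : ∀ ω t, ContinuousWithinAt (fun s => X s ω) (Set.Ioi t) t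
  left_limit : ∀ ω t, ∃ l : G, Tendsto (fun s => X s ω) (𝓝[<] t) (𝓝 l)

/-- The norm `(E sup_{0 ≤ t ≤ T} ‖X_t‖²)^{1/2}` of `M²_T(G)`. -/
def m2Norm {Ω G : Type*} {mΩ : MeasurableSpace Ω} [NormedAddCommGroup G] (P : Measure Ω)
    (T : ℝ≥0) (X : Set.Icc (0 : ℝ≥0) T → Ω → G) : ℝ≥0∞ :=
  (∫⁻ ω, ⨆ t, ‖X t ω‖ₑ ^ 2 ∂P) ^ (1 / 2 : ℝ)

/-! ### Cylindrical martingale-valued measures -/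

/-- The increment `M((s,t], A)(h) = M(t,A)(h) - M(s,A)(h)`. -/
def cylIncrement {Ω U H : Type*} {mΩ : MeasurableSpace Ω} {P : Measure Ω}
    [NormedAddCommGroup H] [InnerProductSpace ℝ H]
    (M : ℝ≥0 → Set U → H →ₗ[ℝ] (Ω →ₘ[P] ℝ)) (s t : ℝ≥0) (A : Set U) (h : H) : Ω →ₘ[P] ℝ :=
  M t A h - M s A h

/-- `M = (M(t,A) : t ≥ 0, A ∈ R)` is a cylindrical martingale-valued measure in `H` on
`ℝ₊ × R` with covariance structure given by `μ`, `lam` and the seminorms `q r u`. Each `M t A` is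
a cylindrical random variable, i.e. a linear map from `H` into `L⁰(Ω, P)`; the values `M t A` for
`A ∉ R` play no role. -/
structure IsCylMartingaleValuedMeasure {Ω U H : Type*} {mΩ : MeasurableSpace Ω}
    [TopologicalSpace U] [MeasurableSpace U] [BorelSpace U]
    [NormedAddCommGroup H] [InnerProductSpace ℝ H]
    (P : Measure Ω) (ℱ : Filtration ℝ≥0 mΩ) (R : Set (Set U))
    (M : ℝ≥0 → Set U → H →ₗ[ℝ] (Ω →ₘ[P] ℝ))
    (μ : Measure U) (lam : Measure ℝ≥0) (q : ℝ≥0 → U → HilbertianSeminorm H) : Prop where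
  /-- `R` is a ring of Borel sets generating the Borel `σ`-algebra. -/
  isSetRing : IsSetRing R
  generates : ‹MeasurableSpace U› = MeasurableSpace.generateFrom R
  zero_time : ∀ A ∈ R, ∀ h, M 0 A h = 0
  empty : ∀ t h, M t ∅ h = 0
  additive : ∀ t, ∀ A ∈ R, ∀ B ∈ R, Disjoint A B → ∀ h, M t (A ∪ B) h = M t A h + M t B h
  martingale : ∀ A ∈ R, ∀ h, Martingale (fun t ω => M t A h ω) ℱ P
  memLp : ∀ A ∈ R, ∀ t h, MemLp (M t A h) 2 P
  mean_zero : ∀ A ∈ R, ∀ t h, ∫ ω, M t A h ω ∂P = 0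
  /-- `M(t,A) : H → L⁰` is continuous for convergence in probability. -/
  continuous : ∀ A ∈ R, ∀ t h₀,
    TendstoInMeasure P (fun (h : H) ω => M t A h ω) (𝓝 h₀) (fun ω => M t A h₀ ω)
  orthogonal : ∀ A ∈ R, ∀ B ∈ R, Disjoint A B → ∀ t s h₁ h₂,
    ∫ ω, M t A h₁ ω * M s B h₂ ω ∂P = 0
  /-- Increments after time `s` are (pairwise jointly) independent of `ℱ_s`. -/
  indep : ∀ s t, s < t → ∀ A ∈ R, ∀ B ∈ R, ∀ h₁ h₂,
    Indep (MeasurableSpace.comap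
      (fun ω => (cylIncrement M s t A h₁ ω, cylIncrement M s t B h₂ ω)) inferInstance) (ℱ s) P
  covariance : ∀ A ∈ R, ∀ s t, s < t → ∀ h,
    ∫⁻ ω, ‖cylIncrement M s t A h ω‖ₑ ^ 2 ∂P
      = ∫⁻ r in Set.Ioc s t, ∫⁻ u in A, ENNReal.ofReal ((q r u).form h h) ∂μ ∂lam
  sigmaFinite_μ : SigmaFinite μ
  μ_lt_top : ∀ A ∈ R, μ A < ∞
  /-- Up to a `μ`-null set, `U` is a countable union of sets of `R`. -/
  exhausts : ∃ A : ℕ → Set U, (∀ n, A n ∈ R) ∧ μ (⋃ n, A n)ᶜ = 0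
  lam_lt_top : ∀ t, lam (Set.Icc 0 t) < ∞
  q_measurable : ∀ h₁ h₂, Measurable fun p : ℝ≥0 × U => (q p.1 p.2).form h₁ h₂
  q_bounded : ∀ h₁ h₂, ∀ T : ℝ≥0, ∃ C : ℝ, ∀ r ≤ T, ∀ u, |(q r u).form h₁ h₂| ≤ C

/-! ### Integrands -/

/-- Families `Φ(r,ω,u)`, `r ∈ [0,T]`, of continuous linear operators from `H_{q_{r,u}}` to `G`. -/
abbrev OperatorFamily {U H : Type*} [NormedAddCommGroup H] [InnerProductSpace ℝ H]
    (Ω G : Type*) [NormedAddCommGroup G] [InnerProductSpace ℝ G]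
    (q : ℝ≥0 → U → HilbertianSeminorm H) (T : ℝ≥0) : Type _ :=
  ∀ (r : Set.Icc (0 : ℝ≥0) T) (_ : Ω) (u : U), (q r u).Space →L[ℝ] G

section Integrands

variable {Ω U H G : Type*} {mΩ : MeasurableSpace Ω} [MeasurableSpace U]
  [NormedAddCommGroup H] [InnerProductSpace ℝ H]
  [NormedAddCommGroup G] [InnerProductSpace ℝ G] {q : ℝ≥0 → U → HilbertianSeminorm H} {T : ℝ≥0}

/-- `E ∫_0^t ∫_U ‖Φ(r,u)‖²_{L₂(H_{q_{r,u}}, G)} μ(du) lam(dr)`, where `∫_0^t` is the integral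
over `(0, t]`. -/
def energy (P : Measure Ω) (μ : Measure U) (lam : Measure ℝ≥0) (Φ : OperatorFamily Ω G q T)
    (t : ℝ≥0) : ℝ≥0∞ :=
  ∫⁻ ω, ∫⁻ r in {r : Set.Icc (0 : ℝ≥0) T | 0 < (r : ℝ≥0) ∧ (r : ℝ≥0) ≤ t},
    ∫⁻ u, hsNormSq (Φ r ω u) ∂μ ∂(lam.comap Subtype.val) ∂P

/-- The norm of `Λ²(M,T)`. -/
def lambda2Norm (P : Measure Ω) (μ : Measure U) (lam : Measure ℝ≥0)
    (Φ : OperatorFamily Ω G q T) : ℝ≥0∞ :=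
  energy P μ lam Φ T ^ (1 / 2 : ℝ)

/-- `Φ ∈ Λ²(M,T)`. -/
structure MemLambda2 [CompleteSpace G] (P : Measure Ω) (ℱ : Filtration ℝ≥0 mΩ) (μ : Measure U)
    (lam : Measure ℝ≥0) (Φ : OperatorFamily Ω G q T) : Prop where
  hilbertSchmidt : ∀ r ω u, IsHilbertSchmidt (Φ r ω u)
  predictable : ∀ (h : H) (g : G),
    Measurable[(predictableOn ℱ T).prod ‹MeasurableSpace U›]
      fun p : (Set.Icc (0 : ℝ≥0) T × Ω) × U =>
        (inner ℝ (ContinuousLinearMap.adjoint (Φ p.1.1 p.1.2 p.2) g)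
          ((q p.1.1 p.2).incl h) : ℝ)
  norm_lt_top : lambda2Norm P μ lam Φ < ∞

end Integrands

/-- The data of a representation
`∑ᵢ ∑ⱼ 1_{]sᵢ,tᵢ]}(r) 1_{Fᵢ}(ω) 1_{Aⱼ}(u) S_{i,j} ∘ i*_{q_{r,u}}` of a simple integrand. -/
structure SimpleForm {Ω U : Type*} {mΩ : MeasurableSpace Ω} (ℱ : Filtration ℝ≥0 mΩ)
    (R : Set (Set U)) (T : ℝ≥0) (H G : Type*) [NormedAddCommGroup H] [InnerProductSpace ℝ H]
    [CompleteSpace H] [NormedAddCommGroup G] [InnerProductSpace ℝ G] where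
  n : ℕ
  m : ℕ
  s : Fin n → ℝ≥0
  t : Fin n → ℝ≥0
  s_lt_t : ∀ i, s i < t i
  t_le : ∀ i, t i ≤ T
  F : Fin n → Set Ω
  measurableSet_F : ∀ i, MeasurableSet[ℱ (s i)] (F i)
  A : Fin m → Set U
  A_mem : ∀ j, A j ∈ R
  S : Fin n → Fin m → H →L[ℝ] G
  hilbertSchmidt : ∀ i j, IsHilbertSchmidt (S i j)

/-- The simple integrand defined by a representation. -/
def SimpleForm.toFamily {Ω U H G : Type*} {mΩ : MeasurableSpace Ω} {ℱ : Filtration ℝ≥0 mΩ}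
    {R : Set (Set U)} {T : ℝ≥0} [NormedAddCommGroup H] [InnerProductSpace ℝ H] [CompleteSpace H]
    [NormedAddCommGroup G] [InnerProductSpace ℝ G] (φ : SimpleForm ℱ R T H G)
    (q : ℝ≥0 → U → HilbertianSeminorm H) : OperatorFamily Ω G q T :=
  fun r ω u => ∑ i, ∑ j,
    ((Set.Ioc (φ.s i) (φ.t i)).indicator 1 (r : ℝ≥0) * (φ.F i).indicator 1 ω *
      (φ.A j).indicator 1 u : ℝ) •
      (φ.S i j).comp (ContinuousLinearMap.adjoint (q r u).incl)

section SimpleIntegral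

variable {Ω U H G : Type*} {mΩ : MeasurableSpace Ω} {P : Measure Ω}
  [NormedAddCommGroup H] [InnerProductSpace ℝ H] [CompleteSpace H]
  [NormedAddCommGroup G] [InnerProductSpace ℝ G] [CompleteSpace G]

/-- `Y = (Y_r(s,t,A,S) : r ∈ [0,T])` is the radonification by `S` of the cylindrical martingale
`r ↦ M((s ∧ r, t ∧ r], A)`: the càdlàg square integrable martingale in `G` (unique up to
indistinguishability) with `⟨Y_r, g⟩ = M((s ∧ r, t ∧ r], A)(S* g)` a.s. for all `r` and `g`. -/
def IsRadonification (ℱ : Filtration ℝ≥0 mΩ) (M : ℝ≥0 → Set U → H →ₗ[ℝ] (Ω →ₘ[P] ℝ)) (T : ℝ≥0)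
    (s t : ℝ≥0) (A : Set U) (S : H →L[ℝ] G) (Y : Set.Icc (0 : ℝ≥0) T → Ω → G) : Prop :=
  IsCadlagL2Martingale ℱ P T Y ∧
  ∀ (r : Set.Icc (0 : ℝ≥0) T) (g : G), ∀ᵐ ω ∂P, (inner ℝ (Y r ω) g : ℝ) =
    cylIncrement M (min s r) (min t r) A (ContinuousLinearMap.adjoint S g) ω

/-- `X` is (indistinguishable from) the stochastic integral
`∑ᵢ ∑ⱼ 1_{Fᵢ} Y(sᵢ,tᵢ,Aⱼ,S_{i,j})` of the simple integrand represented by `φ`. -/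
def IsSimpleIntegral {ℱ : Filtration ℝ≥0 mΩ} {R : Set (Set U)} {T : ℝ≥0}
    (M : ℝ≥0 → Set U → H →ₗ[ℝ] (Ω →ₘ[P] ℝ)) (φ : SimpleForm ℱ R T H G)
    (X : Set.Icc (0 : ℝ≥0) T → Ω → G) : Prop :=
  ∃ Y : Fin φ.n → Fin φ.m → Set.Icc (0 : ℝ≥0) T → Ω → G,
    (∀ i j, IsRadonification ℱ M T (φ.s i) (φ.t i) (φ.A j) (φ.S i j) (Y i j)) ∧
    ∀ᵐ ω ∂P, ∀ t, X t ω = ∑ i, ∑ j, (φ.F i).indicator (Y i j t) ω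

end SimpleIntegral

end

/-! The integral is first built as an isometry between two `L²` spaces and only then turned into a
process. Write the adjoint of Φ(r,ω,u) in coordinates: a countable Parseval family of `G`, and a
Parseval family of H_{q_{r,u}} obtained by Gram–Schmidt from a fixed dense sequence of `H`, so that
it depends measurably on (r,u). This embeds Λ²(M,T) in an `L²` space of functions of (r,ω,u,m,n),
and the Λ²-norm becomes the `L²`-norm (`energy_eq_lintegral_coord`).

The integral of the rank one integrand 1_{(s,T]} 1_F 1_A (g ⊗ h) ∘ i* is 1_F M((s,T],A)(h) g. Inner
products of two integrals agree with inner products of the integrands: orthogonality of `M` over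
disjoint sets reduces to A ∩ A', the martingale property to the later starting time, independence
extracts P(F ∩ F'), and the covariance formula with polarization identifies what remains as an
integral of q(h,h'). Equal Gram matrices give an isometry on the closed span (`exists_isometry`).
That span contains all of Λ²(M,T) (`coordLp_mem_elemSpan`): predictable rectangles determine a
function almost everywhere, and the Gram–Schmidt system is triangular, so a function orthogonal to
the elementary integrands has no relevant coordinate left.

The integral up to time t is the integral of the truncation to (0,t], and it is the conditional
expectation of the terminal integral given ℱ_t (`condExp_itoMap`). A càdlàg version therefore comes
from `exists_cadlag_condExp`: the expected number of ε-oscillations along dyadic grids is bounded,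
so almost every path has one-sided limits along the grids, and under the usual conditions the right
limits are a version. Doob's inequality gives continuity with constant 2, and the isometry and zero
mean are inherited at each time.

For simple integrands with a general Hilbert–Schmidt `S`, pairing the integral with g gives two
continuous linear maps of g that agree on the Parseval vectors, where only a rank one piece of `S`
is visible (`inner_itoMap_elemFamily`). -/

noncomputable section

/-! ### Hilbert space valued martingales in discrete time -/

section DiscreteMartingale

variable {Ω G : Type*} {mΩ : MeasurableSpace Ω} {P : Measure Ω}
  [NormedAddCommGroup G]

/-- The value of `x` at the last time at which it moved by at least `ε` from its previous
anchor. -/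
def anchor (ε : ℝ) (x : ℕ → G) : ℕ → G
  | 0 => x 0
  | k + 1 => if ε ≤ ‖x (k + 1) - anchor ε x k‖ then x (k + 1) else anchor ε x k

/-- The number of changes of the anchor up to time `k`. -/
def resetCount (ε : ℝ) (x : ℕ → G) : ℕ → ℕ
  | 0 => 0
  | k + 1 => if ε ≤ ‖x (k + 1) - anchor ε x k‖ then resetCount ε x k + 1 else resetCount ε x k

lemma resetCount_monotone (ε : ℝ) (x : ℕ → G) : Monotone (resetCount ε x) :=
  monotone_nat_of_le_succ fun k => by rw [resetCount]; split_ifs <;> omega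

lemma norm_sub_anchor_lt {ε : ℝ} (hε : 0 < ε) (x : ℕ → G) (k : ℕ) :
    ‖x k - anchor ε x k‖ < ε := by
  cases k with
  | zero => simpa [anchor] using hε
  | succ k =>
    rw [anchor]
    split_ifs with h
    · simpa using hε
    · exact not_le.1 h

lemma anchor_eq_of_resetCount_eq {ε : ℝ} {x : ℕ → G} {i j : ℕ} (hij : i ≤ j)
    (h : resetCount ε x i = resetCount ε x j) : anchor ε x i = anchor ε x j := by
  induction j, hij using Nat.le_induction with
  | base => rfl
  | succ j hij ih =>
    have h1 := resetCount_monotone ε x hij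
    have h2 : resetCount ε x (j + 1) = _ := resetCount.eq_2 ε x j
    rw [anchor]
    split_ifs at h2 ⊢ with hε
    · omega
    · exact ih (by omega)

/-- The anchor cannot change between `i` and `j`, so both values lie within ε of the same point. -/
lemma norm_sub_lt_of_resetCount_eq {ε : ℝ} (hε : 0 < ε) {x : ℕ → G} {i j : ℕ} (hij : i ≤ j)
    (h : resetCount ε x i = resetCount ε x j) : ‖x j - x i‖ < 2 * ε := by
  have h1 := norm_sub_anchor_lt hε x i
  have h2 := norm_sub_anchor_lt hε x j
  rw [anchor_eq_of_resetCount_eq hij h, norm_sub_rev] at h1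
  calc ‖x j - x i‖ = ‖(x j - anchor ε x j) + (anchor ε x j - x i)‖ := by abel_nf
    _ ≤ _ := norm_add_le _ _
    _ < 2 * ε := by linarith

lemma resetCount_le (ε : ℝ) (x : ℕ → G) (k : ℕ) : resetCount ε x k ≤ k := by
  induction k with
  | zero => simp [resetCount]
  | succ k ih => rw [resetCount]; split_ifs <;> omega

lemma stronglyMeasurable_anchor {𝒢 : Filtration ℕ mΩ} {X : ℕ → Ω → G} (hX : StronglyAdapted 𝒢 X)
    (ε : ℝ) (k : ℕ) : StronglyMeasurable[𝒢 k] fun ω => anchor ε (X · ω) k := by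
  induction k with
  | zero => simpa [anchor] using hX 0
  | succ k ih =>
    have ih' := ih.mono (𝒢.mono k.le_succ)
    simp only [anchor]
    exact StronglyMeasurable.ite
      (measurableSet_le measurable_const ((hX (k + 1)).sub ih').norm.measurable) (hX (k + 1)) ih'

lemma measurable_resetCount {𝒢 : Filtration ℕ mΩ} {X : ℕ → Ω → G} (hX : StronglyAdapted 𝒢 X)
    (ε : ℝ) (k : ℕ) : Measurable[𝒢 k] fun ω => resetCount ε (X · ω) k := by
  induction k with
  | zero => simp [resetCount]
  | succ k ih =>
    have ih' := ih.mono (𝒢.mono k.le_succ) le_rfl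
    simp only [resetCount]
    exact Measurable.ite (measurableSet_le measurable_const ((hX (k + 1)).sub
      ((stronglyMeasurable_anchor hX ε k).mono (𝒢.mono k.le_succ))).norm.measurable)
      (ih'.add_const 1) ih'

lemma memLp_anchor {𝒢 : Filtration ℕ mΩ} {X : ℕ → Ω → G} (hX : StronglyAdapted 𝒢 X)
    (h2 : ∀ k, MemLp (X k) 2 P) (ε : ℝ) (k : ℕ) : MemLp (fun ω => anchor ε (X · ω) k) 2 P := by
  induction k with
  | zero => simpa [anchor] using h2 0
  | succ k ih =>
    refine ((h2 (k + 1)).norm.add ih.norm).mono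
      ((stronglyMeasurable_anchor hX ε (k + 1)).mono (𝒢.le _)).aestronglyMeasurable
      (ae_of_all _ fun ω => ?_)
    simp only [anchor, Pi.add_apply]
    rw [Real.norm_of_nonneg (by positivity)]
    split_ifs
    · linarith [norm_nonneg (anchor ε (X · ω) k)]
    · linarith [norm_nonneg (X (k + 1) ω)]

/-- The running maximum of the norm of a sequence. -/
def runMax (x : ℕ → G) : ℕ → ℝ
  | 0 => ‖x 0‖
  | k + 1 => max (runMax x k) ‖x (k + 1)‖

lemma norm_le_runMax (x : ℕ → G) (k : ℕ) : ‖x k‖ ≤ runMax x k := by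
  cases k <;> simp [runMax]

lemma runMax_monotone (x : ℕ → G) : Monotone (runMax x) :=
  monotone_nat_of_le_succ fun k => by simp [runMax]

lemma runMax_nonneg (x : ℕ → G) (k : ℕ) : 0 ≤ runMax x k :=
  (norm_nonneg _).trans (norm_le_runMax x k)

lemma stronglyMeasurable_runMax {𝒢 : Filtration ℕ mΩ} {X : ℕ → Ω → G}
    (hX : StronglyAdapted 𝒢 X) (k : ℕ) : StronglyMeasurable[𝒢 k] fun ω => runMax (X · ω) k := by
  induction k with
  | zero => simpa [runMax] using (hX 0).norm
  | succ k ih => exact ((ih.mono (𝒢.mono k.le_succ)).measurable.max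
      (hX (k + 1)).norm.measurable).stronglyMeasurable

lemma memLp_runMax {X : ℕ → Ω → G} (h2 : ∀ k, MemLp (X k) 2 P) (k : ℕ) :
    MemLp (fun ω => runMax (X · ω) k) 2 P := by
  induction k with
  | zero => simpa [runMax] using (h2 0).norm
  | succ k ih => exact ih.sup (h2 (k + 1)).norm

variable [InnerProductSpace ℝ G]

lemma MeasureTheory.MemLp.integrable_inner {X Y : Ω → G} (hX : MemLp X 2 P) (hY : MemLp Y 2 P) :
    Integrable (fun ω => (inner ℝ (X ω) (Y ω) : ℝ)) P := by
  refine (hX.norm.integrable_mul hY.norm).mono (hX.1.inner hY.1) (ae_of_all _ fun ω => ?_)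
  simpa using abs_real_inner_le_norm (X ω) (Y ω)

variable [IsFiniteMeasure P] [CompleteSpace G]

lemma integral_inner_condExp {m : MeasurableSpace Ω} (hm : m ≤ mΩ) {V ξ : Ω → G}
    (hV : AEStronglyMeasurable[m] V P) (hV2 : MemLp V 2 P) (hξ : MemLp ξ 2 P) :
    ∫ ω, (inner ℝ (V ω) ((P[ξ|m]) ω) : ℝ) ∂P = ∫ ω, inner ℝ (V ω) (ξ ω) ∂P := by
  have h := condExp_bilin_of_aestronglyMeasurable_left (innerSL ℝ) hV
    (hV2.integrable_inner hξ) (hξ.integrable one_le_two)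
  rw [← integral_condExp hm (f := fun ω => (inner ℝ (V ω) (ξ ω) : ℝ))]
  exact integral_congr_ae h.symm

lemma MeasureTheory.Martingale.integral_inner_sub_eq_zero {ι : Type*} [Preorder ι]
    {𝒢 : Filtration ι mΩ} {X : ι → Ω → G} (hX : Martingale X 𝒢 P) (h2 : ∀ i, MemLp (X i) 2 P)
    {i j : ι} (hij : i ≤ j) {V : Ω → G} (hV : AEStronglyMeasurable[𝒢 i] V P)
    (hV2 : MemLp V 2 P) : ∫ ω, (inner ℝ (V ω) (X j ω - X i ω) : ℝ) ∂P = 0 := by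
  have h := integral_inner_condExp (𝒢.le i) hV hV2 (h2 j)
  have h' : ∫ ω, (inner ℝ (V ω) ((P[X j|𝒢 i]) ω) : ℝ) ∂P = ∫ ω, inner ℝ (V ω) (X i ω) ∂P :=
    integral_congr_ae ((hX.2 i j hij).mono fun ω hω => by simp [hω])
  simp_rw [inner_sub_right]
  rw [integral_sub (hV2.integrable_inner (h2 j)) (hV2.integrable_inner (h2 i)), ← h, h', sub_self]

/-- A Hilbert space counterpart of the upcrossing inequality. The new increment is orthogonal to the
past, so measuring the position from the origin or from the current anchor, the second moment grows
by the same amount. A reset empties the distance to the anchor and trades at least ε² of it for one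
unit of the counter. -/
lemma integral_resetCount_le {𝒢 : Filtration ℕ mΩ} {X : ℕ → Ω → G} (hX : Martingale X 𝒢 P)
    (h2 : ∀ k, MemLp (X k) 2 P) (ε : ℝ) (hε : 0 < ε) (k : ℕ) :
    ∫ ω, (‖X k ω - anchor ε (X · ω) k‖ ^ 2 + ε ^ 2 * (resetCount ε (X · ω) k : ℝ)) ∂P
      ≤ ∫ ω, ‖X k ω‖ ^ 2 ∂P := by
  have hA := memLp_anchor hX.1 h2 ε
  have hN : ∀ k, Integrable (fun ω => ε ^ 2 * (resetCount ε (X · ω) k : ℝ)) P := fun k => by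
    refine Integrable.const_mul (Integrable.of_bound (C := k) ?_ (ae_of_all _ fun ω => ?_)) _
    · exact (measurable_from_nat.comp
        ((measurable_resetCount hX.1 ε k).mono (𝒢.le k) le_rfl)).aestronglyMeasurable
    · simpa using resetCount_le ε (X · ω) k
  have hsq : ∀ {Y : Ω → G}, MemLp Y 2 P → Integrable (fun ω => ‖Y ω‖ ^ 2) P :=
    fun hY => hY.integrable_norm_pow (by simp)
  induction k with
  | zero =>
    simp only [anchor, resetCount, sub_self]
    simpa using integral_nonneg fun ω => by positivity
  | succ k ih =>
    have o1 : ∫ ω, (inner ℝ (X k ω - anchor ε (X · ω) k) (X (k + 1) ω - X k ω) : ℝ) ∂P = 0 :=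
      hX.integral_inner_sub_eq_zero h2 k.le_succ
        ((hX.1 k).sub (stronglyMeasurable_anchor hX.1 ε k)).aestronglyMeasurable ((h2 k).sub (hA k))
    have o2 : ∫ ω, (inner ℝ (X k ω) (X (k + 1) ω - X k ω) : ℝ) ∂P = 0 :=
      hX.integral_inner_sub_eq_zero h2 k.le_succ (hX.1 k).aestronglyMeasurable (h2 k)
    have i1 := ((h2 k).sub (hA k)).integrable_inner ((h2 (k + 1)).sub (h2 k))
    have i2 := (h2 k).integrable_inner ((h2 (k + 1)).sub (h2 k))
    have i3 := hsq ((h2 k).sub (hA k))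
    have i4 := hsq (h2 k)
    have i5 := hsq (h2 (k + 1))
    simp only [Pi.sub_apply] at i1 i2 i3
    -- The squared increment is eliminated between the expansions `e1` and `e2`; the two inner
    -- products that remain integrate to zero by `o1` and `o2`.
    have key : ∀ ω, ‖X (k + 1) ω - anchor ε (X · ω) (k + 1)‖ ^ 2
        + ε ^ 2 * (resetCount ε (X · ω) (k + 1) : ℝ)
        ≤ (‖X k ω - anchor ε (X · ω) k‖ ^ 2 + ε ^ 2 * (resetCount ε (X · ω) k : ℝ))
          + 2 * inner ℝ (X k ω - anchor ε (X · ω) k) (X (k + 1) ω - X k ω)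
          + (‖X (k + 1) ω‖ ^ 2 - ‖X k ω‖ ^ 2 - 2 * inner ℝ (X k ω) (X (k + 1) ω - X k ω)) := by
      intro ω
      have e1 : ‖X (k + 1) ω - anchor ε (X · ω) k‖ ^ 2 = ‖X k ω - anchor ε (X · ω) k‖ ^ 2
          + 2 * inner ℝ (X k ω - anchor ε (X · ω) k) (X (k + 1) ω - X k ω)
          + ‖X (k + 1) ω - X k ω‖ ^ 2 := by
        rw [← norm_add_sq_real]; congr 2; abel
      have e2 : ‖X (k + 1) ω‖ ^ 2 = ‖X k ω‖ ^ 2 + 2 * inner ℝ (X k ω) (X (k + 1) ω - X k ω)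
          + ‖X (k + 1) ω - X k ω‖ ^ 2 := by
        rw [← norm_add_sq_real]; congr 2; abel
      simp only [anchor, resetCount]
      split_ifs with h
      · have : ε ^ 2 ≤ ‖X (k + 1) ω - anchor ε (X · ω) k‖ ^ 2 := by gcongr
        simp only [sub_self, norm_zero]
        push_cast
        nlinarith
      · linarith
    refine (integral_mono ((hsq ((h2 (k + 1)).sub (hA (k + 1)))).add (hN _))
      (((i3.add (hN k)).add (i1.const_mul 2)).add ((i5.sub i4).sub (i2.const_mul 2))) key).trans ?_
    have e := integral_add ((i3.add (hN k)).add (i1.const_mul 2))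
      ((i5.sub i4).sub (i2.const_mul 2))
    have e' := integral_add (i3.add (hN k)) (i1.const_mul 2)
    have e'' := integral_sub (i5.sub i4) (i2.const_mul 2)
    have e3 := integral_sub i5 i4
    simp only [Pi.add_apply, Pi.sub_apply, integral_const_mul, o1, o2] at e e' e'' e3
    simp only [Pi.add_apply, Pi.sub_apply]
    rw [e, e', e'', e3]
    linarith

lemma lintegral_resetCount_le {𝒢 : Filtration ℕ mΩ} {X : ℕ → Ω → G} (hX : Martingale X 𝒢 P)
    (h2 : ∀ k, MemLp (X k) 2 P) (ε : ℝ) (hε : 0 < ε) (k : ℕ) :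
    ∫⁻ ω, (resetCount ε (X · ω) k : ℝ≥0∞) ∂P
      ≤ ENNReal.ofReal ((∫ ω, ‖X k ω‖ ^ 2 ∂P) / ε ^ 2) := by
  have hm : Measurable fun ω => (resetCount ε (X · ω) k : ℝ) :=
    measurable_from_nat.comp ((measurable_resetCount hX.1 ε k).mono (𝒢.le k) le_rfl)
  have hN : Integrable (fun ω => (resetCount ε (X · ω) k : ℝ)) P :=
    Integrable.of_bound (C := k) hm.aestronglyMeasurable
      (ae_of_all _ fun ω => by simpa using resetCount_le ε (X · ω) k)
  have h := integral_resetCount_le hX h2 ε hε k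
  have hA := ((h2 k).sub (memLp_anchor hX.1 h2 ε k)).integrable_norm_pow (p := 2) (by simp)
  simp only [Pi.sub_apply] at hA
  have h0 : 0 ≤ ∫ ω, ‖X k ω - anchor ε (X · ω) k‖ ^ 2 ∂P := integral_nonneg fun ω => by positivity
  rw [integral_add hA (hN.const_mul _), integral_const_mul] at h
  calc ∫⁻ ω, (resetCount ε (X · ω) k : ℝ≥0∞) ∂P
      = ∫⁻ ω, ENNReal.ofReal (resetCount ε (X · ω) k : ℝ) ∂P := by simp
    _ = ENNReal.ofReal (∫ ω, (resetCount ε (X · ω) k : ℝ) ∂P) :=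
        (ofReal_integral_eq_lintegral_ofReal hN (ae_of_all _ fun ω => by simp)).symm
    _ ≤ _ := by
        gcongr
        rw [le_div_iff₀ (by positivity)]
        linarith

/-- The submartingale property of the norm with a past weight. The martingale increment is tested
against the vector in the direction of `X k` whose length is the running maximum; division by zero
makes it vanish where `X k` does. -/
lemma integral_runMax_mul_norm_le {𝒢 : Filtration ℕ mΩ} {X : ℕ → Ω → G} (hX : Martingale X 𝒢 P)
    (h2 : ∀ k, MemLp (X k) 2 P) (k : ℕ) :
    ∫ ω, runMax (X · ω) k * ‖X k ω‖ ∂P ≤ ∫ ω, runMax (X · ω) k * ‖X (k + 1) ω‖ ∂P := by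
  have hS := memLp_runMax h2
  set V : Ω → G := fun ω => (runMax (X · ω) k / ‖X k ω‖) • X k ω with hV
  have hVn : ∀ ω, ‖V ω‖ ≤ runMax (X · ω) k := fun ω => by
    rw [hV, norm_smul, norm_div, norm_norm, Real.norm_of_nonneg (runMax_nonneg _ _)]
    rw [div_mul_eq_mul_div]
    exact div_le_of_le_mul₀ (norm_nonneg _) (runMax_nonneg _ _) le_rfl
  have hVm : StronglyMeasurable[𝒢 k] V :=
    ((stronglyMeasurable_runMax hX.1 k).measurable.div
      (hX.1 k).norm.measurable).stronglyMeasurable.smul (hX.1 k)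
  have hV2 : MemLp V 2 P := (hS k).mono (hVm.mono (𝒢.le k)).aestronglyMeasurable
    (ae_of_all _ fun ω => by rw [Real.norm_of_nonneg (runMax_nonneg _ _)]; exact hVn ω)
  have h0 := hX.integral_inner_sub_eq_zero h2 k.le_succ hVm.aestronglyMeasurable hV2
  simp_rw [inner_sub_right] at h0
  rw [integral_sub (hV2.integrable_inner (h2 _)) (hV2.integrable_inner (h2 _)), sub_eq_zero] at h0
  have e : ∀ ω, (inner ℝ (V ω) (X k ω) : ℝ) = runMax (X · ω) k * ‖X k ω‖ := fun ω => by
    rw [hV, real_inner_smul_left, real_inner_self_eq_norm_sq]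
    by_cases h : ‖X k ω‖ = 0
    · simp [h]
    · field_simp
  simp_rw [← e, ← h0]
  refine integral_mono (hV2.integrable_inner (h2 _)) ((hS k).integrable_mul (h2 _).norm)
    fun ω => ?_
  exact (real_inner_le_norm _ _).trans (by gcongr; exact hVn ω)

/-- Doob's maximal inequality in `L²`. -/
lemma integral_runMax_sq_le {𝒢 : Filtration ℕ mΩ} {X : ℕ → Ω → G} (hX : Martingale X 𝒢 P)
    (h2 : ∀ k, MemLp (X k) 2 P) (k : ℕ) :
    ∫ ω, runMax (X · ω) k ^ 2 ∂P ≤ 4 * ∫ ω, ‖X k ω‖ ^ 2 ∂P := by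
  have hS := memLp_runMax h2
  have i1 : ∀ k, Integrable (fun ω => runMax (X · ω) k ^ 2) P := fun k => (hS k).integrable_sq
  have i2 : ∀ k l, Integrable (fun ω => runMax (X · ω) k * ‖X l ω‖) P :=
    fun k l => (hS k).integrable_mul (h2 l).norm
  have hsq : ∀ k, Integrable (fun ω => ‖X k ω‖ ^ 2) P :=
    fun k => (h2 k).integrable_norm_pow (by simp)
  have main : ∀ k, ∫ ω, runMax (X · ω) k ^ 2 ∂P ≤ 2 * ∫ ω, runMax (X · ω) k * ‖X k ω‖ ∂P := by
    intro k
    induction k with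
    | zero =>
      rw [← integral_const_mul]
      refine integral_mono (i1 0) ((i2 0 0).const_mul 2) fun ω => ?_
      simp only [runMax]
      nlinarith [norm_nonneg (X 0 ω)]
    | succ k ih =>
      -- Pathwise: equality if the maximum does not change; otherwise the two sides differ by the
      -- square of `runMax (X · ω) k - ‖X (k + 1) ω‖`.
      have step : ∫ ω, (runMax (X · ω) (k + 1) ^ 2
          - 2 * (runMax (X · ω) (k + 1) * ‖X (k + 1) ω‖)) ∂P
          ≤ ∫ ω, (runMax (X · ω) k ^ 2 - 2 * (runMax (X · ω) k * ‖X (k + 1) ω‖)) ∂P := by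
        refine integral_mono ((i1 _).sub ((i2 _ _).const_mul 2))
          ((i1 _).sub ((i2 _ _).const_mul 2)) fun ω => ?_
        simp only [runMax]
        rcases max_cases (runMax (X · ω) k) ‖X (k + 1) ω‖ with h | h <;> rw [h.1]
        nlinarith [sq_nonneg (runMax (X · ω) k - ‖X (k + 1) ω‖)]
      rw [integral_sub (i1 _) ((i2 _ _).const_mul 2), integral_sub (i1 _) ((i2 _ _).const_mul 2),
        integral_const_mul, integral_const_mul] at step
      have := integral_runMax_mul_norm_le hX h2 k
      linarith
  -- From 2ab ≤ a²/2 + 2b²; absorbing half of the left side produces the constant 4.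
  have h3 : 2 * ∫ ω, runMax (X · ω) k * ‖X k ω‖ ∂P
      ≤ (1 / 2) * ∫ ω, runMax (X · ω) k ^ 2 ∂P + 2 * ∫ ω, ‖X k ω‖ ^ 2 ∂P := by
    rw [← integral_const_mul, ← integral_const_mul, ← integral_const_mul,
      ← integral_add ((i1 k).const_mul _) ((hsq k).const_mul _)]
    refine integral_mono ((i2 k k).const_mul 2) (((i1 k).const_mul _).add ((hsq k).const_mul _))
      fun ω => ?_
    simp only
    nlinarith [sq_nonneg (runMax (X · ω) k - 2 * ‖X k ω‖)]
  linarith [main k]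

lemma lintegral_runMax_sq_le {𝒢 : Filtration ℕ mΩ} {X : ℕ → Ω → G} (hX : Martingale X 𝒢 P)
    (h2 : ∀ k, MemLp (X k) 2 P) (k : ℕ) :
    ∫⁻ ω, ENNReal.ofReal (runMax (X · ω) k ^ 2) ∂P ≤ ENNReal.ofReal (4 * ∫ ω, ‖X k ω‖ ^ 2 ∂P) := by
  rw [← ofReal_integral_eq_lintegral_ofReal (memLp_runMax h2 k).integrable_sq
    (ae_of_all _ fun ω => sq_nonneg _)]
  exact ENNReal.ofReal_le_ofReal (integral_runMax_sq_le hX h2 k)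

end DiscreteMartingale

/-! ### Dyadic grids in `[0, T]` and regularity of paths along them -/

section DyadicGrid

variable {T : ℝ≥0}

/-- The grid point `k / 2ⁿ`, cut off at `T`. -/
def gridPt (T : ℝ≥0) (n k : ℕ) : Set.Icc (0 : ℝ≥0) T :=
  ⟨min (k / 2 ^ n) T, zero_le, min_le_right _ _⟩

/-- The index of the first grid point at or after `t`. -/
def gridIdx (n : ℕ) (t : ℝ≥0) : ℕ := ⌈t * 2 ^ n⌉₊

/-- The end point `T` of `[0, T]`. -/
def endPt (T : ℝ≥0) : Set.Icc (0 : ℝ≥0) T := ⟨T, zero_le, le_rfl⟩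

/-- The set of all grid points. -/
def gridSet (T : ℝ≥0) : Set (Set.Icc (0 : ℝ≥0) T) := Set.range fun p : ℕ × ℕ => gridPt T p.1 p.2

lemma le_endPt (t : Set.Icc (0 : ℝ≥0) T) : t ≤ endPt T := t.2.2

lemma gridPt_monotone (n : ℕ) : Monotone (gridPt T n) := fun i j h => by
  refine Subtype.mk_le_mk.2 (min_le_min_right _ ?_)
  gcongr

lemma gridIdx_monotone (n : ℕ) : Monotone (gridIdx n) := fun s t h => by
  unfold gridIdx
  gcongr

lemma gridPt_gridIdx_endPt (n : ℕ) : gridPt T n (gridIdx n T) = endPt T := by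
  refine Subtype.ext (min_eq_right ?_)
  rw [le_div_iff₀ (by positivity)]
  exact Nat.le_ceil _

lemma endPt_mem_gridSet : endPt T ∈ gridSet T := ⟨(0, gridIdx 0 T), gridPt_gridIdx_endPt 0⟩

/-- A dyadic point below `T` lies on every finer grid, and a point that was cut off is `T`, which
lies on all of them. -/
lemma eventually_gridPt_gridIdx {d : Set.Icc (0 : ℝ≥0) T} (hd : d ∈ gridSet T) :
    ∀ᶠ n in atTop, gridPt T n (gridIdx n d) = d := by
  obtain ⟨⟨i, j⟩, rfl⟩ := hd
  rcases le_total ((j : ℝ≥0) / 2 ^ i) T with h | h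
  · filter_upwards [eventually_ge_atTop i] with n hn
    have e : (gridPt T i j : ℝ≥0) = j / 2 ^ i := min_eq_left h
    have e2 : (j : ℝ≥0) / 2 ^ i * 2 ^ n = ((j * 2 ^ (n - i) : ℕ) : ℝ≥0) := by
      obtain ⟨k, rfl⟩ := Nat.exists_eq_add_of_le hn
      rw [pow_add, Nat.add_sub_cancel_left]
      push_cast
      field_simp
    refine Subtype.ext ?_
    simp only [gridIdx, e, e2, Nat.ceil_natCast]
    change min (((j * 2 ^ (n - i) : ℕ) : ℝ≥0) / 2 ^ n) T = _
    rw [← e2, mul_div_cancel_right₀ _ (by positivity), min_eq_left h]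
  · have e : gridPt T i j = endPt T := Subtype.ext (min_eq_right h)
    exact Eventually.of_forall fun n => by simp only [e]; exact gridPt_gridIdx_endPt n

lemma exists_gridSet_between {s t : Set.Icc (0 : ℝ≥0) T} (h : s < t) :
    ∃ d ∈ gridSet T, s < d ∧ d < t := by
  have h' : (s : ℝ≥0) < t := h
  obtain ⟨n, hn⟩ := exists_pow_lt_of_lt_one (tsub_pos_of_lt h') (one_half_lt_one (α := ℝ≥0))
  have h2 : (0 : ℝ≥0) < 2 ^ n := by positivity
  have hlt : ((⌊(s : ℝ≥0) * 2 ^ n⌋₊ + 1 : ℕ) : ℝ≥0) / 2 ^ n < t := by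
    have h1 : ((⌊(s : ℝ≥0) * 2 ^ n⌋₊ + 1 : ℕ) : ℝ≥0) / 2 ^ n ≤ s + (1 / 2) ^ n := by
      rw [div_le_iff₀ h2, add_mul, ← mul_pow]
      push_cast
      gcongr
      · exact Nat.floor_le (by positivity)
      · norm_num
    exact h1.trans_lt (lt_tsub_iff_left.1 hn)
  refine ⟨_, ⟨(n, ⌊(s : ℝ≥0) * 2 ^ n⌋₊ + 1), rfl⟩, ?_, ?_⟩
  · refine Subtype.mk_lt_mk.2 (lt_min ?_ (h'.trans_le t.2.2))
    rw [lt_div_iff₀ h2]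
    exact_mod_cast Nat.lt_floor_add_one _
  · exact Subtype.mk_lt_mk.2 ((min_le_left _ _).trans_lt hlt)

lemma neBot_nhdsWithin_gridSet_Ioi {t : Set.Icc (0 : ℝ≥0) T} (ht : t < endPt T) :
    (𝓝[gridSet T ∩ Set.Ioi t] t).NeBot := by
  rw [← mem_closure_iff_nhdsWithin_neBot, mem_closure_iff_nhds]
  intro V hV
  obtain ⟨u, hu, hV⟩ := exists_Ico_subset_of_mem_nhds hV ⟨_, ht⟩
  obtain ⟨d, hd, h1, h2⟩ := exists_gridSet_between hu
  exact ⟨d, hV ⟨h1.le, h2⟩, hd, h1⟩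

end DyadicGrid

/-! ### One-sided limits of paths with few oscillations -/

section RegularPath

variable {G : Type*} [NormedAddCommGroup G] {T : ℝ≥0}

/-- The path `x` has, for every `ε = 1 / (j + 1)`, boundedly many `ε`-oscillations along
infinitely many dyadic grids. -/
def RegularPath (x : Set.Icc (0 : ℝ≥0) T → G) : Prop :=
  ∀ j : ℕ, ∃ K : ℕ, ∃ᶠ n in atTop,
    resetCount (1 / ((j : ℝ) + 1)) (fun k => x (gridPt T n k)) (gridIdx n T) ≤ K

/-- Along an ultrafilter of levels with count at most `K`, each count takes finitely many values and
is therefore eventually constant. The limits form one monotone bounded function for all levels at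
once, and the oscillation bound survives because a grid point belongs to all sufficiently fine
grids. -/
lemma RegularPath.exists_monotone {x : Set.Icc (0 : ℝ≥0) T → G} (hx : RegularPath x) (j : ℕ) :
    ∃ φ : Set.Icc (0 : ℝ≥0) T → ℕ, Monotone φ ∧ (∃ K, ∀ t, φ t ≤ K) ∧
      ∀ a ∈ gridSet T, ∀ b ∈ gridSet T, a ≤ b → φ a = φ b →
        ‖x b - x a‖ < 2 * (1 / ((j : ℝ) + 1)) := by
  obtain ⟨K, hK⟩ := hx j
  set ε : ℝ := 1 / ((j : ℝ) + 1)
  have hε : 0 < ε := by positivity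
  set f : ℕ → Set.Icc (0 : ℝ≥0) T → ℕ :=
    fun n t => resetCount ε (fun k => x (gridPt T n k)) (gridIdx n t) with hf
  have hne : (atTop ⊓ 𝓟 {n | f n (endPt T) ≤ K}).NeBot := frequently_mem_iff_neBot.1 hK
  set 𝒰 : Ultrafilter ℕ := Ultrafilter.of (atTop ⊓ 𝓟 {n | f n (endPt T) ≤ K})
  have h𝒰 : (𝒰 : Filter ℕ) ≤ atTop ⊓ 𝓟 {n | f n (endPt T) ≤ K} := Ultrafilter.of_le _
  have hmono : ∀ n, Monotone (f n) := fun n s t hst =>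
    resetCount_monotone _ _ (gridIdx_monotone n hst)
  have hle : ∀ t, ∀ᶠ n in 𝒰, f n t ≤ K := fun t => by
    have : ∀ᶠ n in 𝒰, f n (endPt T) ≤ K := h𝒰 (mem_inf_of_right (mem_principal_self _))
    exact this.mono fun n hn => (hmono n (le_endPt t)).trans hn
  have hlim : ∀ t, ∃ c, ∀ᶠ n in 𝒰, f n t = c := fun t => by
    obtain ⟨c, -, hc⟩ := Ultrafilter.eq_pure_of_finite_mem (f := 𝒰.map (f · t))
      (Set.finite_Iic K) (hle t)
    refine ⟨c, ?_⟩
    have : {c} ∈ 𝒰.map (f · t) := by rw [hc]; exact Set.mem_singleton c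
    exact this
  choose φ hφ using hlim
  refine ⟨φ, fun s t hst => ?_, ⟨K, fun t => ?_⟩, fun a ha b hb hab h => ?_⟩
  · obtain ⟨n, h1, h2⟩ := ((hφ s).and (hφ t)).exists
    rw [← h1, ← h2]
    exact hmono n hst
  · obtain ⟨n, h1, h2⟩ := ((hφ t).and (hle t)).exists
    omega
  · have ha' := (h𝒰.trans inf_le_left) (eventually_gridPt_gridIdx ha)
    have hb' := (h𝒰.trans inf_le_left) (eventually_gridPt_gridIdx hb)
    obtain ⟨n, ⟨h1, h2⟩, h3, h4⟩ :=
      (((hφ a).and (hφ b)).and (Filter.Eventually.and ha' hb')).exists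
    have := norm_sub_lt_of_resetCount_eq hε (x := fun k => x (gridPt T n k))
      (gridIdx_monotone n hab) (by rw [← h1, ← h2] at h; exact h)
    simpa only [h3, h4] using this

variable [CompleteSpace G]

/-- Where the limiting count is constant, grid values differ by less than 2ε. The Cauchy criterion
is thus reduced to eventual constancy of bounded monotone integer functions along `l`. -/
lemma RegularPath.exists_tendsto {x : Set.Icc (0 : ℝ≥0) T → G} (hx : RegularPath x)
    {l : Filter (Set.Icc (0 : ℝ≥0) T)} (hl : gridSet T ∈ l)
    (hconst : ∀ φ : Set.Icc (0 : ℝ≥0) T → ℕ, Monotone φ → (∃ K, ∀ t, φ t ≤ K) →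
      ∃ c, ∀ᶠ t in l, φ t = c) : ∃ y, Tendsto x l (𝓝 y) := by
  rcases l.eq_or_neBot with rfl | hne
  · exact ⟨0, tendsto_bot⟩
  rw [← cauchy_map_iff_exists_tendsto, Metric.cauchy_iff]
  refine ⟨inferInstance, fun ε hε => ?_⟩
  obtain ⟨j, hj⟩ := exists_nat_one_div_lt (half_pos hε)
  obtain ⟨φ, h1, h2, h3⟩ := hx.exists_monotone j
  obtain ⟨c, hc⟩ := hconst φ h1 h2
  refine ⟨x '' (gridSet T ∩ {t | φ t = c}), image_mem_map (inter_mem hl hc), ?_⟩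
  have key : ∀ a ∈ gridSet T ∩ {t | φ t = c}, ∀ b ∈ gridSet T ∩ {t | φ t = c}, a ≤ b →
      dist (x b) (x a) < ε := fun a ha b hb hab => by
    rw [dist_eq_norm]
    linarith [h3 a ha.1 b hb.1 hab (ha.2.trans hb.2.symm)]
  rintro _ ⟨a, ha, rfl⟩ _ ⟨b, hb, rfl⟩
  rcases le_total a b with h | h
  · rw [dist_comm]; exact key a ha b hb h
  · exact key b hb a ha h

lemma RegularPath.exists_tendsto_right {x : Set.Icc (0 : ℝ≥0) T → G} (hx : RegularPath x)
    (t : Set.Icc (0 : ℝ≥0) T) : ∃ y, Tendsto x (𝓝[gridSet T ∩ Set.Ioi t] t) (𝓝 y) := by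
  rcases (le_endPt t).eq_or_lt with rfl | ht
  · refine ⟨0, ?_⟩
    have : Set.Ioi (endPt T) = ∅ := Set.eq_empty_of_forall_notMem fun s hs => (le_endPt s).not_gt hs
    simp [this]
  refine hx.exists_tendsto (mem_of_superset self_mem_nhdsWithin Set.inter_subset_left)
    fun φ hφ _ => ?_
  -- By well-ordering, φ attains its minimum to the right of `t`; monotonicity makes it constant
  -- between `t` and `s`.
  obtain ⟨s, hs, hmin⟩ : ∃ s ∈ Set.Ioi t, ∀ r ∈ Set.Ioi t, φ s ≤ φ r := by
    obtain ⟨c, ⟨s, hs, rfl⟩, hc⟩ := WellFounded.has_min Nat.lt_wfRel.wf (φ '' Set.Ioi t)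
      (Set.Nonempty.image _ ⟨_, ht⟩)
    exact ⟨s, hs, fun r hr => not_lt.1 (hc _ ⟨r, hr, rfl⟩)⟩
  refine ⟨φ s, ?_⟩
  filter_upwards [self_mem_nhdsWithin, mem_nhdsWithin_of_mem_nhds (Iio_mem_nhds hs)] with r hr hrs
  exact le_antisymm (hφ (le_of_lt hrs)) (hmin r hr.2)

lemma RegularPath.exists_tendsto_left {x : Set.Icc (0 : ℝ≥0) T → G} (hx : RegularPath x)
    (t : Set.Icc (0 : ℝ≥0) T) : ∃ y, Tendsto x (𝓝[gridSet T ∩ Set.Iio t] t) (𝓝 y) := by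
  rcases (Set.Iio t).eq_empty_or_nonempty with h | hne
  · exact ⟨0, by simp [h]⟩
  refine hx.exists_tendsto (mem_of_superset self_mem_nhdsWithin Set.inter_subset_left)
    fun φ hφ ⟨K, hK⟩ => ?_
  -- On the left a maximum is needed, and it exists because φ is bounded.
  obtain ⟨s, hs, hmax⟩ : ∃ s ∈ Set.Iio t, ∀ r ∈ Set.Iio t, φ r ≤ φ s := by
    have hfin : (φ '' Set.Iio t).Finite :=
      (Set.finite_Iic K).subset (by rintro _ ⟨r, -, rfl⟩; exact hK r)
    obtain ⟨c, ⟨s, hs, rfl⟩, hc⟩ := Set.exists_max_image _ id hfin (hne.image _)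
    exact ⟨s, hs, fun r hr => hc _ ⟨r, hr, rfl⟩⟩
  refine ⟨φ s, ?_⟩
  filter_upwards [self_mem_nhdsWithin, mem_nhdsWithin_of_mem_nhds (Ioi_mem_nhds hs)] with r hr hrs
  exact le_antisymm (hmax r hr.2) (hφ (le_of_lt hrs))

open Classical in
/-- The right limits of `x` along the dyadic grids, and `x` itself at the end point. -/
def rightLimPath (x : Set.Icc (0 : ℝ≥0) T → G) (t : Set.Icc (0 : ℝ≥0) T) : G :=
  if t = endPt T then x t else limUnder (𝓝[gridSet T ∩ Set.Ioi t] t) x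

lemma RegularPath.tendsto_rightLimPath {x : Set.Icc (0 : ℝ≥0) T → G} (hx : RegularPath x)
    {t : Set.Icc (0 : ℝ≥0) T} (ht : t < endPt T) :
    Tendsto x (𝓝[gridSet T ∩ Set.Ioi t] t) (𝓝 (rightLimPath x t)) := by
  have := neBot_nhdsWithin_gridSet_Ioi ht
  rw [rightLimPath, if_neg ht.ne]
  exact tendsto_nhds_limUnder (hx.exists_tendsto_right t)

/-- Since `O` is open, the grid points just to the right of `s` are still in `O`, and closed
conditions pass to the limit. With closed balls for `C`, this transfers limits from the grid to the
regularized path. -/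
lemma RegularPath.rightLimPath_mem {x : Set.Icc (0 : ℝ≥0) T → G} (hx : RegularPath x)
    {O : Set (Set.Icc (0 : ℝ≥0) T)} (hO : IsOpen O) {C : Set G} (hC : IsClosed C)
    (h : ∀ d ∈ gridSet T ∩ O, x d ∈ C) {s : Set.Icc (0 : ℝ≥0) T} (hs : s ∈ O) :
    rightLimPath x s ∈ C := by
  rcases (le_endPt s).eq_or_lt with rfl | hs'
  · rw [rightLimPath, if_pos rfl]
    exact h _ ⟨endPt_mem_gridSet, hs⟩
  · have := neBot_nhdsWithin_gridSet_Ioi hs'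
    refine hC.mem_of_tendsto (hx.tendsto_rightLimPath hs') ?_
    filter_upwards [self_mem_nhdsWithin, mem_nhdsWithin_of_mem_nhds (hO.mem_nhds hs)]
      with d hd hdO using h d ⟨hd.1, hdO⟩

lemma RegularPath.tendsto_rightLimPath_nhdsWithin {x : Set.Icc (0 : ℝ≥0) T → G}
    (hx : RegularPath x) {O : Set (Set.Icc (0 : ℝ≥0) T)} (hO : IsOpen O)
    {t : Set.Icc (0 : ℝ≥0) T} {y : G} (h : Tendsto x (𝓝[gridSet T ∩ O] t) (𝓝 y)) :
    Tendsto (rightLimPath x) (𝓝[O] t) (𝓝 y) := by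
  rw [(Metric.nhds_basis_closedBall (x := y)).tendsto_right_iff] at h ⊢
  intro ε hε
  obtain ⟨V, hV, htV, hVO⟩ := mem_nhdsWithin.1 (h ε hε)
  filter_upwards [self_mem_nhdsWithin, mem_nhdsWithin_of_mem_nhds (hV.mem_nhds htV)] with s hs hsV
  exact hx.rightLimPath_mem (hV.inter hO) Metric.isClosed_closedBall
    (fun d hd => hVO ⟨hd.2.1, hd.1, hd.2.2⟩) ⟨hsV, hs⟩

lemma RegularPath.continuousWithinAt_rightLimPath {x : Set.Icc (0 : ℝ≥0) T → G}
    (hx : RegularPath x) (t : Set.Icc (0 : ℝ≥0) T) :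
    ContinuousWithinAt (rightLimPath x) (Set.Ioi t) t := by
  rcases (le_endPt t).eq_or_lt with rfl | ht
  · have : Set.Ioi (endPt T) = ∅ := Set.eq_empty_of_forall_notMem fun s hs => (le_endPt s).not_gt hs
    simp [this, ContinuousWithinAt]
  · exact hx.tendsto_rightLimPath_nhdsWithin isOpen_Ioi (hx.tendsto_rightLimPath ht)

lemma RegularPath.exists_leftLim_rightLimPath {x : Set.Icc (0 : ℝ≥0) T → G}
    (hx : RegularPath x) (t : Set.Icc (0 : ℝ≥0) T) :
    ∃ y, Tendsto (rightLimPath x) (𝓝[<] t) (𝓝 y) :=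
  (hx.exists_tendsto_left t).imp fun _ hy => hx.tendsto_rightLimPath_nhdsWithin isOpen_Iio hy

end RegularPath

/-! ### Càdlàg versions and the maximal inequality -/

section CadlagVersion

variable {Ω G : Type*} {mΩ : MeasurableSpace Ω} {P : Measure Ω}
  [NormedAddCommGroup G] {ℱ : Filtration ℝ≥0 mΩ} {T : ℝ≥0}

/-- The filtration along the `n`-th dyadic grid. -/
def gridFiltration (ℱ : Filtration ℝ≥0 mΩ) (T : ℝ≥0) (n : ℕ) : Filtration ℕ mΩ where
  seq k := ℱ (gridPt T n k)
  mono' _ _ h := ℱ.mono (gridPt_monotone n h)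
  le' _ := ℱ.le _

/-- All null sets belong to ℱ₀, hence to ℱ_t, so a modification on a null set does not affect
measurability. -/
lemma UsualConditions.stronglyMeasurable_of_aestronglyMeasurable [SeparableSpace G]
    (hℱ : UsualConditions ℱ P)
    {t : ℝ≥0} {f : Ω → G} (hf : AEStronglyMeasurable[ℱ t] f P) : StronglyMeasurable[ℱ t] f := by
  borelize G
  have : SecondCountableTopology G := UniformSpace.secondCountable_of_separable G
  have hnull : ∀ s : Set Ω, P s = 0 → MeasurableSet[ℱ t] s := fun s hs =>
    ℱ.mono zero_le _ (hℱ.complete s hs)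
  obtain ⟨g, hg, hfg⟩ := hf
  have hN : P {ω | f ω ≠ g ω} = 0 := hfg
  refine (?_ : Measurable[ℱ t] f).stronglyMeasurable
  intro s hs
  have e : f ⁻¹' s = (g ⁻¹' s \ {ω | f ω ≠ g ω}) ∪ (f ⁻¹' s ∩ {ω | f ω ≠ g ω}) := by
    ext ω
    by_cases h : f ω = g ω <;> simp [h]
  rw [e]
  exact ((hg.measurable hs).diff (hnull _ hN)).union
    (hnull _ (measure_mono_null Set.inter_subset_right hN))

variable [InnerProductSpace ℝ G]

lemma MeasureTheory.Martingale.grid {X : Set.Icc (0 : ℝ≥0) T → Ω → G}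
    (hX : Martingale X (restrictFiltration ℱ T) P) (n : ℕ) :
    Martingale (fun k => X (gridPt T n k)) (gridFiltration ℱ T n) P :=
  ⟨fun _ => hX.1 _, fun _ _ h => hX.2 _ _ (gridPt_monotone n h)⟩

variable [CompleteSpace G] [IsFiniteMeasure P]

/-- Fatou's lemma for the counts along the grids, whose means are bounded by E‖X_T‖²/ε² uniformly in
the level. A finite lower limit controls only infinitely many levels, which is all that
`RegularPath` asks for. -/
lemma MeasureTheory.Martingale.ae_regularPath {X : Set.Icc (0 : ℝ≥0) T → Ω → G}
    (hX : Martingale X (restrictFiltration ℱ T) P) (h2 : ∀ t, MemLp (X t) 2 P) :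
    ∀ᵐ ω ∂P, RegularPath (X · ω) := by
  refine ae_all_iff.2 fun j => ?_
  set ε : ℝ := 1 / ((j : ℝ) + 1)
  have hε : 0 < ε := by positivity
  set N : ℕ → Ω → ℝ≥0∞ :=
    fun n ω => (resetCount ε (fun k => X (gridPt T n k) ω) (gridIdx n T) : ℝ≥0∞)
  have hN : ∀ n, Measurable (N n) := fun n => measurable_from_nat.comp
    ((measurable_resetCount (hX.grid n).1 ε _).mono ((gridFiltration ℱ T n).le _) le_rfl)
  have hle : ∫⁻ ω, liminf (fun n => N n ω) atTop ∂P
      ≤ ENNReal.ofReal ((∫ ω, ‖X (endPt T) ω‖ ^ 2 ∂P) / ε ^ 2) := by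
    refine (lintegral_liminf_le hN).trans ?_
    refine liminf_le_of_frequently_le' (Frequently.of_forall fun n => ?_)
    have := lintegral_resetCount_le (hX.grid n) (fun k => h2 _) ε hε (gridIdx n T)
    rwa [gridPt_gridIdx_endPt] at this
  have hfin := ae_lt_top (Measurable.liminf hN) (hle.trans_lt ENNReal.ofReal_lt_top).ne
  filter_upwards [hfin] with ω hω
  obtain ⟨K, hK⟩ := ENNReal.exists_nat_gt hω.ne
  refine ⟨K, (frequently_lt_of_liminf_lt (by isBoundedDefault) hK).mono fun n hn => ?_⟩
  have : (resetCount ε (fun k => X (gridPt T n k) ω) (gridIdx n T) : ℝ≥0∞) < K := hn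
  exact_mod_cast this.le

/-- Every grid point is eventually seen by the discrete running maxima, so their lower limit
dominates the supremum; Doob and Fatou conclude. -/
lemma MeasureTheory.Martingale.lintegral_iSup_grid_le {X : Set.Icc (0 : ℝ≥0) T → Ω → G}
    (hX : Martingale X (restrictFiltration ℱ T) P) (h2 : ∀ t, MemLp (X t) 2 P) :
    ∫⁻ ω, ⨆ p : ℕ × ℕ, ‖X (gridPt T p.1 p.2) ω‖ₑ ^ 2 ∂P
      ≤ 4 * ∫⁻ ω, ‖X (endPt T) ω‖ₑ ^ 2 ∂P := by
  set S : ℕ → Ω → ℝ≥0∞ :=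
    fun n ω => ENNReal.ofReal (runMax (fun k => X (gridPt T n k) ω) (gridIdx n T) ^ 2)
  have hS : ∀ n, Measurable (S n) := fun n => ENNReal.measurable_ofReal.comp
    (((stronglyMeasurable_runMax (hX.grid n).1 _).measurable.mono
      ((gridFiltration ℱ T n).le _) le_rfl).pow_const 2)
  have hsq : ENNReal.ofReal (4 * ∫ ω, ‖X (endPt T) ω‖ ^ 2 ∂P)
      = 4 * ∫⁻ ω, ‖X (endPt T) ω‖ₑ ^ 2 ∂P := by
    rw [ENNReal.ofReal_mul (by norm_num), ofReal_integral_eq_lintegral_ofReal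
      ((h2 _).integrable_norm_pow (by simp)) (ae_of_all _ fun ω => by positivity)]
    simp [ENNReal.ofReal_pow]
  calc ∫⁻ ω, ⨆ p : ℕ × ℕ, ‖X (gridPt T p.1 p.2) ω‖ₑ ^ 2 ∂P
      ≤ ∫⁻ ω, liminf (fun n => S n ω) atTop ∂P := by
        refine lintegral_mono fun ω => iSup_le fun p => ?_
        refine le_liminf_of_le (by isBoundedDefault) ?_
        filter_upwards [eventually_gridPt_gridIdx (d := gridPt T p.1 p.2) ⟨p, rfl⟩] with n hn
        have h1 := norm_le_runMax (fun k => X (gridPt T n k) ω) (gridIdx n (gridPt T p.1 p.2))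
        have h3 := runMax_monotone (fun k => X (gridPt T n k) ω)
          (gridIdx_monotone n (gridPt T p.1 p.2).2.2)
        rw [hn] at h1
        rw [← ofReal_norm, ← ENNReal.ofReal_pow (norm_nonneg _)]
        exact ENNReal.ofReal_le_ofReal (pow_le_pow_left₀ (norm_nonneg _) (h1.trans h3) 2)
    _ ≤ liminf (fun n => ∫⁻ ω, S n ω ∂P) atTop := lintegral_liminf_le hS
    _ ≤ _ := by
        refine liminf_le_of_frequently_le' (Frequently.of_forall fun n => ?_)
        have := lintegral_runMax_sq_le (hX.grid n) (fun k => h2 _) (gridIdx n T)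
        rwa [gridPt_gridIdx_endPt, hsq] at this

/-- Every conditional expectation process of a square integrable variable has a càdlàg version. -/
theorem exists_cadlag_condExp [SeparableSpace G] (hℱ : UsualConditions ℱ P)
    {ξ : Ω → G} (hξ : MemLp ξ 2 P) :
    ∃ X : Set.Icc (0 : ℝ≥0) T → Ω → G, IsCadlagL2Martingale ℱ P T X ∧
      ∀ t, X t =ᵐ[P] P[ξ|ℱ t] := by
  classical
  set Z : Set.Icc (0 : ℝ≥0) T → Ω → G := fun t => P[ξ|ℱ t] with hZ
  have hZm : Martingale Z (restrictFiltration ℱ T) P :=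
    ⟨fun t => stronglyMeasurable_condExp, fun s t hst =>
      condExp_condExp_of_le (ℱ.mono hst) (ℱ.le _)⟩
  have hZ2 : ∀ t, MemLp (Z t) 2 P := fun t => hξ.condExp one_le_two
  -- The value 0 on the exceptional event makes every path càdlàg, not just almost every one.
  set X : Set.Icc (0 : ℝ≥0) T → Ω → G :=
    fun t ω => if RegularPath (Z · ω) then rightLimPath (Z · ω) t else 0 with hX
  have hreg := hZm.ae_regularPath hZ2
  have hXZ : ∀ t, X t =ᵐ[P] Z t := by
    intro t
    rcases (le_endPt t).eq_or_lt with rfl | ht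
    · filter_upwards [hreg] with ω hω
      simp [hX, hω, rightLimPath]
    have := neBot_nhdsWithin_gridSet_Ioi ht
    obtain ⟨d, hd⟩ := exists_seq_tendsto (𝓝[gridSet T ∩ Set.Ioi t] t)
    have hlim : ∀ᵐ ω ∂P, Tendsto (fun n => Z (d n) ω) atTop (𝓝 (X t ω)) := by
      filter_upwards [hreg] with ω hω
      simp only [hX, hω, if_true]
      exact (hω.tendsto_rightLimPath ht).comp hd
    -- The right limit uses only grid times before `u`, so it is measurable for every ℱ_u with u >
    -- t; right continuity of the filtration then brings it down to ℱ_t.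
    have hmeas : ∀ u, (t : ℝ≥0) < u → StronglyMeasurable[ℱ u] (X t) := by
      intro u hu
      have hset : MeasurableSet[ℱ u] {ω | RegularPath (Z · ω)} :=
        (ℱ.mono zero_le _ (hℱ.complete {ω | ¬ RegularPath (Z · ω)} hreg)).of_compl
      have hev : ∀ᶠ n in atTop, (d n : ℝ≥0) < u := by
        have h1 := hd.mono_right (nhdsWithin_le_nhds)
        exact ((continuous_subtype_val.tendsto t).comp h1).eventually_lt_const hu
      obtain ⟨n₀, hn₀⟩ := eventually_atTop.1 hev
      refine stronglyMeasurable_of_tendsto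
        (f := fun n => {ω | RegularPath (Z · ω)}.indicator (Z (d (n + n₀)))) atTop
        (fun n => ((hZm.1 (d (n + n₀))).mono
          (ℱ.mono (hn₀ (n + n₀) (Nat.le_add_left _ _)).le)).indicator hset) ?_
      refine tendsto_pi_nhds.2 fun ω => ?_
      by_cases hω : RegularPath (Z · ω)
      · simp only [hX, hω, if_true, Set.indicator, Set.mem_ofPred_eq]
        exact ((hω.tendsto_rightLimPath ht).comp hd).comp (tendsto_add_atTop_nat n₀)
      · simp [hX, hω, Set.indicator]
    have hmeas_t : StronglyMeasurable[ℱ t] (X t) := by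
      borelize G
      have : SecondCountableTopology G := UniformSpace.secondCountable_of_separable G
      refine (?_ : Measurable[ℱ t] (X t)).stronglyMeasurable
      intro s hs
      have := hℱ.rightContinuous
      refine Filtration.IsRightContinuous.measurableSet ?_
      rw [Filtration.rightCont_eq]
      simp only [MeasurableSpace.measurableSet_iInf]
      exact fun u hu => (hmeas u hu).measurable hs
    -- The maximal function is square integrable by Doob, and a ≤ a² + 1 turns its square into an
    -- integrable bound for all grid values.
    set b : Ω → ℝ≥0∞ := fun ω => ⨆ p : ℕ × ℕ, ‖Z (gridPt T p.1 p.2) ω‖ₑ ^ 2 with hb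
    have hb_meas : AEMeasurable b P := AEMeasurable.iSup fun p => (hZ2 _).1.enorm.pow_const 2
    have hb_fin : ∫⁻ ω, b ω ∂P ≠ ∞ := by
      refine ne_top_of_le_ne_top (ENNReal.mul_ne_top (by simp) ?_)
        (hZm.lintegral_iSup_grid_le hZ2)
      have := (hZ2 (endPt T)).eLpNorm_lt_top
      rw [eLpNorm_lt_top_iff_lintegral_rpow_enorm_lt_top (by simp) (by simp)] at this
      simpa using this.ne
    have hb_int := integrable_toReal_of_lintegral_ne_top hb_meas hb_fin
    have hdom : ∀ n, d n ∈ gridSet T → ∀ᵐ ω ∂P, ‖Z (d n) ω‖ ≤ (b ω).toReal + 1 := by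
      intro n ⟨p, hp⟩
      filter_upwards [ae_lt_top' hb_meas hb_fin] with ω hω
      have h1 : ‖Z (d n) ω‖ₑ ^ 2 ≤ b ω := by
        rw [← hp]
        exact le_iSup (fun p : ℕ × ℕ => ‖Z (gridPt T p.1 p.2) ω‖ₑ ^ 2) p
      have h2 : ‖Z (d n) ω‖ ^ 2 ≤ (b ω).toReal := by
        have := ENNReal.toReal_mono hω.ne h1
        simpa using this
      nlinarith [norm_nonneg (Z (d n) ω)]
    have hev_mem : ∀ᶠ n in atTop, d n ∈ gridSet T ∩ Set.Ioi t :=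
      hd.eventually self_mem_nhdsWithin
    have hX_int : Integrable (X t) P := by
      refine (hb_int.add (integrable_const (1 : ℝ))).mono'
        (hmeas_t.mono (ℱ.le t)).aestronglyMeasurable ?_
      obtain ⟨n₀, hn₀⟩ := eventually_atTop.1 hev_mem
      have hall : ∀ᵐ ω ∂P, ∀ n, ‖Z (d (n + n₀)) ω‖ ≤ (b ω).toReal + 1 :=
        ae_all_iff.2 fun n => hdom _ (hn₀ _ (Nat.le_add_left _ _)).1
      filter_upwards [hlim, hall] with ω h1 h2
      exact le_of_tendsto' (h1.comp (tendsto_add_atTop_nat n₀)).norm h2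
    refine ae_eq_condExp_of_forall_setIntegral_eq (ℱ.le t) (hξ.integrable one_le_two)
      (fun _ _ _ => hX_int.integrableOn) (fun B hB _ => ?_) hmeas_t.aestronglyMeasurable
    have hconv : Tendsto (fun n => ∫ ω in B, Z (d n) ω ∂P) atTop (𝓝 (∫ ω in B, X t ω ∂P)) := by
      refine tendsto_integral_filter_of_dominated_convergence (fun ω => (b ω).toReal + 1)
        (Eventually.of_forall fun n => (hZ2 _).1.restrict) ?_
        (hb_int.add (integrable_const (1 : ℝ))).integrableOn (ae_restrict_of_ae hlim)
      filter_upwards [hev_mem] with n hn using ae_restrict_of_ae (hdom n hn.1)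
    -- The grid times lie after `t`, so over an event of ℱ_t each integral already equals that of ξ;
    -- passing to the limit identifies `X t` as the conditional expectation.
    have hconst : ∀ᶠ n in atTop, ∫ ω in B, Z (d n) ω ∂P = ∫ ω in B, ξ ω ∂P := by
      filter_upwards [hev_mem] with n hn
      exact setIntegral_condExp (ℱ.le _) (hξ.integrable one_le_two)
        (ℱ.mono (Subtype.coe_le_coe.2 (le_of_lt hn.2)) _ hB)
    exact tendsto_nhds_unique hconv (tendsto_const_nhds.congr' (hconst.mono fun _ h => h.symm))
  refine ⟨X, ⟨⟨fun t => ?_, fun s t hst => ?_⟩, fun t => ?_, fun ω t => ?_, fun ω t => ?_⟩, hXZ⟩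
  · exact hℱ.stronglyMeasurable_of_aestronglyMeasurable
      ((hZm.1 t).aestronglyMeasurable.congr (hXZ t).symm)
  · exact (condExp_congr_ae (hXZ t)).trans ((hZm.2 s t hst).trans (hXZ s).symm)
  · exact (hZ2 t).ae_eq (hXZ t).symm
  · by_cases h : RegularPath (Z · ω)
    · simp only [hX, h, if_true]
      exact h.continuousWithinAt_rightLimPath t
    · simp only [hX, h, if_false]
      exact continuousWithinAt_const
  · by_cases h : RegularPath (Z · ω)
    · simp only [hX, h, if_true]
      exact h.exists_leftLim_rightLimPath t
    · simp only [hX, h, if_false]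
      exact ⟨0, tendsto_const_nhds⟩

end CadlagVersion

section RightContinuousPaths

variable {G : Type*} {T : ℝ≥0}

/-- Right-continuous paths are governed by their grid values. Used with `{0}` to upgrade
modifications to indistinguishability, and with a closed ball to extend the maximal inequality to
all times. -/
lemma mem_of_forall_gridSet [TopologicalSpace G] {x : Set.Icc (0 : ℝ≥0) T → G}
    (hx : ∀ t, ContinuousWithinAt x (Set.Ioi t) t) {C : Set G} (hC : IsClosed C)
    (h : ∀ d ∈ gridSet T, x d ∈ C) (t : Set.Icc (0 : ℝ≥0) T) : x t ∈ C := by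
  rcases (le_endPt t).eq_or_lt with rfl | ht
  · exact h _ endPt_mem_gridSet
  · have := neBot_nhdsWithin_gridSet_Ioi ht
    have hlim : Tendsto x (𝓝[gridSet T ∩ Set.Ioi t] t) (𝓝 (x t)) :=
      (hx t).mono_left (nhdsWithin_mono t Set.inter_subset_right)
    refine hC.mem_of_tendsto hlim ?_
    filter_upwards [self_mem_nhdsWithin] with d hd using h d hd.1

variable {Ω : Type*} {mΩ : MeasurableSpace Ω} {P : Measure Ω}

lemma indistinguishable_of_modification [NormedAddCommGroup G]
    {X Y : Set.Icc (0 : ℝ≥0) T → Ω → G}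
    (hX : ∀ ω t, ContinuousWithinAt (X · ω) (Set.Ioi t) t)
    (hY : ∀ ω t, ContinuousWithinAt (Y · ω) (Set.Ioi t) t) (h : ∀ t, X t =ᵐ[P] Y t) :
    ∀ᵐ ω ∂P, ∀ t, X t ω = Y t ω := by
  have : ∀ᵐ ω ∂P, ∀ p : ℕ × ℕ, X (gridPt T p.1 p.2) ω = Y (gridPt T p.1 p.2) ω :=
    ae_all_iff.2 fun p => h _
  filter_upwards [this] with ω hω t
  have := mem_of_forall_gridSet (x := fun t => X t ω - Y t ω) (C := {0})
    (fun t => (hX ω t).sub (hY ω t)) isClosed_singleton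
    (by rintro _ ⟨p, rfl⟩; simp [hω p]) t
  simpa [sub_eq_zero] using this

lemma IsCadlagL2Martingale.m2Norm_le [NormedAddCommGroup G] [InnerProductSpace ℝ G]
    [CompleteSpace G] [IsFiniteMeasure P] {ℱ : Filtration ℝ≥0 mΩ}
    {X : Set.Icc (0 : ℝ≥0) T → Ω → G} (hX : IsCadlagL2Martingale ℱ P T X) :
    m2Norm P T X ≤ 2 * (∫⁻ ω, ‖X (endPt T) ω‖ₑ ^ 2 ∂P) ^ (1 / 2 : ℝ) := by
  have h1 : ∫⁻ ω, ⨆ t, ‖X t ω‖ₑ ^ 2 ∂P ≤ 4 * ∫⁻ ω, ‖X (endPt T) ω‖ₑ ^ 2 ∂P := by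
    refine le_trans (lintegral_mono fun ω => iSup_le fun t => ?_)
      (hX.martingale.lintegral_iSup_grid_le hX.memLp)
    refine mem_of_forall_gridSet (hX.right_continuous ω)
      (C := {y : G | ‖y‖ₑ ^ 2 ≤ ⨆ p : ℕ × ℕ, ‖X (gridPt T p.1 p.2) ω‖ₑ ^ 2})
      (isClosed_le (by fun_prop) continuous_const) ?_ t
    rintro _ ⟨p, rfl⟩
    exact le_iSup (fun p : ℕ × ℕ => ‖X (gridPt T p.1 p.2) ω‖ₑ ^ 2) p
  have h4 : (4 : ℝ≥0∞) ^ (1 / 2 : ℝ) = 2 := by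
    rw [show (4 : ℝ≥0∞) = 2 ^ (2 : ℝ) by norm_num, ← ENNReal.rpow_mul]
    norm_num
  calc m2Norm P T X ≤ (4 * ∫⁻ ω, ‖X (endPt T) ω‖ₑ ^ 2 ∂P) ^ (1 / 2 : ℝ) :=
        ENNReal.rpow_le_rpow h1 (by norm_num)
    _ = _ := by rw [ENNReal.mul_rpow_of_nonneg _ _ (by norm_num), h4]

end RightContinuousPaths

/-! ### Parseval families and Hilbert–Schmidt norms -/

section Parseval

open InnerProductSpace

variable {K G : Type*} [NormedAddCommGroup K] [InnerProductSpace ℝ K] [CompleteSpace K]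
  [NormedAddCommGroup G] [InnerProductSpace ℝ G]

lemma HilbertBasis.tsum_enorm_inner_sq {ι : Type*} (b : HilbertBasis ι ℝ K) (y : K) :
    ∑' i, ‖(inner ℝ y (b i) : ℝ)‖ₑ ^ 2 = ‖y‖ₑ ^ 2 := by
  have h := b.hasSum_inner_mul_inner y y
  have e : ∀ i, (inner ℝ y (b i) * inner ℝ (b i) y : ℝ) = ‖(inner ℝ y (b i) : ℝ)‖ ^ 2 := fun i => by
    rw [real_inner_comm y (b i), Real.norm_eq_abs, sq_abs, sq]
  simp_rw [e, real_inner_self_eq_norm_sq] at h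
  rw [← ofReal_norm, ← ENNReal.ofReal_pow (norm_nonneg _), ← h.tsum_eq,
    ENNReal.ofReal_tsum_of_nonneg (fun i => by positivity) h.summable]
  exact tsum_congr fun i => by rw [ENNReal.ofReal_pow (norm_nonneg _), ofReal_norm]

/-- Discarding the zero vectors leaves a Hilbert basis, and the zero vectors contribute nothing to
the sum. Keeping them fixes the index set ℕ, whatever the dimension of the space, which matters
since that of H_{q_{r,u}} may vary with (r,u). -/
lemma tsum_enorm_inner_gramSchmidtNormed_sq {f : ℕ → K} (hf : DenseRange f) (y : K) :
    ∑' n, ‖(inner ℝ y (gramSchmidtNormed ℝ f n) : ℝ)‖ₑ ^ 2 = ‖y‖ₑ ^ 2 := by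
  have ho := gramSchmidtNormed_orthonormal' (𝕜 := ℝ) f
  have hspan : ⊤ ≤ (Submodule.span ℝ (Set.range
      fun i : {i // gramSchmidtNormed ℝ f i ≠ 0} => gramSchmidtNormed ℝ f i)).topologicalClosure := by
    have h1 : Submodule.span ℝ (Set.range f) ≤ Submodule.span ℝ (Set.range
        fun i : {i // gramSchmidtNormed ℝ f i ≠ 0} => gramSchmidtNormed ℝ f i) := by
      rw [← span_gramSchmidt ℝ f, ← span_gramSchmidtNormed_range, Submodule.span_le]
      rintro _ ⟨i, rfl⟩
      by_cases hi : gramSchmidtNormed ℝ f i = 0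
      · rw [hi]; exact Submodule.zero_mem _
      · exact Submodule.subset_span ⟨⟨i, hi⟩, rfl⟩
    intro x _
    exact closure_mono (Submodule.subset_span.trans h1) (hf x)
  have h := (HilbertBasis.mk ho hspan).tsum_enorm_inner_sq y
  rw [HilbertBasis.coe_mk] at h
  rw [← h]
  symm
  refine tsum_subtype_eq_of_support_subset
    (f := fun n => ‖(inner ℝ y (gramSchmidtNormed ℝ f n) : ℝ)‖ₑ ^ 2)
    (s := {i | gramSchmidtNormed ℝ f i ≠ 0}) ?_
  intro n hn h0
  exact hn (by simp [h0])

lemma inner_gramSchmidtNormed_of_ne (f : ℕ → G) {m n : ℕ} (h : m ≠ n) :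
    (inner ℝ (gramSchmidtNormed ℝ f m) (gramSchmidtNormed ℝ f n) : ℝ) = 0 := by
  simp [gramSchmidtNormed, inner_smul_left, inner_smul_right, gramSchmidt_orthogonal ℝ f h]

lemma inner_gramSchmidtNormed_self (f : ℕ → G) {m : ℕ} (h : gramSchmidtNormed ℝ f m ≠ 0) :
    (inner ℝ (gramSchmidtNormed ℝ f m) (gramSchmidtNormed ℝ f m) : ℝ) = 1 := by
  rw [real_inner_self_eq_norm_sq, gramSchmidtNormed_unit_length' h, one_pow]

variable [CompleteSpace G]

/-- Interchange of summation in the double array of squared matrix entries. The norm is thereby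
computed from vectors of `G`, which do not depend on (r,u). -/
lemma hsNormSq_eq_tsum_adjoint {g : ℕ → G}
    (hg : ∀ y : G, ∑' m, ‖(inner ℝ y (g m) : ℝ)‖ₑ ^ 2 = ‖y‖ₑ ^ 2) (S : K →L[ℝ] G) :
    hsNormSq S = ∑' m, ‖ContinuousLinearMap.adjoint S (g m)‖ₑ ^ 2 := by
  obtain ⟨b, hb⟩ := (exists_hilbertBasis ℝ K).choose_spec
  simp_rw [hsNormSq, ← hg (S _)]
  rw [ENNReal.tsum_comm]
  refine tsum_congr fun m => ?_
  rw [← b.tsum_enorm_inner_sq (ContinuousLinearMap.adjoint S (g m))]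
  refine tsum_congr fun e => ?_
  rw [ContinuousLinearMap.adjoint_inner_left, real_inner_comm, hb]

/-- A countable Parseval family of orthogonal vectors, each of norm one or zero. -/
def parsevalSeq (G : Type*) [NormedAddCommGroup G] [InnerProductSpace ℝ G] [SeparableSpace G]
    (n : ℕ) : G :=
  gramSchmidtNormed ℝ (denseSeq G) n

lemma tsum_enorm_inner_parsevalSeq_sq [SeparableSpace G] (y : G) :
    ∑' m, ‖(inner ℝ y (parsevalSeq G m) : ℝ)‖ₑ ^ 2 = ‖y‖ₑ ^ 2 :=
  tsum_enorm_inner_gramSchmidtNormed_sq (denseRange_denseSeq G) y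

end Parseval

/-! ### Measurable orthonormalization in the spaces H_q -/

namespace HilbertianSeminorm

open InnerProductSpace

variable {H : Type*} [NormedAddCommGroup H] [InnerProductSpace ℝ H] [SeparableSpace H]

/-- The image in `H_q` of a dense sequence of `H`. -/
def denseIncl (q : HilbertianSeminorm H) (n : ℕ) : q.Space := q.incl (denseSeq H n)

lemma denseRange_denseIncl (q : HilbertianSeminorm H) : DenseRange q.denseIncl := by
  have h1 : DenseRange q.incl := by
    have h2 : Function.Surjective q.toPreL := fun y => ⟨q.toPre.symm y, by
      change q.toPre (q.toPre.symm y) = y; simp⟩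
    exact (UniformSpace.Completion.denseRange_coe (α := q.Pre)).comp h2.denseRange
      (UniformSpace.Completion.continuous_coe _)
  exact h1.comp (denseRange_denseSeq H) q.incl.continuous

/-- A countable Parseval family in `H_q`, obtained by orthonormalization from `H`. -/
def frame (q : HilbertianSeminorm H) (n : ℕ) : q.Space := gramSchmidtNormed ℝ q.denseIncl n

lemma tsum_enorm_inner_frame_sq (q : HilbertianSeminorm H) (y : q.Space) :
    ∑' n, ‖(inner ℝ y (q.frame n) : ℝ)‖ₑ ^ 2 = ‖y‖ₑ ^ 2 :=
  tsum_enorm_inner_gramSchmidtNormed_sq q.denseRange_denseIncl y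

variable {α : Type*} [MeasurableSpace α]

/-- Strong induction along the Gram–Schmidt recursion. The field `y` is quantified inside the
induction because the coefficients need the earlier cases for `y` in the range of i_q and for `y` an
earlier Gram–Schmidt vector. -/
lemma measurable_inner_gramSchmidt {q : α → HilbertianSeminorm H}
    (hq : ∀ h₁ h₂, Measurable fun a => (q a).form h₁ h₂) (n : ℕ) :
    ∀ y : ∀ a, (q a).Space, (∀ h, Measurable fun a => (inner ℝ (y a) ((q a).incl h) : ℝ)) →
      Measurable fun a => (inner ℝ (y a) (gramSchmidt ℝ (q a).denseIncl n) : ℝ) := by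
  induction n using Nat.strong_induction_on with
  | _ n ih =>
    intro y hy
    have e : ∀ a, (inner ℝ (y a) (gramSchmidt ℝ (q a).denseIncl n) : ℝ)
        = inner ℝ (y a) ((q a).denseIncl n) - ∑ i ∈ Finset.Iio n,
          (inner ℝ ((q a).denseIncl n) (gramSchmidt ℝ (q a).denseIncl i) /
            inner ℝ (gramSchmidt ℝ (q a).denseIncl i) (gramSchmidt ℝ (q a).denseIncl i)) *
            inner ℝ (y a) (gramSchmidt ℝ (q a).denseIncl i) := fun a => by
      rw [gramSchmidt_def, inner_sub_right, inner_sum]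
      congr 1
      refine Finset.sum_congr rfl fun i _ => ?_
      rw [Submodule.starProjection_singleton, inner_smul_right, real_inner_self_eq_norm_sq,
        real_inner_comm]
      simp
    simp_rw [e]
    refine (hy _).sub (Finset.measurable_fun_sum _ fun i hi => ?_)
    have hi' : i < n := Finset.mem_Iio.1 hi
    have hincl : ∀ h, Measurable fun a =>
        (inner ℝ ((q a).incl h) (gramSchmidt ℝ (q a).denseIncl i) : ℝ) := fun h =>
      ih i hi' (fun a => (q a).incl h) fun h' => by simpa only [inner_incl] using hq h h'
    refine ((hincl _).div (ih i hi' _ fun h => ?_)).mul (ih i hi' y hy)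
    simpa only [real_inner_comm] using hincl h

lemma measurable_inner_frame {q : α → HilbertianSeminorm H}
    (hq : ∀ h₁ h₂, Measurable fun a => (q a).form h₁ h₂) {y : ∀ a, (q a).Space}
    (hy : ∀ h, Measurable fun a => (inner ℝ (y a) ((q a).incl h) : ℝ)) (n : ℕ) :
    Measurable fun a => (inner ℝ (y a) ((q a).frame n) : ℝ) := by
  have hgs : ∀ h, Measurable fun a =>
      (inner ℝ (gramSchmidt ℝ (q a).denseIncl n) ((q a).incl h) : ℝ) := fun h => by
    simp_rw [real_inner_comm ((q _).incl h)]
    exact measurable_inner_gramSchmidt hq n (fun a => (q a).incl h) fun h' => by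
      simpa only [inner_incl] using hq h h'
  have e : ∀ a, (inner ℝ (y a) ((q a).frame n) : ℝ)
      = (√(inner ℝ (gramSchmidt ℝ (q a).denseIncl n) (gramSchmidt ℝ (q a).denseIncl n)))⁻¹ *
        inner ℝ (y a) (gramSchmidt ℝ (q a).denseIncl n) := fun a => by
    rw [frame, gramSchmidtNormed, inner_smul_right, norm_eq_sqrt_real_inner]
    simp
  simp_rw [e]
  exact (measurable_inner_gramSchmidt hq n _ hgs).sqrt.inv.mul
    (measurable_inner_gramSchmidt hq n y hy)

/-- Triangularity of the orthonormalization. -/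
lemma inner_frame_denseIncl_of_lt (q : HilbertianSeminorm H) {k n : ℕ} (h : k < n) :
    (inner ℝ (q.denseIncl k) (q.frame n) : ℝ) = 0 := by
  rw [frame, gramSchmidtNormed, inner_smul_right, real_inner_comm,
    gramSchmidt_inv_triangular ℝ _ h, mul_zero]

/-- Only the component along the n-th Gram–Schmidt vector survives, and the inner product is its
norm. These are the diagonal entries of the triangular system in `ae_coord_eq_zero_of_orthogonal`.
-/
lemma inner_frame_denseIncl_self_ne_zero (q : HilbertianSeminorm H) {n : ℕ} (h : q.frame n ≠ 0) :
    (inner ℝ (q.denseIncl n) (q.frame n) : ℝ) ≠ 0 := by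
  have hgs : gramSchmidt ℝ q.denseIncl n ≠ 0 := fun h0 => h (by simp [frame, gramSchmidtNormed, h0])
  have h1 : (inner ℝ (q.denseIncl n) (gramSchmidt ℝ q.denseIncl n) : ℝ)
      = inner ℝ (gramSchmidt ℝ q.denseIncl n) (gramSchmidt ℝ q.denseIncl n) := by
    conv_lhs => rw [gramSchmidt_def'' ℝ q.denseIncl n]
    rw [inner_add_left, sum_inner, Finset.sum_eq_zero, add_zero]
    intro i hi
    rw [inner_smul_left, gramSchmidt_orthogonal ℝ _ (Finset.mem_Iio.1 hi).ne, mul_zero]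
  rw [frame, gramSchmidtNormed, inner_smul_right, h1]
  simp [hgs]

end HilbertianSeminorm

/-! ### The coordinates of an integrand -/

section Coordinates

variable {Ω U H G : Type*} {mΩ : MeasurableSpace Ω} [MeasurableSpace U]

/-- `[0, T] × Ω` with the predictable `σ`-algebra. -/
@[nolint unusedArguments]
def PredSpace (_ℱ : Filtration ℝ≥0 mΩ) (T : ℝ≥0) : Type _ := Set.Icc (0 : ℝ≥0) T × Ω

instance (ℱ : Filtration ℝ≥0 mΩ) (T : ℝ≥0) : MeasurableSpace (PredSpace ℱ T) := predictableOn ℱ T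

/-- The time component. -/
def PredSpace.time {ℱ : Filtration ℝ≥0 mΩ} {T : ℝ≥0} (p : PredSpace ℱ T) : Set.Icc (0 : ℝ≥0) T :=
  Prod.fst p

/-- The random component. -/
def PredSpace.state {ℱ : Filtration ℝ≥0 mΩ} {T : ℝ≥0} (p : PredSpace ℱ T) : Ω := Prod.snd p

/-- The point of `PredSpace ℱ T` with given components. -/
def PredSpace.mk {ℱ : Filtration ℝ≥0 mΩ} {T : ℝ≥0} (p : Set.Icc (0 : ℝ≥0) T × Ω) : PredSpace ℱ T :=
  p

@[simp]
lemma PredSpace.time_mk {ℱ : Filtration ℝ≥0 mΩ} {T : ℝ≥0} (p : Set.Icc (0 : ℝ≥0) T × Ω) :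
    (PredSpace.mk (ℱ := ℱ) p).time = p.1 := rfl

lemma measurable_predSpace_incl (ℱ : Filtration ℝ≥0 mΩ) (T : ℝ≥0) :
    @Measurable _ _ _ ℱ.predictable
      (fun p : PredSpace ℱ T => (((p.time : ℝ≥0), p.state) : ℝ≥0 × Ω)) :=
  measurable_iff_comap_le.2 le_rfl

lemma measurableSet_predSpace_Ioi {ℱ : Filtration ℝ≥0 mΩ} {T : ℝ≥0} (s : ℝ≥0) {F : Set Ω}
    (hF : MeasurableSet[ℱ s] F) :
    MeasurableSet {p : PredSpace ℱ T | s < (p.time : ℝ≥0) ∧ p.state ∈ F} := by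
  have h := measurable_predSpace_incl ℱ T (measurableSet_predictable_Ioi_prod hF)
  exact h

lemma measurable_time {ℱ : Filtration ℝ≥0 mΩ} {T : ℝ≥0} :
    Measurable fun p : PredSpace ℱ T => (p.time : ℝ≥0) := by
  refine measurable_of_Ioi fun s => ?_
  convert measurableSet_predSpace_Ioi (ℱ := ℱ) (T := T) s (F := Set.univ) MeasurableSet.univ
    using 1
  ext p
  simp

/-- The generators of the predictable σ-algebra are measurable rectangles, so the product measure
can be pushed forward to `PredSpace`. -/
lemma measurable_toPredSpace (ℱ : Filtration ℝ≥0 mΩ) (T : ℝ≥0) :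
    Measurable (PredSpace.mk : Set.Icc (0 : ℝ≥0) T × Ω → PredSpace ℱ T) := by
  have h : @Measurable _ _ _ ℱ.predictable
      (fun p : Set.Icc (0 : ℝ≥0) T × Ω => ((p.1 : ℝ≥0), p.2)) := by
    refine measurable_generateFrom ?_
    rintro _ (⟨A, hA, rfl⟩ | ⟨i, A, hA, rfl⟩)
    · exact (measurable_subtype_coe.comp measurable_fst (measurableSet_singleton _)).inter
        (measurable_snd (ℱ.le _ _ hA))
    · exact (measurable_subtype_coe.comp measurable_fst measurableSet_Ioi).inter
        (measurable_snd (ℱ.le _ _ hA))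
  rintro _ ⟨s, hs, rfl⟩
  exact h hs

/-- The restriction of `lam` to `(0, T]`. -/
def timeMeasure (lam : Measure ℝ≥0) (T : ℝ≥0) : Measure (Set.Icc (0 : ℝ≥0) T) :=
  (lam.comap Subtype.val).restrict {r | 0 < (r : ℝ≥0)}

lemma isFiniteMeasure_timeMeasure {lam : Measure ℝ≥0} {T : ℝ≥0} (h : lam (Set.Icc 0 T) < ∞) :
    IsFiniteMeasure (timeMeasure lam T) := by
  have : IsFiniteMeasure (lam.comap (Subtype.val : Set.Icc (0 : ℝ≥0) T → ℝ≥0)) := ⟨by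
    rw [comap_subtype_coe_apply measurableSet_Icc, Set.image_univ, Subtype.range_coe]
    exact h⟩
  unfold timeMeasure
  infer_instance

/-- The measure `lam ⊗ P` on the predictable sets. -/
def predMeasure (ℱ : Filtration ℝ≥0 mΩ) (P : Measure Ω) (lam : Measure ℝ≥0) (T : ℝ≥0) :
    Measure (PredSpace ℱ T) :=
  Measure.map PredSpace.mk ((timeMeasure lam T).prod P)

/-- The measure `lam ⊗ P ⊗ μ` on the domain of the integrands. -/
def intMeasure (ℱ : Filtration ℝ≥0 mΩ) (P : Measure Ω) (μ : Measure U) (lam : Measure ℝ≥0)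
    (T : ℝ≥0) : Measure (PredSpace ℱ T × U) :=
  (predMeasure ℱ P lam T).prod μ

/-- The measure `lam ⊗ P ⊗ μ ⊗ #` on the domain of the coordinates of the integrands. -/
def coordMeasure (ℱ : Filtration ℝ≥0 mΩ) (P : Measure Ω) (μ : Measure U) (lam : Measure ℝ≥0)
    (T : ℝ≥0) : Measure ((PredSpace ℱ T × U) × (ℕ × ℕ)) :=
  (intMeasure ℱ P μ lam T).prod Measure.count

variable {ℱ : Filtration ℝ≥0 mΩ} {P : Measure Ω} {μ : Measure U} {lam : Measure ℝ≥0} {T : ℝ≥0}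

lemma isFiniteMeasure_predMeasure [IsFiniteMeasure P] (h : lam (Set.Icc 0 T) < ∞) :
    IsFiniteMeasure (predMeasure ℱ P lam T) := by
  have := isFiniteMeasure_timeMeasure h
  unfold predMeasure
  infer_instance

lemma lintegral_intMeasure [IsFiniteMeasure P] [SigmaFinite μ] (h : lam (Set.Icc 0 T) < ∞)
    {f : PredSpace ℱ T × U → ℝ≥0∞} (hf : Measurable f) :
    ∫⁻ x, f x ∂(intMeasure ℱ P μ lam T)
      = ∫⁻ ω, ∫⁻ r, ∫⁻ u, f (PredSpace.mk (r, ω), u) ∂μ ∂(timeMeasure lam T) ∂P := by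
  have := isFiniteMeasure_timeMeasure h
  have := isFiniteMeasure_predMeasure (ℱ := ℱ) (P := P) h
  have hm : Measurable fun p : PredSpace ℱ T => ∫⁻ u, f (p, u) ∂μ := hf.lintegral_prod_right'
  rw [intMeasure, lintegral_prod _ hf.aemeasurable, predMeasure,
    lintegral_map hm (measurable_toPredSpace ℱ T)]
  exact lintegral_prod_symm _ (hm.comp (measurable_toPredSpace ℱ T)).aemeasurable

variable [NormedAddCommGroup H] [InnerProductSpace ℝ H] [SeparableSpace H]
  [NormedAddCommGroup G] [InnerProductSpace ℝ G] [CompleteSpace G] [SeparableSpace G]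
  {q : ℝ≥0 → U → HilbertianSeminorm H}

/-- The coordinates of the operators `Φ(r,ω,u)` for Parseval families of `H_{q_{r,u}}` and `G`. -/
def coord (ℱ : Filtration ℝ≥0 mΩ) (Φ : OperatorFamily Ω G q T)
    (z : (PredSpace ℱ T × U) × (ℕ × ℕ)) : ℝ :=
  inner ℝ (ContinuousLinearMap.adjoint (Φ z.1.1.time z.1.1.state z.1.2) (parsevalSeq G z.2.1))
    ((q z.1.1.time z.1.2).frame z.2.2)

lemma coord_linear (Φ Ψ : OperatorFamily Ω G q T) (a b : ℝ) :
    coord ℱ (a • Φ + b • Ψ) = a • coord ℱ Φ + b • coord ℱ Ψ := by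
  ext z
  simp [coord, inner_add_left, inner_smul_left]

lemma hsNormSq_eq_tsum_coord (Φ : OperatorFamily Ω G q T) (x : PredSpace ℱ T × U) :
    hsNormSq (Φ x.1.time x.1.state x.2) = ∑' p, ‖coord ℱ Φ (x, p)‖ₑ ^ 2 := by
  rw [ENNReal.tsum_prod', hsNormSq_eq_tsum_adjoint tsum_enorm_inner_parsevalSeq_sq]
  simp_rw [← (q x.1.time x.2).tsum_enorm_inner_frame_sq]
  rfl

lemma measurable_q_predSpace
    (hq : ∀ h₁ h₂, Measurable fun p : ℝ≥0 × U => (q p.1 p.2).form h₁ h₂) (h₁ h₂ : H) :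
    Measurable fun x : PredSpace ℱ T × U => (q x.1.time x.2).form h₁ h₂ :=
  (hq h₁ h₂).comp ((measurable_time.comp measurable_fst).prodMk measurable_snd)

lemma measurable_coord (hq : ∀ h₁ h₂, Measurable fun p : ℝ≥0 × U => (q p.1 p.2).form h₁ h₂)
    {Φ : OperatorFamily Ω G q T}
    (hΦ : ∀ (h : H) (g : G), Measurable[(predictableOn ℱ T).prod ‹MeasurableSpace U›]
      fun p : (Set.Icc (0 : ℝ≥0) T × Ω) × U =>
        (inner ℝ (ContinuousLinearMap.adjoint (Φ p.1.1 p.1.2 p.2) g)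
          ((q p.1.1 p.2).incl h) : ℝ)) :
    Measurable (coord ℱ Φ) := by
  refine measurable_from_prod_countable_left fun p => ?_
  exact HilbertianSeminorm.measurable_inner_frame
    (q := fun x : PredSpace ℱ T × U => q x.1.time x.2) (measurable_q_predSpace hq)
    (y := fun x => ContinuousLinearMap.adjoint (Φ x.1.time x.1.state x.2) (parsevalSeq G p.1))
    (fun h => hΦ h _) p.2

/-- Two Parseval identities turn the Hilbert–Schmidt norm into an integral against counting measure
on ℕ × ℕ, and Tonelli rearranges the rest. This is the isometric embedding of Λ²(M,T) in `L²`. -/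
lemma energy_eq_lintegral_coord [IsFiniteMeasure P] [SigmaFinite μ] (hlam : lam (Set.Icc 0 T) < ∞)
    {Φ : OperatorFamily Ω G q T} (hΦ : Measurable (coord ℱ Φ)) (t : ℝ≥0) :
    energy P μ lam Φ t = ∫⁻ z in {z | (z.1.1.time : ℝ≥0) ≤ t}, ‖coord ℱ Φ z‖ₑ ^ 2
      ∂(coordMeasure ℱ P μ lam T) := by
  have := isFiniteMeasure_predMeasure (ℱ := ℱ) (P := P) hlam
  have hset : MeasurableSet {x : PredSpace ℱ T × U | (x.1.time : ℝ≥0) ≤ t} :=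
    measurableSet_le (measurable_time.comp measurable_fst) measurable_const
  have hset' : MeasurableSet {z : (PredSpace ℱ T × U) × (ℕ × ℕ) | (z.1.1.time : ℝ≥0) ≤ t} :=
    measurable_fst hset
  have hsq : Measurable fun z => ‖coord ℱ Φ z‖ₑ ^ 2 := hΦ.enorm.pow_const 2
  have : SigmaFinite (intMeasure ℱ P μ lam T) := by unfold intMeasure; infer_instance
  have hhs : Measurable fun x : PredSpace ℱ T × U => hsNormSq (Φ x.1.time x.1.state x.2) := by
    simp_rw [hsNormSq_eq_tsum_coord (ℱ := ℱ)]
    exact Measurable.tsum fun p => hsq.comp measurable_prodMk_right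
  rw [← lintegral_indicator hset', coordMeasure, lintegral_prod _ (hsq.indicator hset').aemeasurable]
  have e : ∀ x : PredSpace ℱ T × U, ∫⁻ p, {z : (PredSpace ℱ T × U) × (ℕ × ℕ) |
      (z.1.1.time : ℝ≥0) ≤ t}.indicator (fun z => ‖coord ℱ Φ z‖ₑ ^ 2) (x, p) ∂Measure.count
      = {x : PredSpace ℱ T × U | (x.1.time : ℝ≥0) ≤ t}.indicator
        (fun x => hsNormSq (Φ x.1.time x.1.state x.2)) x := by
    intro x
    rw [lintegral_count]
    by_cases hx : (x.1.time : ℝ≥0) ≤ t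
    · simp [Set.indicator, hx, hsNormSq_eq_tsum_coord (ℱ := ℱ)]
    · simp [Set.indicator, hx]
  simp_rw [e]
  rw [lintegral_intMeasure hlam (hhs.indicator hset), energy]
  refine lintegral_congr fun ω => ?_
  have hs : MeasurableSet {r : Set.Icc (0 : ℝ≥0) T | (r : ℝ≥0) ≤ t} :=
    measurableSet_le measurable_subtype_coe measurable_const
  have e2 : {r : Set.Icc (0 : ℝ≥0) T | 0 < (r : ℝ≥0) ∧ (r : ℝ≥0) ≤ t}
      = {r : Set.Icc (0 : ℝ≥0) T | (r : ℝ≥0) ≤ t} ∩ {r | 0 < (r : ℝ≥0)} := by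
    ext r; exact and_comm
  rw [e2, ← Measure.restrict_restrict hs, ← lintegral_indicator hs]
  refine lintegral_congr fun r => ?_
  by_cases hr : (r : ℝ≥0) ≤ t
  · simp only [Set.indicator, Set.mem_ofPred_eq, PredSpace.time_mk, hr, if_true]
    rfl
  · simp [Set.indicator, hr]

lemma energy_endPt_eq_lintegral_coord [IsFiniteMeasure P] [SigmaFinite μ]
    (hlam : lam (Set.Icc 0 T) < ∞) {Φ : OperatorFamily Ω G q T} (hΦ : Measurable (coord ℱ Φ)) :
    energy P μ lam Φ T = ∫⁻ z, ‖coord ℱ Φ z‖ₑ ^ 2 ∂(coordMeasure ℱ P μ lam T) := by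
  rw [energy_eq_lintegral_coord hlam hΦ]
  have : {z : (PredSpace ℱ T × U) × (ℕ × ℕ) | (z.1.1.time : ℝ≥0) ≤ T} = Set.univ :=
    Set.eq_univ_of_forall fun z => z.1.1.time.2.2
  rw [this, Measure.restrict_univ]

lemma memLp_two_iff_lintegral_lt_top {α E : Type*} {m : MeasurableSpace α} {ν : Measure α}
    [NormedAddCommGroup E] {f : α → E} (hf : AEStronglyMeasurable f ν) :
    MemLp f 2 ν ↔ ∫⁻ a, ‖f a‖ₑ ^ 2 ∂ν < ∞ := by
  rw [MemLp, and_iff_right hf, eLpNorm_lt_top_iff_lintegral_rpow_enorm_lt_top (by simp) (by simp)]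
  simp

lemma MemLambda2.memLp_coord [IsFiniteMeasure P] [SigmaFinite μ] (hlam : lam (Set.Icc 0 T) < ∞)
    (hq : ∀ h₁ h₂, Measurable fun p : ℝ≥0 × U => (q p.1 p.2).form h₁ h₂)
    {Φ : OperatorFamily Ω G q T} (hΦ : MemLambda2 P ℱ μ lam Φ) :
    MemLp (coord ℱ Φ) 2 (coordMeasure ℱ P μ lam T) := by
  have hm := measurable_coord hq hΦ.predictable
  rw [memLp_two_iff_lintegral_lt_top hm.aestronglyMeasurable,
    ← energy_endPt_eq_lintegral_coord hlam hm]
  have := hΦ.norm_lt_top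
  rwa [lambda2Norm, ENNReal.rpow_lt_top_iff_of_pos (by norm_num)] at this

lemma memLambda2_of_memLp [IsFiniteMeasure P] [SigmaFinite μ] (hlam : lam (Set.Icc 0 T) < ∞)
    (hq : ∀ h₁ h₂, Measurable fun p : ℝ≥0 × U => (q p.1 p.2).form h₁ h₂)
    {Φ : OperatorFamily Ω G q T} (hHS : ∀ r ω u, IsHilbertSchmidt (Φ r ω u))
    (hΦ : ∀ (h : H) (g : G), Measurable[(predictableOn ℱ T).prod ‹MeasurableSpace U›]
      fun p : (Set.Icc (0 : ℝ≥0) T × Ω) × U =>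
        (inner ℝ (ContinuousLinearMap.adjoint (Φ p.1.1 p.1.2 p.2) g)
          ((q p.1.1 p.2).incl h) : ℝ))
    (hL : MemLp (coord ℱ Φ) 2 (coordMeasure ℱ P μ lam T)) : MemLambda2 P ℱ μ lam Φ := by
  refine ⟨hHS, hΦ, ?_⟩
  rw [lambda2Norm, ENNReal.rpow_lt_top_iff_of_pos (by norm_num),
    energy_endPt_eq_lintegral_coord hlam (measurable_coord hq hΦ)]
  exact (memLp_two_iff_lintegral_lt_top hL.1).1 hL

end Coordinates

/-! ### Linear structure of the Hilbert–Schmidt class -/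

section HilbertSchmidtLinear

variable {K G : Type*} [NormedAddCommGroup K] [InnerProductSpace ℝ K] [CompleteSpace K]
  [NormedAddCommGroup G] [InnerProductSpace ℝ G]

lemma IsHilbertSchmidt.smul {S : K →L[ℝ] G} (hS : IsHilbertSchmidt S) (a : ℝ) :
    IsHilbertSchmidt (a • S) := by
  have : hsNormSq (a • S) = ‖a‖ₑ ^ 2 * hsNormSq S := by
    simp_rw [hsNormSq, ← ENNReal.tsum_mul_left, _root_.smul_apply, enorm_smul, mul_pow]
  rw [IsHilbertSchmidt, this]
  exact ENNReal.mul_lt_top (by simp) hS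

lemma IsHilbertSchmidt.add {S S' : K →L[ℝ] G} (hS : IsHilbertSchmidt S)
    (hS' : IsHilbertSchmidt S') : IsHilbertSchmidt (S + S') := by
  have : hsNormSq (S + S') ≤ 2 * hsNormSq S + 2 * hsNormSq S' := by
    simp_rw [hsNormSq, ← ENNReal.tsum_mul_left, ← ENNReal.tsum_add]
    refine ENNReal.tsum_le_tsum fun e => ?_
    have h1 : ‖(S + S') (e : K)‖ₑ ≤ ‖S (e : K)‖ₑ + ‖S' (e : K)‖ₑ := enorm_add_le _ _
    have h2 := ENNReal.rpow_add_le_mul_rpow_add_rpow ‖S (e : K)‖ₑ ‖S' (e : K)‖ₑ (p := 2)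
      (by norm_num)
    rw [← mul_add]
    refine (pow_le_pow_left' h1 2).trans ?_
    have h3 : (2 : ℝ≥0∞) ^ ((2 : ℝ) - 1) = 2 := by norm_num
    simpa [h3] using h2
  exact this.trans_lt (ENNReal.add_lt_top.2
    ⟨ENNReal.mul_lt_top (by simp) hS, ENNReal.mul_lt_top (by simp) hS'⟩)

lemma IsHilbertSchmidt.zero : IsHilbertSchmidt (0 : K →L[ℝ] G) := by
  simp [IsHilbertSchmidt, hsNormSq]

end HilbertSchmidtLinear

/-! ### Elementary integrands -/

section BilinearParseval

variable {K : Type*} [NormedAddCommGroup K] [InnerProductSpace ℝ K]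

lemma hasSum_sq_of_parseval {f : ℕ → K}
    (hf : ∀ y : K, ∑' n, ‖(inner ℝ y (f n) : ℝ)‖ₑ ^ 2 = ‖y‖ₑ ^ 2) (y : K) :
    HasSum (fun n => (inner ℝ y (f n) : ℝ) ^ 2) (‖y‖ ^ 2) := by
  have e : ∀ n, ‖(inner ℝ y (f n) : ℝ)‖ₑ ^ 2 = ENNReal.ofReal ((inner ℝ y (f n) : ℝ) ^ 2) := fun n => by
    rw [← ofReal_norm, ← ENNReal.ofReal_pow (norm_nonneg _), Real.norm_eq_abs, sq_abs]
  have h := hf y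
  simp_rw [e] at h
  have hs : Summable fun n => (inner ℝ y (f n) : ℝ) ^ 2 := by
    have h1 := ENNReal.summable_toReal (f := fun n => ENNReal.ofReal ((inner ℝ y (f n) : ℝ) ^ 2))
      (by rw [h]; exact ENNReal.pow_ne_top (by simp))
    simpa [ENNReal.toReal_ofReal (sq_nonneg _)] using h1
  rw [← ENNReal.ofReal_tsum_of_nonneg (fun n => sq_nonneg _) hs, ← ofReal_norm,
    ← ENNReal.ofReal_pow (norm_nonneg _),
    ENNReal.ofReal_eq_ofReal_iff (tsum_nonneg fun n => sq_nonneg _) (by positivity)] at h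
  rw [← h]
  exact hs.hasSum

lemma hasSum_inner_mul_of_parseval {f : ℕ → K}
    (hf : ∀ y : K, ∑' n, ‖(inner ℝ y (f n) : ℝ)‖ₑ ^ 2 = ‖y‖ₑ ^ 2) (x y : K) :
    HasSum (fun n => (inner ℝ x (f n) * inner ℝ y (f n) : ℝ)) (inner ℝ x y) := by
  have h := ((hasSum_sq_of_parseval hf (x + y)).sub (hasSum_sq_of_parseval hf (x - y))).mul_left
    (1 / 4)
  have e1 : (inner ℝ x y : ℝ) = 1 / 4 * (‖x + y‖ ^ 2 - ‖x - y‖ ^ 2) := by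
    rw [norm_add_sq_real, norm_sub_sq_real]
    ring
  rw [e1]
  refine h.congr_fun fun n => ?_
  rw [inner_add_left, inner_sub_left]
  ring

end BilinearParseval

namespace HilbertianSeminorm

variable {H : Type*} [NormedAddCommGroup H] [InnerProductSpace ℝ H]

lemma enorm_incl_sq (q : HilbertianSeminorm H) (h : H) :
    ‖q.incl h‖ₑ ^ 2 = ENNReal.ofReal (q.form h h) := by
  rw [← ofReal_norm, ← ENNReal.ofReal_pow (norm_nonneg _), ← real_inner_self_eq_norm_sq, inner_incl]

end HilbertianSeminorm

section Elementary

open InnerProductSpace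

variable {Ω U H G : Type*} {mΩ : MeasurableSpace Ω}
  [NormedAddCommGroup H] [InnerProductSpace ℝ H] [CompleteSpace H]
  [NormedAddCommGroup G] [InnerProductSpace ℝ G]

/-- The scalar factor of an elementary integrand. -/
def elemWeight (s t : ℝ≥0) (F : Set Ω) (A : Set U) (r : ℝ≥0) (ω : Ω) (u : U) : ℝ :=
  (Set.Ioc s t).indicator 1 r * F.indicator 1 ω * A.indicator 1 u

/-- The elementary integrand `1_{(s,t]}(r) 1_F(ω) 1_A(u) S ∘ i*_{q_{r,u}}`. -/
def elemFamily (q : ℝ≥0 → U → HilbertianSeminorm H) (T s t : ℝ≥0) (F : Set Ω) (A : Set U)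
    (S : H →L[ℝ] G) : OperatorFamily Ω G q T :=
  fun r ω u => elemWeight s t F A r ω u • S.comp (ContinuousLinearMap.adjoint (q r u).incl)

lemma elemWeight_eq_indicator (s t : ℝ≥0) (F : Set Ω) (A : Set U) (r : ℝ≥0) (ω : Ω) (u : U)
    [Decidable ((s < r ∧ r ≤ t) ∧ ω ∈ F ∧ u ∈ A)] :
    elemWeight s t F A r ω u = if (s < r ∧ r ≤ t) ∧ ω ∈ F ∧ u ∈ A then 1 else 0 := by
  by_cases h1 : s < r ∧ r ≤ t <;> by_cases h2 : ω ∈ F <;> by_cases h3 : u ∈ A <;>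
    simp [elemWeight, Set.indicator, h1, h2, h3]

lemma abs_elemWeight_le (s t : ℝ≥0) (F : Set Ω) (A : Set U) (r : ℝ≥0) (ω : Ω) (u : U) :
    |elemWeight s t F A r ω u| ≤ A.indicator 1 u := by
  classical
  rw [elemWeight_eq_indicator]
  by_cases h3 : u ∈ A <;> simp [h3]
  split_ifs <;> simp

lemma measurable_elemWeight [MeasurableSpace U] {ℱ : Filtration ℝ≥0 mΩ} {T s : ℝ≥0} (t : ℝ≥0)
    {F : Set Ω} (hF : MeasurableSet[ℱ s] F) {A : Set U} (hA : MeasurableSet A) :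
    Measurable fun x : PredSpace ℱ T × U => elemWeight s t F A x.1.time x.1.state x.2 := by
  classical
  simp_rw [elemWeight_eq_indicator]
  refine Measurable.ite ?_ measurable_const measurable_const
  have h1 : MeasurableSet
      ((Prod.fst : PredSpace ℱ T × U → _) ⁻¹' {p | s < (p.time : ℝ≥0) ∧ p.state ∈ F}) :=
    measurable_fst (measurableSet_predSpace_Ioi s hF)
  have h2 : MeasurableSet {x : PredSpace ℱ T × U | (x.1.time : ℝ≥0) ≤ t} :=
    measurableSet_le (measurable_time.comp measurable_fst) measurable_const
  have h3 : MeasurableSet ((Prod.snd : PredSpace ℱ T × U → U) ⁻¹' A) := measurable_snd hA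
  convert (h1.inter h2).inter h3 using 1
  ext x
  simp only [Set.mem_ofPred_eq, Set.mem_inter_iff, Set.mem_preimage]
  tauto

variable [CompleteSpace G]

/-- The adjoint of S ∘ i* is i ∘ S*, so its values lie in the image of `H`, and inner products in
H_q reduce to the form `q`. -/
lemma adjoint_elemFamily (q : ℝ≥0 → U → HilbertianSeminorm H) {T : ℝ≥0} (s t : ℝ≥0) (F : Set Ω)
    (A : Set U) (S : H →L[ℝ] G) (r : Set.Icc (0 : ℝ≥0) T) (ω : Ω) (u : U) (g : G) :
    ContinuousLinearMap.adjoint (elemFamily q T s t F A S r ω u) g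
      = elemWeight s t F A r ω u • (q r u).incl (ContinuousLinearMap.adjoint S g) := by
  simp [elemFamily, ContinuousLinearMap.adjoint_comp]

variable [SeparableSpace G]

/-- Row by row, the squared norm of i_q S*g is q(S*g, S*g) ≤ C‖S*g‖², and the weight is at most the
indicator of `A`. -/
lemma hsNormSq_elemFamily_le {q : ℝ≥0 → U → HilbertianSeminorm H} {T : ℝ≥0} {C : ℝ≥0}
    (hC : ∀ r ≤ T, ∀ u h, (q r u).form h h ≤ C * ‖h‖ ^ 2) (s t : ℝ≥0) (F : Set Ω)
    (A : Set U) (S : H →L[ℝ] G) (r : Set.Icc (0 : ℝ≥0) T) (ω : Ω) (u : U) :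
    hsNormSq (elemFamily q T s t F A S r ω u) ≤ A.indicator (fun _ => C * hsNormSq S) u := by
  rw [hsNormSq_eq_tsum_adjoint tsum_enorm_inner_parsevalSeq_sq,
    hsNormSq_eq_tsum_adjoint tsum_enorm_inner_parsevalSeq_sq S]
  have hw := abs_elemWeight_le s t F A r ω u
  by_cases hu : u ∈ A
  · rw [Set.indicator_of_mem hu, ← ENNReal.tsum_mul_left]
    rw [Set.indicator_of_mem hu, Pi.one_apply] at hw
    refine ENNReal.tsum_le_tsum fun m => ?_
    rw [adjoint_elemFamily, enorm_smul, mul_pow, HilbertianSeminorm.enorm_incl_sq]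
    have h1 : ‖elemWeight s t F A r ω u‖ₑ ^ 2 ≤ 1 := by
      refine pow_le_one₀ zero_le ?_
      rw [← ofReal_norm, Real.norm_eq_abs]
      exact ENNReal.ofReal_le_one.2 hw
    have h2 : ENNReal.ofReal ((q r u).form (ContinuousLinearMap.adjoint S (parsevalSeq G m))
        (ContinuousLinearMap.adjoint S (parsevalSeq G m)))
        ≤ C * ‖ContinuousLinearMap.adjoint S (parsevalSeq G m)‖ₑ ^ 2 := by
      refine (ENNReal.ofReal_le_ofReal (hC r r.2.2 u _)).trans (le_of_eq ?_)
      rw [ENNReal.ofReal_mul (by positivity), ENNReal.ofReal_pow (norm_nonneg _), ofReal_norm]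
      simp
    calc _ ≤ 1 * _ := mul_le_mul' h1 h2
      _ = _ := one_mul _
  · rw [Set.indicator_of_notMem hu] at hw ⊢
    have h0 : elemWeight s t F A r ω u = 0 := abs_eq_zero.1 (le_antisymm hw (abs_nonneg _))
    simp [adjoint_elemFamily, h0]

lemma isHilbertSchmidt_rankOne (g : G) (h : H) : IsHilbertSchmidt (rankOne ℝ g h) := by
  rw [IsHilbertSchmidt, hsNormSq_eq_tsum_adjoint tsum_enorm_inner_parsevalSeq_sq]
  simp_rw [adjoint_rankOne, rankOne_apply, enorm_smul, mul_pow]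
  rw [ENNReal.tsum_mul_right, tsum_enorm_inner_parsevalSeq_sq]
  exact ENNReal.mul_lt_top (by simp) (by simp)

end Elementary

section ElementaryMem

open InnerProductSpace

variable {Ω U H G : Type*} {mΩ : MeasurableSpace Ω}
  [TopologicalSpace U] [MeasurableSpace U] [BorelSpace U]
  [NormedAddCommGroup H] [InnerProductSpace ℝ H] [CompleteSpace H] [SeparableSpace H]
  [NormedAddCommGroup G] [InnerProductSpace ℝ G] [CompleteSpace G] [SeparableSpace G]
  {P : Measure Ω} [IsProbabilityMeasure P] {ℱ : Filtration ℝ≥0 mΩ}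
  {R : Set (Set U)} {M : ℝ≥0 → Set U → H →ₗ[ℝ] (Ω →ₘ[P] ℝ)}
  {μ : Measure U} {lam : Measure ℝ≥0} {q : ℝ≥0 → U → HilbertianSeminorm H}

namespace IsCylMartingaleValuedMeasure

lemma measurableSet (hM : IsCylMartingaleValuedMeasure P ℱ R M μ lam q) {A : Set U} (hA : A ∈ R) :
    MeasurableSet A :=
  hM.generates.ge A (MeasurableSpace.measurableSet_generateFrom hA)

/-- Uniform boundedness twice: pointwise bounds on q(h,h') bound the functionals q(h,·) for each h,
and these bound the forms uniformly on [0,T] × U. -/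
lemma exists_form_bound (hM : IsCylMartingaleValuedMeasure P ℱ R M μ lam q) (T : ℝ≥0) :
    ∃ C : ℝ≥0, ∀ r ≤ T, ∀ u h, (q r u).form h h ≤ C * ‖h‖ ^ 2 := by
  have h1 : ∀ h, ∃ C, ∀ i : Set.Iic T × U, ‖(q i.1 i.2).form h‖ ≤ C := fun h =>
    banach_steinhaus fun h' => (hM.q_bounded h h' T).imp fun C hC i => hC i.1 i.1.2 i.2
  obtain ⟨C, hC⟩ := banach_steinhaus h1
  refine ⟨C.toNNReal, fun r hr u h => ?_⟩
  calc (q r u).form h h ≤ ‖(q r u).form h h‖ := Real.le_norm_self _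
    _ ≤ ‖(q r u).form‖ * ‖h‖ * ‖h‖ := (q r u).form.le_opNorm₂ h h
    _ = ‖(q r u).form‖ * ‖h‖ ^ 2 := by ring
    _ ≤ C.toNNReal * ‖h‖ ^ 2 := by
        gcongr
        exact (hC (⟨r, hr⟩, u)).trans (Real.le_coe_toNNReal C)

lemma lintegral_coord_elemFamily_le (hM : IsCylMartingaleValuedMeasure P ℱ R M μ lam q)
    {T : ℝ≥0} {C : ℝ≥0} (hC : ∀ r ≤ T, ∀ u h, (q r u).form h h ≤ C * ‖h‖ ^ 2) {s t : ℝ≥0}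
    {F : Set Ω} {A : Set U} (hA : A ∈ R) (S : H →L[ℝ] G)
    (hm : Measurable (coord ℱ (elemFamily q T s t F A S))) :
    ∫⁻ z, ‖coord ℱ (elemFamily q T s t F A S) z‖ₑ ^ 2 ∂(coordMeasure ℱ P μ lam T)
      ≤ predMeasure ℱ P lam T Set.univ * μ A * C * hsNormSq S := by
  have := hM.sigmaFinite_μ
  have := isFiniteMeasure_predMeasure (ℱ := ℱ) (P := P) (hM.lam_lt_top T)
  have : SigmaFinite (intMeasure ℱ P μ lam T) := by unfold intMeasure; infer_instance
  have hsq : Measurable fun z => ‖coord ℱ (elemFamily q T s t F A S) z‖ₑ ^ 2 :=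
    hm.enorm.pow_const 2
  rw [coordMeasure, lintegral_prod _ hsq.aemeasurable]
  simp_rw [lintegral_count, ← hsNormSq_eq_tsum_coord]
  calc _ ≤ ∫⁻ x : PredSpace ℱ T × U, (Set.univ ×ˢ A).indicator (fun _ => C * hsNormSq S) x
        ∂(intMeasure ℱ P μ lam T) := by
        refine lintegral_mono fun x => (hsNormSq_elemFamily_le hC s t F A S _ _ _).trans ?_
        by_cases hx : x.2 ∈ A <;> simp [Set.indicator, hx]
    _ = C * hsNormSq S * intMeasure ℱ P μ lam T (Set.univ ×ˢ A) := by
        rw [lintegral_indicator_const (MeasurableSet.univ.prod (hM.measurableSet hA))]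
    _ = _ := by
        rw [intMeasure, Measure.prod_prod]
        ring

lemma memLambda2_elemFamily (hM : IsCylMartingaleValuedMeasure P ℱ R M μ lam q) {T s : ℝ≥0}
    (t : ℝ≥0) {F : Set Ω} (hF : MeasurableSet[ℱ s] F) {A : Set U} (hA : A ∈ R) {S : H →L[ℝ] G}
    (hS : IsHilbertSchmidt S) : MemLambda2 P ℱ μ lam (elemFamily q T s t F A S) := by
  have := hM.sigmaFinite_μ
  have := isFiniteMeasure_predMeasure (ℱ := ℱ) (P := P) (hM.lam_lt_top T)
  obtain ⟨C, hC⟩ := hM.exists_form_bound T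
  have hpred : ∀ (h : H) (g : G), Measurable[(predictableOn ℱ T).prod ‹MeasurableSpace U›]
      fun p : (Set.Icc (0 : ℝ≥0) T × Ω) × U =>
        (inner ℝ (ContinuousLinearMap.adjoint (elemFamily q T s t F A S p.1.1 p.1.2 p.2) g)
          ((q p.1.1 p.2).incl h) : ℝ) := by
    intro h g
    simp_rw [adjoint_elemFamily, real_inner_smul_left, HilbertianSeminorm.inner_incl]
    exact (measurable_elemWeight (T := T) t hF (hM.measurableSet hA)).mul
      (measurable_q_predSpace hM.q_measurable _ _)
  have hm := measurable_coord hM.q_measurable hpred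
  refine memLambda2_of_memLp (hM.lam_lt_top T) hM.q_measurable (fun r ω u => ?_) hpred ?_
  · refine (hsNormSq_elemFamily_le hC s t F A S r ω u).trans_lt ?_
    by_cases hu : u ∈ A
    · simpa [hu] using ENNReal.mul_lt_top ENNReal.coe_lt_top hS
    · simp [hu]
  · rw [memLp_two_iff_lintegral_lt_top hm.aestronglyMeasurable]
    refine (hM.lintegral_coord_elemFamily_le hC hA S hm).trans_lt ?_
    exact ENNReal.mul_lt_top (ENNReal.mul_lt_top (ENNReal.mul_lt_top (measure_lt_top _ _)
      (hM.μ_lt_top A hA)) ENNReal.coe_lt_top) hS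

lemma memLambda2_linear (hM : IsCylMartingaleValuedMeasure P ℱ R M μ lam q) {T : ℝ≥0}
    {Φ Ψ : OperatorFamily Ω G q T} (hΦ : MemLambda2 P ℱ μ lam Φ) (hΨ : MemLambda2 P ℱ μ lam Ψ)
    (a b : ℝ) : MemLambda2 P ℱ μ lam (a • Φ + b • Ψ) := by
  have := hM.sigmaFinite_μ
  refine memLambda2_of_memLp (hM.lam_lt_top T) hM.q_measurable
    (fun r ω u => ((hΦ.hilbertSchmidt r ω u).smul a).add ((hΨ.hilbertSchmidt r ω u).smul b))
    (fun h g => ?_) ?_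
  · have e : ∀ p : (Set.Icc (0 : ℝ≥0) T × Ω) × U,
        (inner ℝ (ContinuousLinearMap.adjoint ((a • Φ + b • Ψ) p.1.1 p.1.2 p.2) g)
          ((q p.1.1 p.2).incl h) : ℝ)
        = a * inner ℝ (ContinuousLinearMap.adjoint (Φ p.1.1 p.1.2 p.2) g) ((q p.1.1 p.2).incl h)
        + b * inner ℝ (ContinuousLinearMap.adjoint (Ψ p.1.1 p.1.2 p.2) g)
          ((q p.1.1 p.2).incl h) := fun p => by
      simp [inner_add_left, inner_smul_left]
    simp_rw [e]
    exact ((hΦ.predictable h g).const_mul a).add ((hΨ.predictable h g).const_mul b)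
  · rw [coord_linear]
    exact ((hΦ.memLp_coord (hM.lam_lt_top T) hM.q_measurable).const_smul a).add
      ((hΨ.memLp_coord (hM.lam_lt_top T) hM.q_measurable).const_smul b)

lemma memLambda2_zero (hM : IsCylMartingaleValuedMeasure P ℱ R M μ lam q) (T : ℝ≥0) :
    MemLambda2 P ℱ μ lam (0 : OperatorFamily Ω G q T) := by
  have := hM.memLambda2_elemFamily (T := T) (s := 0) 0 (F := ∅)
    (@MeasurableSet.empty _ (ℱ 0))
    hM.isSetRing.empty_mem (S := (0 : H →L[ℝ] G)) IsHilbertSchmidt.zero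
  convert this using 1
  ext r ω u x
  simp [elemFamily]

lemma memLambda2_sum (hM : IsCylMartingaleValuedMeasure P ℱ R M μ lam q) {T : ℝ≥0} {ι : Type*}
    (I : Finset ι) {Φ : ι → OperatorFamily Ω G q T} (hΦ : ∀ i ∈ I, MemLambda2 P ℱ μ lam (Φ i)) :
    MemLambda2 P ℱ μ lam (∑ i ∈ I, Φ i) := by
  classical
  induction I using Finset.induction_on with
  | empty => simpa using hM.memLambda2_zero T
  | insert i I hi ih =>
    rw [Finset.sum_insert hi]
    simpa using hM.memLambda2_linear (hΦ i (Finset.mem_insert_self _ _))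
      (ih fun j hj => hΦ j (Finset.mem_insert_of_mem hj)) 1 1

end IsCylMartingaleValuedMeasure

end ElementaryMem

/-! ### Isometries from equality of Gram matrices -/

section Gram

variable {ι V W : Type*} [NormedAddCommGroup V] [InnerProductSpace ℝ V]
  [NormedAddCommGroup W] [InnerProductSpace ℝ W]

lemma norm_linearCombination_sq (v : ι → V) (c : ι →₀ ℝ) :
    ‖Finsupp.linearCombination ℝ v c‖ ^ 2
      = ∑ i ∈ c.support, ∑ j ∈ c.support, c i * (c j * inner ℝ (v i) (v j)) := by
  rw [← real_inner_self_eq_norm_sq, Finsupp.linearCombination_apply, Finsupp.sum]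
  simp_rw [sum_inner, inner_sum, real_inner_smul_left, real_inner_smul_right]

lemma norm_linearCombination_eq_of_gram {v : ι → V} {w : ι → W}
    (h : ∀ i j, (inner ℝ (v i) (v j) : ℝ) = inner ℝ (w i) (w j)) (c : ι →₀ ℝ) :
    ‖Finsupp.linearCombination ℝ w c‖ = ‖Finsupp.linearCombination ℝ v c‖ := by
  rw [← sq_eq_sq₀ (norm_nonneg _) (norm_nonneg _), norm_linearCombination_sq,
    norm_linearCombination_sq]
  simp_rw [h]

variable [CompleteSpace V] [CompleteSpace W]

/-- Equal Gram matrices give a linear combination the same norm in both families, so the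
correspondence is well defined and extends to the closed span `K`. Composition with the orthogonal
projection onto `K` defines it on all of `V`; only on `K` is it claimed to be isometric. -/
lemma exists_isometry_of_gram {v : ι → V} {w : ι → W}
    (h : ∀ i j, (inner ℝ (v i) (v j) : ℝ) = inner ℝ (w i) (w j)) :
    ∃ L : V →L[ℝ] W, (∀ i, L (v i) = w i) ∧
      ∀ x ∈ (Submodule.span ℝ (Set.range v)).topologicalClosure, ‖L x‖ = ‖x‖ := by
  set K := (Submodule.span ℝ (Set.range v)).topologicalClosure with hK
  have : CompleteSpace K := (Submodule.isClosed_topologicalClosure _).completeSpace_coe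
  have hmem : ∀ c : ι →₀ ℝ, Finsupp.linearCombination ℝ v c ∈ K := fun c =>
    Submodule.le_topologicalClosure _ (by
      rw [← Finsupp.range_linearCombination]; exact LinearMap.mem_range_self _ c)
  set e : (ι →₀ ℝ) →ₗ[ℝ] K := (Finsupp.linearCombination ℝ v).codRestrict K hmem with he
  set f : (ι →₀ ℝ) →ₗ[ℝ] W := Finsupp.linearCombination ℝ w
  have hn : ∀ c, ‖f c‖ = ‖e c‖ := fun c => norm_linearCombination_eq_of_gram h c
  have hdense : DenseRange e := by
    rw [denseRange_iff_closure_range, Set.eq_univ_iff_forall]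
    intro x
    rw [closure_subtype]
    have : Subtype.val '' Set.range e = (Submodule.span ℝ (Set.range v) : Set V) := by
      rw [← Finsupp.range_linearCombination]
      ext y
      simp [he]
    rw [this]
    exact x.2
  have hbound : ∃ C, ∀ c, ‖f c‖ ≤ C * ‖e c‖ := ⟨1, fun c => by rw [hn, one_mul]⟩
  set L₀ : K →L[ℝ] W := f.extendOfNorm e
  have hL₀ : ∀ c, L₀ (e c) = f c := LinearMap.extendOfNorm_eq hdense hbound
  have hiso : ∀ x : K, ‖L₀ x‖ = ‖x‖ := fun x =>
    hdense.induction_on x (isClosed_eq (by fun_prop) (by fun_prop)) fun c => by rw [hL₀, hn]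
  refine ⟨L₀.comp K.orthogonalProjectionOnto, fun i => ?_, fun x hx => ?_⟩
  · have hi : v i ∈ K := Submodule.le_topologicalClosure _ (Submodule.subset_span ⟨i, rfl⟩)
    have e1 : K.orthogonalProjectionOnto (v i) = e (Finsupp.single i 1) := by
      refine Subtype.ext ?_
      rw [show v i = ((⟨v i, hi⟩ : K) : V) from rfl,
        Submodule.orthogonalProjectionOnto_mem_subspace_eq_self]
      simp [he]
    rw [ContinuousLinearMap.comp_apply, e1, hL₀]
    simp [f]
  · have e1 : K.orthogonalProjectionOnto x = ⟨x, hx⟩ :=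
      Submodule.orthogonalProjectionOnto_mem_subspace_eq_self (K := K) ⟨x, hx⟩
    rw [ContinuousLinearMap.comp_apply, e1, hiso]
    rfl

end Gram

/-! ### The increments of a cylindrical martingale-valued measure in `L²` -/

section Increments

variable {Ω U H : Type*} {mΩ : MeasurableSpace Ω}
  [TopologicalSpace U] [MeasurableSpace U] [BorelSpace U]
  [NormedAddCommGroup H] [InnerProductSpace ℝ H]
  {P : Measure Ω} {ℱ : Filtration ℝ≥0 mΩ}
  {R : Set (Set U)} {M : ℝ≥0 → Set U → H →ₗ[ℝ] (Ω →ₘ[P] ℝ)}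
  {μ : Measure U} {lam : Measure ℝ≥0} {q : ℝ≥0 → U → HilbertianSeminorm H}

namespace IsCylMartingaleValuedMeasure

lemma mem_Lp (hM : IsCylMartingaleValuedMeasure P ℱ R M μ lam q) {A : Set U} (hA : A ∈ R)
    (t : ℝ≥0) (h : H) : M t A h ∈ Lp ℝ 2 P :=
  Lp.mem_Lp_iff_memLp.2 (hM.memLp A hA t h)

/-- The increment `M((s,t],A)(h)` as an element of `L²`. -/
def incr (hM : IsCylMartingaleValuedMeasure P ℱ R M μ lam q) (s t : ℝ≥0) {A : Set U} (hA : A ∈ R)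
    (h : H) : Lp ℝ 2 P :=
  ⟨M t A h, hM.mem_Lp hA t h⟩ - ⟨M s A h, hM.mem_Lp hA s h⟩

variable (hM : IsCylMartingaleValuedMeasure P ℱ R M μ lam q)

lemma coe_incr (s t : ℝ≥0) {A : Set U} (hA : A ∈ R) (h : H) :
    (hM.incr s t hA h : Ω →ₘ[P] ℝ) = cylIncrement M s t A h := rfl

lemma incr_ae_eq (s t : ℝ≥0) {A : Set U} (hA : A ∈ R) (h : H) :
    hM.incr s t hA h =ᵐ[P] fun ω => M t A h ω - M s A h ω :=
  AEEqFun.coeFn_sub _ _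

lemma incr_add (s t : ℝ≥0) {A : Set U} (hA : A ∈ R) (h h' : H) :
    hM.incr s t hA (h + h') = hM.incr s t hA h + hM.incr s t hA h' := by
  refine Subtype.ext ?_
  rw [AddSubgroup.coe_add, coe_incr, coe_incr, coe_incr]
  simp only [cylIncrement, map_add]
  abel

lemma incr_smul (s t : ℝ≥0) {A : Set U} (hA : A ∈ R) (c : ℝ) (h : H) :
    hM.incr s t hA (c • h) = c • hM.incr s t hA h := by
  refine Subtype.ext ?_
  change cylIncrement M s t A (c • h) = c • cylIncrement M s t A h
  simp only [cylIncrement, map_smul, smul_sub]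

lemma incr_union (s t : ℝ≥0) {A B : Set U} (hA : A ∈ R) (hB : B ∈ R) (hAB : Disjoint A B)
    (hu : A ∪ B ∈ R) (h : H) : hM.incr s t hu h = hM.incr s t hA h + hM.incr s t hB h := by
  refine Subtype.ext ?_
  rw [AddSubgroup.coe_add, coe_incr, coe_incr, coe_incr]
  simp only [cylIncrement, hM.additive _ A hA B hB hAB]
  abel

lemma incr_self (t : ℝ≥0) {A : Set U} (hA : A ∈ R) (h : H) : hM.incr t t hA h = 0 :=
  sub_self _

lemma incr_add_incr (s r t : ℝ≥0) {A : Set U} (hA : A ∈ R) (h : H) :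
    hM.incr s r hA h + hM.incr r t hA h = hM.incr s t hA h := by
  simp only [incr]
  abel

lemma inner_incr_of_disjoint (s t : ℝ≥0) {A B : Set U} (hA : A ∈ R) (hB : B ∈ R)
    (hAB : Disjoint A B) (h h' : H) :
    (inner ℝ (hM.incr s t hA h) (hM.incr s t hB h') : ℝ) = 0 := by
  have key : ∀ a b, (inner ℝ (⟨M a A h, hM.mem_Lp hA a h⟩ : Lp ℝ 2 P)
      (⟨M b B h', hM.mem_Lp hB b h'⟩ : Lp ℝ 2 P) : ℝ) = 0 := fun a b => by
    rw [L2.inner_def, ← hM.orthogonal A hA B hB hAB a b h h']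
    refine integral_congr_ae (ae_of_all _ fun ω => ?_)
    exact mul_comm _ _
  simp only [incr, inner_sub_left, inner_sub_right, key, sub_zero]

/-- Split both sets into the intersection and a remainder. The three pieces are pairwise disjoint,
so every cross term vanishes by orthogonality. -/
lemma inner_incr_eq_inter (s t : ℝ≥0) {A B : Set U} (hA : A ∈ R) (hB : B ∈ R) (h h' : H) :
    (inner ℝ (hM.incr s t hA h) (hM.incr s t hB h') : ℝ)
      = inner ℝ (hM.incr s t (hM.isSetRing.inter_mem hA hB) h)
          (hM.incr s t (hM.isSetRing.inter_mem hA hB) h') := by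
  have hI := hM.isSetRing.inter_mem hA hB
  have hAB := hM.isSetRing.sdiff_mem hA hB
  have hBA := hM.isSetRing.sdiff_mem hB hA
  have d1 : Disjoint (A ∩ B) (A \ B) := Set.disjoint_sdiff_right.mono_left Set.inter_subset_right
  have d2 : Disjoint (A ∩ B) (B \ A) := Set.disjoint_sdiff_right.mono_left Set.inter_subset_left
  have d3 : Disjoint (A \ B) (B \ A) := Set.disjoint_sdiff_left.mono_right Set.sdiff_subset
  have eA : A ∩ B ∪ A \ B = A := Set.inter_union_sdiff A B
  have eB : A ∩ B ∪ B \ A = B := by rw [Set.inter_comm]; exact Set.inter_union_sdiff B A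
  have hA' : hM.incr s t hA h = hM.incr s t hI h + hM.incr s t hAB h := by
    rw [← hM.incr_union s t hI hAB d1 (by rwa [eA])]
    congr 1
    simp only [eA]
  have hB' : hM.incr s t hB h' = hM.incr s t hI h' + hM.incr s t hBA h' := by
    rw [← hM.incr_union s t hI hBA d2 (by rwa [eB])]
    congr 1
    simp only [eB]
  rw [hA', hB', inner_add_left, inner_add_right, inner_add_right,
    hM.inner_incr_of_disjoint s t hI hBA d2, hM.inner_incr_of_disjoint s t hAB hI d1.symm,
    hM.inner_incr_of_disjoint s t hAB hBA d3]
  ring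

lemma enorm_incr_sq {s t : ℝ≥0} (hst : s < t) {A : Set U} (hA : A ∈ R) (h : H) :
    ‖hM.incr s t hA h‖ₑ ^ 2
      = ∫⁻ r in Set.Ioc s t, ∫⁻ u in A, ENNReal.ofReal ((q r u).form h h) ∂μ ∂lam := by
  rw [← hM.covariance A hA s t hst h, Lp.enorm_def,
    eLpNorm_eq_lintegral_rpow_enorm_toReal (by simp) (by simp)]
  rw [← ENNReal.rpow_natCast, ← ENNReal.rpow_mul]
  norm_num
  rfl

variable [IsProbabilityMeasure P]

/-- The earlier increment restricted to `F` is square integrable and ℱ_r-measurable, hence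
orthogonal to the martingale increment after `r`. -/
lemma setIntegral_incr_mul_incr_of_le {s r t : ℝ≥0} (hsr : s ≤ r) (hrt : r ≤ t) {A B : Set U}
    (hA : A ∈ R) (hB : B ∈ R) {F : Set Ω} (hF : MeasurableSet[ℱ r] F) (h h' : H) :
    ∫ ω in F, hM.incr s r hA h ω * hM.incr r t hB h' ω ∂P = 0 := by
  set V : Ω → ℝ := F.indicator fun ω => M r A h ω - M s A h ω with hV
  have hVm : StronglyMeasurable[ℱ r] V :=
    (((hM.martingale A hA h).1 r).sub
      (((hM.martingale A hA h).1 s).mono (ℱ.mono hsr))).indicator hF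
  have hV2 : MemLp V 2 P := ((hM.memLp A hA r h).sub (hM.memLp A hA s h)).indicator (ℱ.le r _ hF)
  have h0 := (hM.martingale B hB h').integral_inner_sub_eq_zero (hM.memLp B hB · h') hrt
    hVm.aestronglyMeasurable hV2
  rw [← integral_indicator (ℱ.le r _ hF), ← h0]
  refine integral_congr_ae ?_
  filter_upwards [hM.incr_ae_eq s r hA h, hM.incr_ae_eq r t hB h'] with ω h1 h2
  by_cases hω : ω ∈ F
  · simp [hV, hω, h1, h2, mul_comm]
  · simp [hV, hω]

lemma setIntegral_incr {s t : ℝ≥0} (hst : s ≤ t) {A : Set U} (hA : A ∈ R) {F : Set Ω}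
    (hF : MeasurableSet[ℱ s] F) (h : H) : ∫ ω in F, hM.incr s t hA h ω ∂P = 0 := by
  have hV2 : MemLp (F.indicator fun _ : Ω => (1 : ℝ)) 2 P :=
    (memLp_const 1).indicator (ℱ.le s _ hF)
  have h0 := (hM.martingale A hA h).integral_inner_sub_eq_zero (hM.memLp A hA · h) hst
    ((stronglyMeasurable_const.indicator hF).aestronglyMeasurable) hV2
  rw [← integral_indicator (ℱ.le s _ hF), ← h0]
  refine integral_congr_ae ?_
  filter_upwards [hM.incr_ae_eq s t hA h] with ω h1
  by_cases hω : ω ∈ F <;> simp [hω, h1]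

/-- Joint independence of the pair from ℱ_s makes the conditional expectation of the product
constant, which lets P(F) be factored out. -/
lemma setIntegral_incr_mul_incr {s t : ℝ≥0} (hst : s ≤ t) {A B : Set U}
    (hA : A ∈ R) (hB : B ∈ R) {F : Set Ω} (hF : MeasurableSet[ℱ s] F) (h h' : H) :
    ∫ ω in F, hM.incr s t hA h ω * hM.incr s t hB h' ω ∂P
      = P.real F * inner ℝ (hM.incr s t hA h) (hM.incr s t hB h') := by
  rcases hst.eq_or_lt with rfl | hst
  · rw [incr_self hM s hA h, inner_zero_left, mul_zero]
    rw [integral_eq_zero_of_ae]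
    exact ae_of_all _ fun ω => by simp
  set X : Ω → ℝ × ℝ := fun ω => (cylIncrement M s t A h ω, cylIncrement M s t B h' ω) with hX
  have hind := hM.indep s t hst A hA B hB h h'
  have hXm : Measurable X := (AEEqFun.measurable _).prodMk (AEEqFun.measurable _)
  have hf : StronglyMeasurable[MeasurableSpace.comap X inferInstance]
      (fun ω => (X ω).1 * (X ω).2) :=
    ((measurable_fst.comp (comap_measurable X)).mul
      (measurable_snd.comp (comap_measurable X))).stronglyMeasurable
  have hint : Integrable (fun ω => (X ω).1 * (X ω).2) P :=
    (Lp.memLp (hM.incr s t hA h)).integrable_mul (Lp.memLp (hM.incr s t hB h'))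
  have hc := condExp_indep_eq hXm.comap_le (ℱ.le s) hf hind
  have e := setIntegral_condExp (ℱ.le s) hint hF
  rw [setIntegral_congr_ae (ℱ.le s _ hF) (hc.mono fun ω hω _ => hω), setIntegral_const] at e
  refine e.symm.trans ?_
  rw [smul_eq_mul, L2.inner_def]
  congr 1
  exact integral_congr_ae (ae_of_all _ fun ω => mul_comm _ _)

end IsCylMartingaleValuedMeasure

end Increments

/-! ### The isometry on elementary integrands of rank one -/

lemma integral_count_eq_of_hasSum {ι : Type*} [MeasurableSpace ι] [MeasurableSingletonClass ι]
    {f : ι → ℝ} {a : ℝ} (hf : HasSum f a) : ∫ i, f i ∂Measure.count = a := by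
  have hint : Integrable f Measure.count := integrable_count_iff.2 hf.summable.norm
  have h := hasSum_integral_measure (f := f) (μ := fun i : ι => Measure.dirac i) (by
    simpa [Measure.count] using hint)
  simp only [integral_dirac] at h
  exact h.unique hf

/-- With a common right end `T`, the product of two weights has the same shape, starting at the
later time. This is why the elementary integrands used for the isometry all end at `T`. -/
lemma elemWeight_mul {Ω U : Type*} (s s' T : ℝ≥0) (F F' : Set Ω) (A A' : Set U) (r : ℝ≥0) (ω : Ω)
    (u : U) : elemWeight s T F A r ω u * elemWeight s' T F' A' r ω u
      = elemWeight (max s s') T (F ∩ F') (A ∩ A') r ω u := by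
  classical
  simp only [elemWeight_eq_indicator, max_lt_iff, Set.mem_inter_iff]
  grind

section GramIdentity

open InnerProductSpace

variable {Ω U H G : Type*} {mΩ : MeasurableSpace Ω}
  [TopologicalSpace U] [MeasurableSpace U] [BorelSpace U]
  [NormedAddCommGroup H] [InnerProductSpace ℝ H] [CompleteSpace H] [SeparableSpace H]
  [NormedAddCommGroup G] [InnerProductSpace ℝ G]
  {P : Measure Ω} {ℱ : Filtration ℝ≥0 mΩ}
  {R : Set (Set U)} {M : ℝ≥0 → Set U → H →ₗ[ℝ] (Ω →ₘ[P] ℝ)}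
  {μ : Measure U} {lam : Measure ℝ≥0} {q : ℝ≥0 → U → HilbertianSeminorm H}

namespace IsCylMartingaleValuedMeasure

variable [IsProbabilityMeasure P]

lemma lintegral_elemWeight_mul_form (hM : IsCylMartingaleValuedMeasure P ℱ R M μ lam q)
    {s T : ℝ≥0} (hsT : s < T) {F : Set Ω} (hF : MeasurableSet[ℱ s] F) {A : Set U} (hA : A ∈ R)
    (h : H) :
    ∫⁻ x : PredSpace ℱ T × U, ENNReal.ofReal (elemWeight s T F A x.1.time x.1.state x.2 *
      (q x.1.time x.2).form h h) ∂(intMeasure ℱ P μ lam T) = P F * ‖hM.incr s T hA h‖ₑ ^ 2 := by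
  classical
  have := hM.sigmaFinite_μ
  have hAm := hM.measurableSet hA
  have hm : Measurable fun x : PredSpace ℱ T × U => ENNReal.ofReal
      (elemWeight s T F A x.1.time x.1.state x.2 * (q x.1.time x.2).form h h) :=
    ENNReal.measurable_ofReal.comp ((measurable_elemWeight (T := T) T hF hAm).mul
      (measurable_q_predSpace hM.q_measurable h h))
  rw [lintegral_intMeasure (hM.lam_lt_top T) hm, hM.enorm_incr_sq hsT hA h]
  have e1 : ∀ ω, ∫⁻ r, ∫⁻ u, ENNReal.ofReal (elemWeight s T F A (r : ℝ≥0) ω u *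
      (q r u).form h h) ∂μ ∂(timeMeasure lam T) = F.indicator (fun _ =>
        ∫⁻ r in Set.Ioc s T, ∫⁻ u in A, ENNReal.ofReal ((q r u).form h h) ∂μ ∂lam) ω := by
    intro ω
    by_cases hω : ω ∈ F
    · rw [Set.indicator_of_mem hω]
      have e2 : ∀ r : Set.Icc (0 : ℝ≥0) T, ∫⁻ u, ENNReal.ofReal (elemWeight s T F A (r : ℝ≥0) ω u *
          (q r u).form h h) ∂μ = (Set.Ioc s T).indicator
            (fun r => ∫⁻ u in A, ENNReal.ofReal ((q r u).form h h) ∂μ) (r : ℝ≥0) := by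
        intro r
        by_cases hr : (r : ℝ≥0) ∈ Set.Ioc s T
        · rw [Set.indicator_of_mem hr, ← lintegral_indicator hAm]
          refine lintegral_congr fun u => ?_
          by_cases hu : u ∈ A
          · simp [elemWeight, Set.indicator_of_mem hr, hω, hu]
          · simp [elemWeight, hu]
        · rw [Set.indicator_of_notMem hr]
          simp [elemWeight, Set.indicator_of_notMem hr]
      -- `timeMeasure` omits time 0, which does not belong to (s,T] anyway.
      have e3 : Set.Ioc s T ∩ Subtype.val '' {r : Set.Icc (0 : ℝ≥0) T | 0 < (r : ℝ≥0)}
          = Set.Ioc s T := by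
        refine Set.inter_eq_left.2 fun r hr => ⟨⟨r, zero_le, hr.2⟩, ?_, rfl⟩
        exact zero_le.trans_lt hr.1
      simp_rw [e2]
      rw [timeMeasure, setLIntegral_subtype measurableSet_Icc,
        setLIntegral_indicator measurableSet_Ioc, e3]
    · rw [Set.indicator_of_notMem hω]
      simp [elemWeight, hω]
  refine (lintegral_congr e1).trans ?_
  rw [lintegral_indicator_const (ℱ.le s _ hF), mul_comm]

lemma integrable_elemWeight_mul_form (hM : IsCylMartingaleValuedMeasure P ℱ R M μ lam q)
    {s T : ℝ≥0} {F : Set Ω} (hF : MeasurableSet[ℱ s] F) {A : Set U} (hA : A ∈ R) (h h' : H) :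
    Integrable (fun x : PredSpace ℱ T × U => elemWeight s T F A x.1.time x.1.state x.2 *
      (q x.1.time x.2).form h h') (intMeasure ℱ P μ lam T) := by
  have := hM.sigmaFinite_μ
  have := isFiniteMeasure_predMeasure (ℱ := ℱ) (P := P) (hM.lam_lt_top T)
  obtain ⟨C, hC⟩ := hM.q_bounded h h' T
  have hAm := hM.measurableSet hA
  have hset : MeasurableSet (Set.univ ×ˢ A : Set (PredSpace ℱ T × U)) := MeasurableSet.univ.prod hAm
  refine Integrable.mono' (g := (Set.univ ×ˢ A).indicator fun _ => C) ?_
    ((measurable_elemWeight (T := T) T hF hAm).mul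
      (measurable_q_predSpace hM.q_measurable h h')).aestronglyMeasurable (ae_of_all _ fun x => ?_)
  · refine (integrable_indicator_iff hset).2 (integrableOn_const ?_)
    rw [intMeasure, Measure.prod_prod]
    exact (ENNReal.mul_lt_top (measure_lt_top _ _) (hM.μ_lt_top A hA)).ne
  · have h1 := abs_elemWeight_le s T F A x.1.time x.1.state x.2
    have h2 := hC x.1.time x.1.time.2.2 x.2
    rw [norm_mul, Real.norm_eq_abs, Real.norm_eq_abs]
    by_cases hx : x.2 ∈ A
    · simp only [hx, Set.indicator_of_mem, Pi.one_apply] at h1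
      simp only [Set.indicator, Set.mem_prod, Set.mem_univ, hx, and_self, if_true]
      calc _ ≤ 1 * C := mul_le_mul h1 h2 (abs_nonneg _) zero_le_one
        _ = C := one_mul C
    · simp only [hx, not_false_eq_true, Set.indicator_of_notMem] at h1
      rw [le_antisymm h1 (abs_nonneg _), zero_mul]
      simp [Set.indicator, hx]

lemma integral_elemWeight_mul_form (hM : IsCylMartingaleValuedMeasure P ℱ R M μ lam q)
    {s T : ℝ≥0} (hsT : s ≤ T) {F : Set Ω} (hF : MeasurableSet[ℱ s] F) {A : Set U} (hA : A ∈ R)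
    (h h' : H) :
    ∫ x : PredSpace ℱ T × U, elemWeight s T F A x.1.time x.1.state x.2 *
      (q x.1.time x.2).form h h' ∂(intMeasure ℱ P μ lam T)
      = P.real F * inner ℝ (hM.incr s T hA h) (hM.incr s T hA h') := by
  rcases hsT.eq_or_lt with rfl | hsT
  · simp [incr_self, elemWeight]
  have diag : ∀ h, ∫ x : PredSpace ℱ T × U, elemWeight s T F A x.1.time x.1.state x.2 *
      (q x.1.time x.2).form h h ∂(intMeasure ℱ P μ lam T)
      = P.real F * ‖hM.incr s T hA h‖ ^ 2 := by
    intro h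
    rw [integral_eq_lintegral_of_nonneg_ae, hM.lintegral_elemWeight_mul_form hsT hF hA h]
    · simp [Measure.real]
    · refine ae_of_all _ fun x => mul_nonneg ?_ ((q _ _).nonneg h)
      exact mul_nonneg (mul_nonneg (Set.indicator_nonneg (fun _ _ => zero_le_one) _)
        (Set.indicator_nonneg (fun _ _ => zero_le_one) _))
        (Set.indicator_nonneg (fun _ _ => zero_le_one) _)
    · exact (hM.integrable_elemWeight_mul_form hF hA h h).aestronglyMeasurable
  have i := hM.integrable_elemWeight_mul_form (T := T) hF hA
  -- Polarization reduces to the diagonal case, the only one given by the covariance formula.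
  have e : ∀ x : PredSpace ℱ T × U, elemWeight s T F A x.1.time x.1.state x.2 *
      (q x.1.time x.2).form h h' = (1 / 2) * (elemWeight s T F A x.1.time x.1.state x.2 *
      (q x.1.time x.2).form (h + h') (h + h') - elemWeight s T F A x.1.time x.1.state x.2 *
      (q x.1.time x.2).form h h - elemWeight s T F A x.1.time x.1.state x.2 *
      (q x.1.time x.2).form h' h') := fun x => by
    have := (q x.1.time x.2).symm h' h
    simp only [map_add, _root_.add_apply, this]
    ring
  simp_rw [e]
  have s1 := integral_sub ((i (h + h') (h + h')).sub (i h h)) (i h' h')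
  simp only [Pi.sub_apply] at s1
  rw [integral_const_mul, s1, integral_sub (i _ _) (i _ _), diag, diag, diag, hM.incr_add, norm_add_sq_real]
  ring

variable [CompleteSpace G] [SeparableSpace G]

lemma memLp_coord (hM : IsCylMartingaleValuedMeasure P ℱ R M μ lam q) {T : ℝ≥0}
    {Φ : OperatorFamily Ω G q T} (hΦ : MemLambda2 P ℱ μ lam Φ) :
    MemLp (coord ℱ Φ) 2 (coordMeasure ℱ P μ lam T) :=
  have := hM.sigmaFinite_μ
  hΦ.memLp_coord (hM.lam_lt_top T) hM.q_measurable

/-- The coordinates of `Φ ∈ Λ²(M,T)` as an element of `L²`. -/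
def coordLp (hM : IsCylMartingaleValuedMeasure P ℱ R M μ lam q) {T : ℝ≥0}
    {Φ : OperatorFamily Ω G q T} (hΦ : MemLambda2 P ℱ μ lam Φ) :
    Lp ℝ 2 (coordMeasure ℱ P μ lam T) :=
  (hM.memLp_coord hΦ).toLp

lemma coordLp_ae_eq (hM : IsCylMartingaleValuedMeasure P ℱ R M μ lam q) {T : ℝ≥0}
    {Φ : OperatorFamily Ω G q T} (hΦ : MemLambda2 P ℱ μ lam Φ) :
    hM.coordLp hΦ =ᵐ[coordMeasure ℱ P μ lam T] coord ℱ Φ :=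
  MemLp.coeFn_toLp _

lemma coordLp_linear (hM : IsCylMartingaleValuedMeasure P ℱ R M μ lam q) {T : ℝ≥0}
    {Φ Ψ : OperatorFamily Ω G q T} (hΦ : MemLambda2 P ℱ μ lam Φ) (hΨ : MemLambda2 P ℱ μ lam Ψ)
    (a b : ℝ) (h : MemLambda2 P ℱ μ lam (a • Φ + b • Ψ)) :
    hM.coordLp h = a • hM.coordLp hΦ + b • hM.coordLp hΨ := by
  rw [coordLp, coordLp, coordLp, ← MemLp.toLp_const_smul, ← MemLp.toLp_const_smul,
    ← MemLp.toLp_add]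
  exact MemLp.toLp_congr _ _ (ae_of_all _ fun z => by rw [coord_linear])

lemma inner_coordLp (hM : IsCylMartingaleValuedMeasure P ℱ R M μ lam q) {T : ℝ≥0}
    {Φ Ψ : OperatorFamily Ω G q T} (hΦ : MemLambda2 P ℱ μ lam Φ) (hΨ : MemLambda2 P ℱ μ lam Ψ) :
    (inner ℝ (hM.coordLp hΦ) (hM.coordLp hΨ) : ℝ)
      = ∫ z, coord ℱ Φ z * coord ℱ Ψ z ∂(coordMeasure ℱ P μ lam T) := by
  rw [L2.inner_def]
  refine integral_congr_ae ?_
  filter_upwards [hM.coordLp_ae_eq hΦ, hM.coordLp_ae_eq hΨ] with z h1 h2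
  rw [h1, h2]
  exact mul_comm _ _

/-- For rank one operators the sum over coordinates factors into two Parseval sums, one giving
⟨g,g'⟩ in `G` and one giving q(h,h') in H_q. -/
lemma inner_coordLp_rankOne (hM : IsCylMartingaleValuedMeasure P ℱ R M μ lam q) {T s s' : ℝ≥0}
    {F F' : Set Ω} {A A' : Set U} (g g' : G) (h h' : H)
    (he : MemLambda2 P ℱ μ lam (elemFamily q T s T F A (rankOne ℝ g h)))
    (he' : MemLambda2 P ℱ μ lam (elemFamily q T s' T F' A' (rankOne ℝ g' h'))) :
    (inner ℝ (hM.coordLp he) (hM.coordLp he') : ℝ)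
      = inner ℝ g g' * ∫ x : PredSpace ℱ T × U,
        elemWeight (max s s') T (F ∩ F') (A ∩ A') x.1.time x.1.state x.2 *
          (q x.1.time x.2).form h h' ∂(intMeasure ℱ P μ lam T) := by
  have := hM.sigmaFinite_μ
  have := isFiniteMeasure_predMeasure (ℱ := ℱ) (P := P) (hM.lam_lt_top T)
  have : SigmaFinite (intMeasure ℱ P μ lam T) := by unfold intMeasure; infer_instance
  have hint : Integrable (fun z => coord ℱ (elemFamily q T s T F A (rankOne ℝ g h)) z *
      coord ℱ (elemFamily q T s' T F' A' (rankOne ℝ g' h')) z) (coordMeasure ℱ P μ lam T) :=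
    (hM.memLp_coord he).integrable_mul (hM.memLp_coord he')
  rw [hM.inner_coordLp, coordMeasure, integral_prod _ hint, ← integral_const_mul]
  refine integral_congr_ae (ae_of_all _ fun x => ?_)
  refine integral_count_eq_of_hasSum ?_
  have h1 := hasSum_inner_mul_of_parseval tsum_enorm_inner_parsevalSeq_sq g g'
  have h2 := hasSum_inner_mul_of_parseval (q x.1.time x.2).tsum_enorm_inner_frame_sq
    ((q x.1.time x.2).incl h) ((q x.1.time x.2).incl h')
  have h3 := (h1.mul h2 (summable_mul_of_summable_norm h1.summable.norm h2.summable.norm)).mul_left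
    (elemWeight (max s s') T (F ∩ F') (A ∩ A') x.1.time x.1.state x.2)
  rw [HilbertianSeminorm.inner_incl] at h3
  beta_reduce
  rw [mul_left_comm]
  refine h3.congr_fun fun p => ?_
  rw [← elemWeight_mul]
  simp only [coord, adjoint_elemFamily, adjoint_rankOne, rankOne_apply, map_smul,
    real_inner_smul_left]
  ring

end IsCylMartingaleValuedMeasure

/-- The data of an elementary integrand of rank one, `1_{(s,T]} 1_F 1_A (g ⊗ h) ∘ i*`. -/
structure ElemData (ℱ : Filtration ℝ≥0 mΩ) (R : Set (Set U)) (T : ℝ≥0) (H G : Type*) where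
  s : ℝ≥0
  s_le : s ≤ T
  F : Set Ω
  measurableSet_F : MeasurableSet[ℱ s] F
  A : Set U
  A_mem : A ∈ R
  g : G
  h : H

namespace IsCylMartingaleValuedMeasure

variable [IsProbabilityMeasure P]

lemma memLp_indicator_incr_smul (hM : IsCylMartingaleValuedMeasure P ℱ R M μ lam q) {s t : ℝ≥0}
    {F : Set Ω} (hF : MeasurableSet[ℱ s] F) {A : Set U} (hA : A ∈ R) (h : H) (g : G) :
    MemLp (fun ω => F.indicator (hM.incr s t hA h) ω • g) 2 P :=
  (ContinuousLinearMap.toSpanSingleton ℝ g).comp_memLp'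
    ((Lp.memLp (hM.incr s t hA h)).indicator (ℱ.le s _ hF))

/-- The integral of an elementary integrand of rank one. -/
def elemInt (hM : IsCylMartingaleValuedMeasure P ℱ R M μ lam q) {T : ℝ≥0}
    (e : ElemData ℱ R T H G) : Lp G 2 P :=
  (hM.memLp_indicator_incr_smul (t := T) e.measurableSet_F e.A_mem e.h e.g).toLp

lemma elemInt_ae_eq (hM : IsCylMartingaleValuedMeasure P ℱ R M μ lam q) {T : ℝ≥0}
    (e : ElemData ℱ R T H G) :
    hM.elemInt e =ᵐ[P] fun ω => e.F.indicator (hM.incr e.s T e.A_mem e.h) ω • e.g :=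
  MemLp.coeFn_toLp _

/-- The increment of `e` is split at the start of `e'`. Its earlier part drops out by the martingale
property; independence applies to the later part, since F ∩ F' is known at the later start. -/
lemma inner_elemInt_of_le (hM : IsCylMartingaleValuedMeasure P ℱ R M μ lam q) {T : ℝ≥0}
    (e e' : ElemData ℱ R T H G) (hs : e.s ≤ e'.s) :
    (inner ℝ (hM.elemInt e) (hM.elemInt e') : ℝ)
      = inner ℝ e.g e'.g * (P.real (e.F ∩ e'.F) *
        inner ℝ (hM.incr (max e.s e'.s) T (hM.isSetRing.inter_mem e.A_mem e'.A_mem) e.h)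
          (hM.incr (max e.s e'.s) T (hM.isSetRing.inter_mem e.A_mem e'.A_mem) e'.h)) := by
  have hF : MeasurableSet[ℱ e'.s] (e.F ∩ e'.F) :=
    (ℱ.mono hs _ e.measurableSet_F).inter e'.measurableSet_F
  have hFm := ℱ.le _ _ hF
  rw [max_eq_right hs, ← hM.inner_incr_eq_inter e'.s T e.A_mem e'.A_mem,
    ← hM.setIntegral_incr_mul_incr e'.s_le e.A_mem e'.A_mem hF]
  have h0 := hM.setIntegral_incr_mul_incr_of_le hs e'.s_le e.A_mem e'.A_mem hF e.h e'.h
  have i1 : Integrable (fun ω => hM.incr e.s e'.s e.A_mem e.h ω * hM.incr e'.s T e'.A_mem e'.h ω) P :=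
    (Lp.memLp _).integrable_mul (Lp.memLp _)
  have i2 : Integrable (fun ω => hM.incr e'.s T e.A_mem e.h ω * hM.incr e'.s T e'.A_mem e'.h ω) P :=
    (Lp.memLp _).integrable_mul (Lp.memLp _)
  have hsum := integral_add (i1.integrableOn (s := e.F ∩ e'.F)) (i2.integrableOn (s := e.F ∩ e'.F))
  rw [h0, zero_add] at hsum
  rw [L2.inner_def, ← hsum, ← integral_indicator hFm, ← integral_const_mul]
  refine integral_congr_ae ?_
  have hadd := Lp.coeFn_add (hM.incr e.s e'.s e.A_mem e.h) (hM.incr e'.s T e.A_mem e.h)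
  rw [hM.incr_add_incr] at hadd
  filter_upwards [hM.elemInt_ae_eq e, hM.elemInt_ae_eq e', hadd] with ω h1 h2 h3
  rw [h1, h2, real_inner_smul_left, real_inner_smul_right]
  by_cases hω : ω ∈ e.F <;> by_cases hω' : ω ∈ e'.F <;> simp [hω, hω', h3]
  ring

lemma inner_elemInt (hM : IsCylMartingaleValuedMeasure P ℱ R M μ lam q) {T : ℝ≥0}
    (e e' : ElemData ℱ R T H G) :
    (inner ℝ (hM.elemInt e) (hM.elemInt e') : ℝ)
      = inner ℝ e.g e'.g * (P.real (e.F ∩ e'.F) *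
        inner ℝ (hM.incr (max e.s e'.s) T (hM.isSetRing.inter_mem e.A_mem e'.A_mem) e.h)
          (hM.incr (max e.s e'.s) T (hM.isSetRing.inter_mem e.A_mem e'.A_mem) e'.h)) := by
  rcases le_total e.s e'.s with hs | hs
  · exact hM.inner_elemInt_of_le e e' hs
  · rw [real_inner_comm, hM.inner_elemInt_of_le e' e hs, real_inner_comm, Set.inter_comm e'.F,
      max_comm, real_inner_comm (hM.incr _ T _ e.h)]
    simp only [Set.inter_comm e'.A]

variable [CompleteSpace G] [SeparableSpace G]

lemma memLambda2_elemData (hM : IsCylMartingaleValuedMeasure P ℱ R M μ lam q) {T : ℝ≥0}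
    (e : ElemData ℱ R T H G) :
    MemLambda2 P ℱ μ lam (elemFamily q T e.s T e.F e.A (rankOne ℝ e.g e.h)) :=
  hM.memLambda2_elemFamily T e.measurableSet_F e.A_mem (isHilbertSchmidt_rankOne e.g e.h)

/-- The closed span of the elementary integrands of rank one. -/
def elemSpan (hM : IsCylMartingaleValuedMeasure P ℱ R M μ lam q) (T : ℝ≥0) (G : Type*)
    [NormedAddCommGroup G] [InnerProductSpace ℝ G] [CompleteSpace G] [SeparableSpace G] :
    Submodule ℝ (Lp ℝ 2 (coordMeasure ℱ P μ lam T)) :=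
  (Submodule.span ℝ (Set.range fun e : ElemData ℱ R T H G =>
    hM.coordLp (hM.memLambda2_elemData e))).topologicalClosure

/-- The stochastic integral exists as an isometry on the closed span of the elementary integrands
of rank one. -/
lemma exists_isometry (hM : IsCylMartingaleValuedMeasure P ℱ R M μ lam q) (T : ℝ≥0) :
    ∃ L : Lp ℝ 2 (coordMeasure ℱ P μ lam T) →L[ℝ] Lp G 2 P,
      (∀ e : ElemData ℱ R T H G, L (hM.coordLp (hM.memLambda2_elemData e)) = hM.elemInt e) ∧
      ∀ x ∈ hM.elemSpan T G, ‖L x‖ = ‖x‖ := by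
  -- Both Gram entries equal ⟨g,g'⟩ P(F ∩ F') times the inner product of the increments over (s ∨
  -- s', T] and A ∩ A'.
  refine exists_isometry_of_gram fun e e' => ?_
  rw [hM.inner_coordLp_rankOne, hM.inner_elemInt,
    hM.integral_elemWeight_mul_form (max_le e.s_le e'.s_le) ?_
      (hM.isSetRing.inter_mem e.A_mem e'.A_mem)]
  exact (ℱ.mono (le_max_left _ _) _ e.measurableSet_F).inter
    (ℱ.mono (le_max_right _ _) _ e'.measurableSet_F)

end IsCylMartingaleValuedMeasure

end GramIdentity

/-! ### Density of the elementary integrands -/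

/-- An integrable function whose integrals over a generating `π`-system vanish is zero. -/
lemma ae_eq_zero_of_forall_piSystem {α : Type*} {m : MeasurableSpace α} {ν : Measure α}
    {y : α → ℝ} (hy : Integrable y ν) {C : Set (Set α)}
    (hm : m = MeasurableSpace.generateFrom C) (hC : IsPiSystem C) (huniv : ∫ a, y a ∂ν = 0)
    (h : ∀ B ∈ C, ∫ a in B, y a ∂ν = 0) : y =ᵐ[ν] 0 := by
  refine hy.ae_eq_zero_of_forall_setIntegral_eq_zero fun B hB hfin => ?_
  clear hfin
  induction B, hB using MeasurableSpace.induction_on_inter hm hC with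
  | empty => simp
  | basic B hB => exact h B hB
  | compl B hB ih =>
    have := integral_add_compl hB hy
    rwa [ih, huniv, zero_add] at this
  | iUnion f hd hf ih => rw [integral_iUnion hf hd hy.integrableOn]; simp [ih]

section PredictableRectangles

variable {Ω U : Type*} {mΩ : MeasurableSpace Ω}

/-- A `π`-system generating the predictable `σ`-algebra. -/
def predRectangles (ℱ : Filtration ℝ≥0 mΩ) (T : ℝ≥0) : Set (Set (PredSpace ℱ T)) :=
  insert Set.univ ({E | ∃ F, MeasurableSet[ℱ 0] F ∧ E = {p | (p.time : ℝ≥0) = 0 ∧ p.state ∈ F}} ∪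
    {E | ∃ s F, MeasurableSet[ℱ s] F ∧ E = {p | s < (p.time : ℝ≥0) ∧ p.state ∈ F}})

lemma isPiSystem_predRectangles (ℱ : Filtration ℝ≥0 mΩ) (T : ℝ≥0) :
    IsPiSystem (predRectangles ℱ T) := by
  refine IsPiSystem.insert_univ ?_
  rintro _ (⟨F, hF, rfl⟩ | ⟨s, F, hF, rfl⟩) _ (⟨F', hF', rfl⟩ | ⟨s', F', hF', rfl⟩) hne
  · refine Or.inl ⟨F ∩ F', hF.inter hF', ?_⟩
    ext p
    simp only [Set.mem_inter_iff, Set.mem_ofPred_eq]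
    tauto
  · obtain ⟨p, ⟨h1, -⟩, h2, -⟩ := hne
    rw [h1] at h2
    exact absurd h2 not_lt_zero
  · obtain ⟨p, ⟨h1, -⟩, h2, -⟩ := hne
    rw [h2] at h1
    exact absurd h1 not_lt_zero
  · refine Or.inr ⟨max s s', F ∩ F', (ℱ.mono (le_max_left _ _) _ hF).inter
      (ℱ.mono (le_max_right _ _) _ hF'), ?_⟩
    ext p
    simp only [Set.mem_inter_iff, Set.mem_ofPred_eq, max_lt_iff]
    tauto

lemma generateFrom_predRectangles (ℱ : Filtration ℝ≥0 mΩ) (T : ℝ≥0) :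
    MeasurableSpace.generateFrom (predRectangles ℱ T)
      = (inferInstance : MeasurableSpace (PredSpace ℱ T)) := by
  rw [predRectangles, MeasurableSpace.generateFrom_insert_univ]
  refine le_antisymm (MeasurableSpace.generateFrom_le ?_) ?_
  · rintro _ (⟨F, hF, rfl⟩ | ⟨s, F, hF, rfl⟩)
    · have h1 : MeasurableSet {p : PredSpace ℱ T | (p.time : ℝ≥0) = 0} :=
        measurable_time (measurableSet_singleton 0)
      have h := measurable_predSpace_incl ℱ T (measurableSet_predictable_singleton_bot_prod hF)
      convert h using 1
      ext p
      simp
    · exact measurableSet_predSpace_Ioi s hF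
  · change MeasurableSpace.comap _ (MeasurableSpace.generateFrom _) ≤ _
    rw [MeasurableSpace.comap_generateFrom]
    refine MeasurableSpace.generateFrom_mono ?_
    rintro _ ⟨_, ⟨F, hF, rfl⟩ | ⟨s, F, hF, rfl⟩, rfl⟩
    · refine Or.inl ⟨F, hF, ?_⟩
      ext p
      exact Iff.rfl
    · exact Or.inr ⟨s, F, hF, rfl⟩

variable [MeasurableSpace U] {ℱ : Filtration ℝ≥0 mΩ} {P : Measure Ω} {μ : Measure U}
  {lam : Measure ℝ≥0} {T : ℝ≥0}

/-- Time 0 carries no mass, so the generators {0} × F of the predictable σ-algebra play no role in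
the density argument. -/
lemma ae_time_pos [SFinite P] [SFinite μ] :
    ∀ᵐ x ∂(intMeasure ℱ P μ lam T), 0 < (x.1.time : ℝ≥0) := by
  have hset : MeasurableSet {p : PredSpace ℱ T | 0 < (p.time : ℝ≥0)} :=
    measurable_time measurableSet_Ioi
  have h1 : ∀ᵐ r : Set.Icc (0 : ℝ≥0) T ∂(timeMeasure lam T), 0 < (r : ℝ≥0) :=
    ae_restrict_mem (s := {r : Set.Icc (0 : ℝ≥0) T | 0 < (r : ℝ≥0)}) (measurable_subtype_coe measurableSet_Ioi)
  have h2 : ∀ᵐ p ∂(predMeasure ℱ P lam T), 0 < (p.time : ℝ≥0) := by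
    rw [predMeasure, ae_map_iff (measurable_toPredSpace ℱ T).aemeasurable hset]
    exact Measure.quasiMeasurePreserving_fst.ae h1
  exact Measure.quasiMeasurePreserving_fst.ae h2

end PredictableRectangles

section Density

open InnerProductSpace

variable {Ω U H G : Type*} {mΩ : MeasurableSpace Ω}
  [TopologicalSpace U] [MeasurableSpace U] [BorelSpace U]
  [NormedAddCommGroup H] [InnerProductSpace ℝ H] [CompleteSpace H] [SeparableSpace H]
  {P : Measure Ω} [IsProbabilityMeasure P] {ℱ : Filtration ℝ≥0 mΩ}
  {R : Set (Set U)} {M : ℝ≥0 → Set U → H →ₗ[ℝ] (Ω →ₘ[P] ℝ)}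
  {μ : Measure U} {lam : Measure ℝ≥0} {q : ℝ≥0 → U → HilbertianSeminorm H}

namespace IsCylMartingaleValuedMeasure

/-- A square integrable function which is orthogonal to the indicators of all predictable
rectangles vanishes. -/
lemma ae_eq_zero_of_forall_elemWeight (hM : IsCylMartingaleValuedMeasure P ℱ R M μ lam q) {T : ℝ≥0}
    {y : PredSpace ℱ T × U → ℝ} (hy : MemLp y 2 (intMeasure ℱ P μ lam T))
    (h : ∀ s ≤ T, ∀ F, MeasurableSet[ℱ s] F → ∀ A ∈ R,
      ∫ x, elemWeight s T F A x.1.time x.1.state x.2 * y x ∂(intMeasure ℱ P μ lam T) = 0) :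
    y =ᵐ[intMeasure ℱ P μ lam T] 0 := by
  classical
  have := hM.sigmaFinite_μ
  have := isFiniteMeasure_predMeasure (ℱ := ℱ) (P := P) (hM.lam_lt_top T)
  have hrect : ∀ s F, MeasurableSet[ℱ s] F → ∀ A ∈ R,
      ∫ x in {p : PredSpace ℱ T | s < (p.time : ℝ≥0) ∧ p.state ∈ F} ×ˢ A, y x
        ∂(intMeasure ℱ P μ lam T) = 0 := by
    intro s F hF A hA
    rcases le_or_gt s T with hs | hs
    · rw [← h s hs F hF A hA, ← integral_indicator
        ((measurableSet_predSpace_Ioi s hF).prod (hM.measurableSet hA))]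
      refine integral_congr_ae (ae_of_all _ fun x => ?_)
      have : (x.1.time : ℝ≥0) ≤ T := x.1.time.2.2
      simp only [elemWeight_eq_indicator, Set.indicator, Set.mem_prod, Set.mem_ofPred_eq, this,
        and_true, and_assoc, ite_mul, one_mul, zero_mul]
    · have : {p : PredSpace ℱ T | s < (p.time : ℝ≥0) ∧ p.state ∈ F} = ∅ :=
        Set.eq_empty_of_forall_notMem fun p hp =>
          (hs.trans hp.1).not_ge p.time.2.2
      simp [this]
  -- Restricting to `A₀` makes the measure finite and `y` integrable, as the π-system argument
  -- requires; the countable exhaustion of `U` glues the local statements.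
  have hloc : ∀ A₀ ∈ R, y =ᵐ[(intMeasure ℱ P μ lam T).restrict (Set.univ ×ˢ A₀)] 0 := by
    intro A₀ hA₀
    have hset : MeasurableSet (Set.univ ×ˢ A₀ : Set (PredSpace ℱ T × U)) :=
      MeasurableSet.univ.prod (hM.measurableSet hA₀)
    have : IsFiniteMeasure ((intMeasure ℱ P μ lam T).restrict (Set.univ ×ˢ A₀)) := ⟨by
      rw [Measure.restrict_apply_univ, intMeasure, Measure.prod_prod]
      exact ENNReal.mul_lt_top (measure_lt_top _ _) (hM.μ_lt_top A₀ hA₀)⟩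
    have hR : IsPiSystem R := fun A hA B hB _ => hM.isSetRing.inter_mem hA hB
    have hall : ∀ E ∈ predRectangles ℱ T, ∀ A ∈ insert Set.univ R,
        ∫ x in E ×ˢ A, y x ∂((intMeasure ℱ P μ lam T).restrict (Set.univ ×ˢ A₀)) = 0 := by
      intro E hE A hA
      have hA' : A ∩ A₀ ∈ R := by
        rcases hA with rfl | hA
        · rwa [Set.univ_inter]
        · exact hM.isSetRing.inter_mem hA hA₀
      have hEm : MeasurableSet E := (generateFrom_predRectangles ℱ T).le E
        (MeasurableSpace.measurableSet_generateFrom hE)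
      have hAm : MeasurableSet A := by
        rcases hA with rfl | hA
        · exact MeasurableSet.univ
        · exact hM.measurableSet hA
      rw [Measure.restrict_restrict (hEm.prod hAm), Set.prod_inter_prod, Set.inter_univ]
      rcases hE with rfl | ⟨F, hF, rfl⟩ | ⟨s, F, hF, rfl⟩
      -- Up to a null set the whole space is the rectangle of positive times with `F` the whole of
      -- Ω.
      · rw [← hrect 0 Set.univ MeasurableSet.univ _ hA']
        refine setIntegral_congr_set ?_
        filter_upwards [ae_time_pos (ℱ := ℱ) (P := P) (μ := μ) (lam := lam) (T := T)] with x hx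
        exact propext ⟨fun hx' => ⟨⟨hx, trivial⟩, hx'.2⟩, fun hx' => ⟨trivial, hx'.2⟩⟩
      · refine setIntegral_measure_zero _ ?_
        refine measure_mono_null (fun x hx => ?_)
          (ae_time_pos (ℱ := ℱ) (P := P) (μ := μ) (lam := lam) (T := T))
        exact fun h0 => h0.ne' hx.1.1
      · exact hrect s F hF _ hA'
    refine ae_eq_zero_of_forall_piSystem
      ((hy.restrict (Set.univ ×ˢ A₀)).integrable one_le_two)
      (C := Set.image2 (· ×ˢ ·) (predRectangles ℱ T) (insert Set.univ R)) ?_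
      ((isPiSystem_predRectangles ℱ T).prod hR.insert_univ) ?_ ?_
    · symm
      refine generateFrom_eq_prod (generateFrom_predRectangles ℱ T) ?_
        ⟨fun _ => Set.univ, fun _ => Or.inl rfl, Set.iUnion_const _⟩
        ⟨fun _ => Set.univ, fun _ => Or.inl rfl, Set.iUnion_const _⟩
      rw [MeasurableSpace.generateFrom_insert_univ]
      exact hM.generates.symm
    · have := hall Set.univ (Or.inl rfl) Set.univ (Or.inl rfl)
      rwa [Set.univ_prod_univ, Measure.restrict_univ] at this
    · rintro _ ⟨E, hE, A, hA, rfl⟩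
      exact hall E hE A hA
  obtain ⟨A, hA, hnull⟩ := hM.exhausts
  have h1 : ∀ᵐ x ∂(intMeasure ℱ P μ lam T), ∀ n, x ∈ (Set.univ ×ˢ A n : Set (PredSpace ℱ T × U)) →
      y x = 0 :=
    ae_all_iff.2 fun n => (ae_restrict_iff' (MeasurableSet.univ.prod
      (hM.measurableSet (hA n)))).1 (hloc _ (hA n))
  have h2 : ∀ᵐ x ∂(intMeasure ℱ P μ lam T), x.2 ∈ ⋃ n, A n :=
    Measure.quasiMeasurePreserving_snd.ae (p := fun u => u ∈ ⋃ n, A n) hnull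
  filter_upwards [h1, h2] with x hx hx2
  obtain ⟨n, hn⟩ := Set.mem_iUnion.1 hx2
  exact hx n ⟨trivial, hn⟩

variable [NormedAddCommGroup G] [InnerProductSpace ℝ G] [CompleteSpace G] [SeparableSpace G]

/-- Test with g the m-th Parseval vector and h the k-th vector of the dense sequence. Orthogonality
in `G` selects row m, and triangularity of Gram–Schmidt leaves a finite sum over n ≤ k, which
vanishes almost everywhere by `ae_eq_zero_of_forall_elemWeight`. The coordinates are then found to
be zero one after another; those at a zero frame vector are not determined. -/
lemma ae_coord_eq_zero_of_orthogonal (hM : IsCylMartingaleValuedMeasure P ℱ R M μ lam q) {T : ℝ≥0}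
    (x : Lp ℝ 2 (coordMeasure ℱ P μ lam T))
    (hx : ∀ e : ElemData ℱ R T H G,
      (inner ℝ x (hM.coordLp (hM.memLambda2_elemData e)) : ℝ) = 0)
    {m : ℕ} (hm : parsevalSeq G m ≠ 0) :
    ∀ᵐ p ∂(intMeasure ℱ P μ lam T), ∀ n, (q p.1.time p.2).frame n ≠ 0 → x (p, (m, n)) = 0 := by
  have := hM.sigmaFinite_μ
  have := isFiniteMeasure_predMeasure (ℱ := ℱ) (P := P) (hM.lam_lt_top T)
  have : SigmaFinite (intMeasure ℱ P μ lam T) := by unfold intMeasure; infer_instance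
  obtain ⟨C, hC⟩ := hM.exists_form_bound T
  have hxm : StronglyMeasurable x := Lp.stronglyMeasurable x
  have hxn : ∀ n, MemLp (fun p => x (p, (m, n))) 2 (intMeasure ℱ P μ lam T) := by
    intro n
    have hmn : StronglyMeasurable fun p : PredSpace ℱ T × U => x (p, (m, n)) :=
      hxm.comp_measurable measurable_prodMk_right
    rw [memLp_two_iff_lintegral_lt_top hmn.aestronglyMeasurable]
    have h0 := (memLp_two_iff_lintegral_lt_top hxm.aestronglyMeasurable).1 (Lp.memLp x)
    have h1 : ∫⁻ z, ‖x z‖ₑ ^ 2 ∂(coordMeasure ℱ P μ lam T)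
        = ∫⁻ p, ∫⁻ i, ‖x (p, i)‖ₑ ^ 2 ∂Measure.count ∂(intMeasure ℱ P μ lam T) :=
      lintegral_prod _ (hxm.enorm.pow_const 2).aemeasurable
    rw [h1] at h0
    refine (lintegral_mono fun p => ?_).trans_lt h0
    rw [lintegral_count]
    exact ENNReal.le_tsum (f := fun i => ‖x (p, i)‖ₑ ^ 2) (m, n)
  set y : ℕ → PredSpace ℱ T × U → ℝ := fun k p => ∑ n ∈ Finset.range (k + 1),
    inner ℝ ((q p.1.time p.2).denseIncl k) ((q p.1.time p.2).frame n) * x (p, (m, n)) with hy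
  have hyL : ∀ k, MemLp (y k) 2 (intMeasure ℱ P μ lam T) := by
    intro k
    refine memLp_finsetSum _ fun n _ => ?_
    have hmeas : Measurable fun p : PredSpace ℱ T × U =>
        (inner ℝ ((q p.1.time p.2).denseIncl k) ((q p.1.time p.2).frame n) : ℝ) :=
      HilbertianSeminorm.measurable_inner_frame
        (q := fun p : PredSpace ℱ T × U => q p.1.time p.2)
        (measurable_q_predSpace hM.q_measurable) (fun h => by
          simpa only [HilbertianSeminorm.denseIncl, HilbertianSeminorm.inner_incl] using
            measurable_q_predSpace hM.q_measurable _ h) n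
    refine MemLp.of_le_mul (c := √(C * ‖denseSeq H k‖ ^ 2)) (hxn n)
      (hmeas.aestronglyMeasurable.mul (hxn n).1) (ae_of_all _ fun p => ?_)
    rw [norm_mul]
    refine mul_le_mul_of_nonneg_right ?_ (norm_nonneg _)
    refine (norm_inner_le_norm _ _).trans ?_
    have h1 : ‖(q p.1.time p.2).frame n‖ ≤ 1 := by
      by_cases h0 : (q p.1.time p.2).frame n = 0
      · simp [h0]
      · exact (gramSchmidtNormed_unit_length' h0).le
    have h2 : ‖(q p.1.time p.2).denseIncl k‖ ≤ √(C * ‖denseSeq H k‖ ^ 2) := by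
      refine Real.le_sqrt_of_sq_le ?_
      rw [← real_inner_self_eq_norm_sq, HilbertianSeminorm.denseIncl,
        HilbertianSeminorm.inner_incl]
      exact hC _ p.1.time.2.2 _ _
    calc _ ≤ √(C * ‖denseSeq H k‖ ^ 2) * 1 :=
          mul_le_mul h2 h1 (norm_nonneg _) (Real.sqrt_nonneg _)
      _ = _ := mul_one _
  have hy0 : ∀ k, y k =ᵐ[intMeasure ℱ P μ lam T] 0 := by
    intro k
    refine hM.ae_eq_zero_of_forall_elemWeight (hyL k) fun s hs F hF A hA => ?_
    have h0 := hx ⟨s, hs, F, hF, A, hA, parsevalSeq G m, denseSeq H k⟩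
    have hE := hM.memLambda2_elemData
      (⟨s, hs, F, hF, A, hA, parsevalSeq G m, denseSeq H k⟩ : ElemData ℱ R T H G)
    have hint : Integrable (fun z => x z * coord ℱ (elemFamily q T s T F A
        (rankOne ℝ (parsevalSeq G m) (denseSeq H k))) z) (coordMeasure ℱ P μ lam T) :=
      (Lp.memLp x).integrable_mul (hM.memLp_coord hE)
    have h1 : (inner ℝ x (hM.coordLp hE) : ℝ) = ∫ z, x z * coord ℱ (elemFamily q T s T F A
        (rankOne ℝ (parsevalSeq G m) (denseSeq H k))) z ∂(coordMeasure ℱ P μ lam T) := by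
      rw [L2.inner_def]
      refine integral_congr_ae ?_
      filter_upwards [hM.coordLp_ae_eq hE] with z hz
      rw [hz]
      exact mul_comm _ _
    rw [← h0]
    refine Eq.trans ?_ h1.symm
    refine Eq.trans ?_ (integral_prod _ hint).symm
    refine integral_congr_ae (ae_of_all _ fun p => ?_)
    refine (integral_count_eq_of_hasSum ?_).symm
    have hsum := hasSum_sum_of_ne_finset_zero (L := .unconditional _)
      (s := ({m} : Finset ℕ) ×ˢ Finset.range (k + 1))
      (f := fun i : ℕ × ℕ => x (p, i) * coord ℱ (elemFamily q T s T F A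
        (rankOne ℝ (parsevalSeq G m) (denseSeq H k))) (p, i)) (fun i hi => by
        simp only [coord, adjoint_elemFamily, adjoint_rankOne, rankOne_apply, map_smul,
          real_inner_smul_left]
        by_cases hi1 : i.1 = m
        · have hi2 : k < i.2 := by
            by_contra hcon
            exact hi (Finset.mem_product.2 ⟨Finset.mem_singleton.2 hi1,
              Finset.mem_range.2 (by omega)⟩)
          have := (q p.1.time p.2).inner_frame_denseIncl_of_lt hi2
          rw [HilbertianSeminorm.denseIncl] at this
          rw [this]
          ring
        · have := inner_gramSchmidtNormed_of_ne (denseSeq G) (Ne.symm hi1)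
          rw [parsevalSeq, parsevalSeq, this]
          ring)
    convert hsum using 1
    rw [Finset.sum_product, Finset.sum_singleton]
    simp only [hy, Finset.mul_sum]
    refine Finset.sum_congr rfl fun n _ => ?_
    have := inner_gramSchmidtNormed_self (denseSeq G) hm
    simp only [coord, adjoint_elemFamily, adjoint_rankOne, rankOne_apply, map_smul,
      real_inner_smul_left]
    rw [parsevalSeq, this, HilbertianSeminorm.denseIncl]
    ring
  filter_upwards [ae_all_iff.2 hy0] with p hp n
  -- Forward substitution: in equation n the earlier terms vanish and the diagonal coefficient is
  -- nonzero.
  induction n using Nat.strong_induction_on with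
  | _ n ih =>
    intro hn
    have h0 := hp n
    simp only [hy, Pi.zero_apply] at h0
    rw [Finset.sum_range_succ, Finset.sum_eq_zero, zero_add] at h0
    · exact (mul_eq_zero.1 h0).resolve_left
        ((q p.1.time p.2).inner_frame_denseIncl_self_ne_zero hn)
    · intro i hi
      by_cases hf : (q p.1.time p.2).frame i = 0
      · rw [hf, inner_zero_right, zero_mul]
      · rw [ih i (Finset.mem_range.1 hi) hf, mul_zero]

/-- By the double orthogonal complement. A function orthogonal to the elementary integrands can be
nonzero only at indices of zero vectors, exactly where the coordinates of Φ vanish. -/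
lemma coordLp_mem_elemSpan (hM : IsCylMartingaleValuedMeasure P ℱ R M μ lam q) {T : ℝ≥0}
    {Φ : OperatorFamily Ω G q T} (hΦ : MemLambda2 P ℱ μ lam Φ) :
    hM.coordLp hΦ ∈ hM.elemSpan T G := by
  have := hM.sigmaFinite_μ
  have := isFiniteMeasure_predMeasure (ℱ := ℱ) (P := P) (hM.lam_lt_top T)
  have : SigmaFinite (intMeasure ℱ P μ lam T) := by unfold intMeasure; infer_instance
  rw [elemSpan, ← Submodule.orthogonal_orthogonal_eq_closure, Submodule.mem_orthogonal]
  intro x hx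
  have hx' : ∀ e : ElemData ℱ R T H G,
      (inner ℝ x (hM.coordLp (hM.memLambda2_elemData e)) : ℝ) = 0 := fun e =>
    (Submodule.mem_orthogonal' _ x).1 hx _ (Submodule.subset_span ⟨e, rfl⟩)
  have hae : ∀ᵐ p ∂(intMeasure ℱ P μ lam T), ∀ m, parsevalSeq G m ≠ 0 → ∀ n,
      (q p.1.time p.2).frame n ≠ 0 → x (p, (m, n)) = 0 := by
    refine ae_all_iff.2 fun m => ?_
    by_cases hm : parsevalSeq G m = 0
    · exact ae_of_all _ fun p h => absurd hm h
    · filter_upwards [hM.ae_coord_eq_zero_of_orthogonal x hx' hm] with p hp _ using hp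
  have hint : Integrable (fun z => x z * coord ℱ Φ z) (coordMeasure ℱ P μ lam T) :=
    (Lp.memLp x).integrable_mul (hM.memLp_coord hΦ)
  have h1 : (inner ℝ x (hM.coordLp hΦ) : ℝ)
      = ∫ z, x z * coord ℱ Φ z ∂(coordMeasure ℱ P μ lam T) := by
    rw [L2.inner_def]
    refine integral_congr_ae ?_
    filter_upwards [hM.coordLp_ae_eq hΦ] with z hz
    rw [hz]
    exact mul_comm _ _
  refine (h1.trans (integral_prod _ hint)).trans ?_
  refine integral_eq_zero_of_ae ?_
  filter_upwards [hae] with p hp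
  refine integral_eq_zero_of_ae (ae_of_all _ fun i => ?_)
  simp only [coord, Pi.zero_apply]
  by_cases hm : parsevalSeq G i.1 = 0
  · rw [hm, map_zero, inner_zero_left, mul_zero]
  by_cases hn : (q p.1.time p.2).frame i.2 = 0
  · rw [hn, inner_zero_right, mul_zero]
  · rw [show x (p, i) = 0 from hp i.1 hm i.2 hn, zero_mul]

end IsCylMartingaleValuedMeasure

end Density

/-! ### The stochastic integral at a fixed time -/

section Cut

variable {α : Type*} {m : MeasurableSpace α}

/-- Multiplication by the indicator of a measurable set on `L²`. -/
def cutLp (ν : Measure α) {S : Set α} (hS : MeasurableSet S) : Lp ℝ 2 ν →L[ℝ] Lp ℝ 2 ν :=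
  LinearMap.mkContinuous
    { toFun := fun x => ((Lp.memLp x).indicator hS).toLp
      map_add' := fun x y => by
        rw [← MemLp.toLp_add]
        refine MemLp.toLp_congr _ _ ?_
        filter_upwards [Lp.coeFn_add x y] with a ha
        rw [Pi.add_apply, ← Pi.add_apply (S.indicator x), ← Set.indicator_add']
        exact congrArg (fun v => S.indicator (fun _ => v) a) ha
      map_smul' := fun c x => by
        rw [RingHom.id_apply, ← MemLp.toLp_const_smul]
        refine MemLp.toLp_congr _ _ ?_
        filter_upwards [Lp.coeFn_smul c x] with a ha
        rw [Pi.smul_apply, ← Set.indicator_const_smul_apply]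
        exact congrArg (fun v => S.indicator (fun _ => v) a) ha } 1 fun x => by
    rw [one_mul]
    refine Lp.norm_le_norm_of_ae_le ?_
    filter_upwards [((Lp.memLp x).indicator hS).coeFn_toLp] with a ha
    exact (congrArg norm ha).le.trans (norm_indicator_le_norm_self _ _)

lemma cutLp_ae_eq {ν : Measure α} {S : Set α} (hS : MeasurableSet S) (x : Lp ℝ 2 ν) :
    cutLp ν hS x =ᵐ[ν] S.indicator x :=
  ((Lp.memLp x).indicator hS).coeFn_toLp

lemma Lp_enorm_sq_eq_lintegral {E : Type*} [NormedAddCommGroup E] {ν : Measure α} (x : Lp E 2 ν) :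
    ‖x‖ₑ ^ 2 = ∫⁻ a, ‖x a‖ₑ ^ 2 ∂ν := by
  rw [Lp.enorm_def, eLpNorm_eq_lintegral_rpow_enorm_toReal (by simp) (by simp),
    ← ENNReal.rpow_natCast, ← ENNReal.rpow_mul]
  norm_num

lemma enorm_cutLp_sq {ν : Measure α} {S : Set α} (hS : MeasurableSet S) (x : Lp ℝ 2 ν) :
    ‖cutLp ν hS x‖ₑ ^ 2 = ∫⁻ a in S, ‖x a‖ₑ ^ 2 ∂ν := by
  rw [Lp_enorm_sq_eq_lintegral, ← lintegral_indicator hS]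
  refine lintegral_congr_ae ?_
  filter_upwards [cutLp_ae_eq hS x] with a ha
  rw [ha]
  by_cases h : a ∈ S <;> simp [h]

end Cut

lemma measurableSet_coord_time_le {Ω U : Type*} {mΩ : MeasurableSpace Ω} [MeasurableSpace U]
    (ℱ : Filtration ℝ≥0 mΩ) (T t : ℝ≥0) :
    MeasurableSet {z : (PredSpace ℱ T × U) × (ℕ × ℕ) | (z.1.1.time : ℝ≥0) ≤ t} :=
  measurableSet_le (measurable_time.comp (measurable_fst.comp measurable_fst)) measurable_const

section ItoMap

open InnerProductSpace

variable {Ω U H G : Type*} {mΩ : MeasurableSpace Ω}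
  [TopologicalSpace U] [MeasurableSpace U] [BorelSpace U]
  [NormedAddCommGroup H] [InnerProductSpace ℝ H] [CompleteSpace H] [SeparableSpace H]
  [NormedAddCommGroup G] [InnerProductSpace ℝ G] [CompleteSpace G] [SeparableSpace G]
  {P : Measure Ω} [IsProbabilityMeasure P] {ℱ : Filtration ℝ≥0 mΩ}
  {R : Set (Set U)} {M : ℝ≥0 → Set U → H →ₗ[ℝ] (Ω →ₘ[P] ℝ)}
  {μ : Measure U} {lam : Measure ℝ≥0} {q : ℝ≥0 → U → HilbertianSeminorm H}

namespace IsCylMartingaleValuedMeasure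

lemma coordLp_congr (hM : IsCylMartingaleValuedMeasure P ℱ R M μ lam q) {T : ℝ≥0}
    {Φ Ψ : OperatorFamily Ω G q T} (hΦ : MemLambda2 P ℱ μ lam Φ) (hΨ : MemLambda2 P ℱ μ lam Ψ)
    (h : Φ = Ψ) : hM.coordLp hΦ = hM.coordLp hΨ := by
  subst h
  rfl

lemma cutLp_coordLp (hM : IsCylMartingaleValuedMeasure P ℱ R M μ lam q) {T : ℝ≥0}
    {Φ Ψ : OperatorFamily Ω G q T} (hΦ : MemLambda2 P ℱ μ lam Φ) (hΨ : MemLambda2 P ℱ μ lam Ψ)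
    {S : Set ((PredSpace ℱ T × U) × (ℕ × ℕ))} (hS : MeasurableSet S)
    (h : ∀ z, S.indicator (coord ℱ Φ) z = coord ℱ Ψ z) :
    cutLp (coordMeasure ℱ P μ lam T) hS (hM.coordLp hΦ) = hM.coordLp hΨ := by
  refine Lp.ext ?_
  filter_upwards [cutLp_ae_eq hS (hM.coordLp hΦ), hM.coordLp_ae_eq hΦ, hM.coordLp_ae_eq hΨ]
    with z h1 h2 h3
  rw [h1, h3, ← h z]
  by_cases hz : z ∈ S <;> simp [hz, h2]

/-- The truncation to `(0, t]`. -/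
def truncLp (_hM : IsCylMartingaleValuedMeasure P ℱ R M μ lam q) (T t : ℝ≥0) :
    Lp ℝ 2 (coordMeasure ℱ P μ lam T) →L[ℝ] Lp ℝ 2 (coordMeasure ℱ P μ lam T) :=
  cutLp _ (measurableSet_coord_time_le ℱ T t)

/-- Only the region cut out in time and Ω matters, so `hw` leaves the endpoints and the event free.
Later uses choose them so that adaptedness is preserved, or take the event empty. -/
lemma truncLp_coordLp_elemFamily (hM : IsCylMartingaleValuedMeasure P ℱ R M μ lam q)
    {T s t s' t' : ℝ≥0} (r : ℝ≥0) {F F' : Set Ω} {A : Set U} {S : H →L[ℝ] G}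
    (h : MemLambda2 P ℱ μ lam (elemFamily q T s t F A S))
    (h' : MemLambda2 P ℱ μ lam (elemFamily q T s' t' F' A S))
    (hw : ∀ a ω, (s < a ∧ a ≤ t) ∧ a ≤ r ∧ ω ∈ F ↔ (s' < a ∧ a ≤ t') ∧ ω ∈ F') :
    hM.truncLp T r (hM.coordLp h) = hM.coordLp h' := by
  classical
  refine hM.cutLp_coordLp h h' _ fun z => ?_
  have hz := hw z.1.1.time z.1.1.state
  simp only [Set.indicator, Set.mem_ofPred_eq, coord, adjoint_elemFamily, real_inner_smul_left,
    elemWeight_eq_indicator, ite_mul, one_mul, zero_mul]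
  split_ifs <;> first | rfl | (exfalso; tauto)

/-- The stochastic integral over `(0, T]`, as a map on coordinates. -/
def itoMap (hM : IsCylMartingaleValuedMeasure P ℱ R M μ lam q) (T : ℝ≥0) (G : Type*)
    [NormedAddCommGroup G] [InnerProductSpace ℝ G] [CompleteSpace G] [SeparableSpace G] :
    Lp ℝ 2 (coordMeasure ℱ P μ lam T) →L[ℝ] Lp G 2 P :=
  (hM.exists_isometry (G := G) T).choose

lemma itoMap_elem (hM : IsCylMartingaleValuedMeasure P ℱ R M μ lam q) {T : ℝ≥0}
    (e : ElemData ℱ R T H G) :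
    hM.itoMap T G (hM.coordLp (hM.memLambda2_elemData e)) = hM.elemInt e :=
  (hM.exists_isometry (G := G) T).choose_spec.1 e

lemma norm_itoMap (hM : IsCylMartingaleValuedMeasure P ℱ R M μ lam q) {T : ℝ≥0}
    {x : Lp ℝ 2 (coordMeasure ℱ P μ lam T)} (hx : x ∈ hM.elemSpan T G) :
    ‖hM.itoMap T G x‖ = ‖x‖ :=
  (hM.exists_isometry (G := G) T).choose_spec.2 x hx

/-- Two continuous linear maps which agree on the elementary integrands agree on `Λ²(M,T)`. -/
lemma eq_of_eq_on_elem (hM : IsCylMartingaleValuedMeasure P ℱ R M μ lam q) {T : ℝ≥0}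
    {W : Type*} [NormedAddCommGroup W] [NormedSpace ℝ W]
    {K L : Lp ℝ 2 (coordMeasure ℱ P μ lam T) →L[ℝ] W}
    (h : ∀ e : ElemData ℱ R T H G, K (hM.coordLp (hM.memLambda2_elemData e))
      = L (hM.coordLp (hM.memLambda2_elemData e)))
    {x : Lp ℝ 2 (coordMeasure ℱ P μ lam T)} (hx : x ∈ hM.elemSpan T G) : K x = L x := by
  have h1 : hM.elemSpan T G ≤ LinearMap.eqLocus K.toLinearMap L.toLinearMap := by
    refine Submodule.topologicalClosure_minimal _ (Submodule.span_le.2 ?_)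
      (isClosed_eq K.continuous L.continuous)
    rintro _ ⟨e, rfl⟩
    exact h e
  exact h1 hx

/-- For B in ℱ_t, the event B ∩ F is known at the start of the increment, over which the increment
integrates to zero. -/
lemma condExp_elemInt_eq_zero (hM : IsCylMartingaleValuedMeasure P ℱ R M μ lam q) {T t : ℝ≥0}
    (e : ElemData ℱ R T H G) (ht : t ≤ e.s) : P[hM.elemInt e|ℱ t] =ᵐ[P] 0 := by
  symm
  refine ae_eq_condExp_of_forall_setIntegral_eq (ℱ.le t)
    ((Lp.memLp (hM.elemInt e)).integrable one_le_two) (fun _ _ _ => integrableOn_zero)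
    (fun B hB _ => ?_) stronglyMeasurable_zero.aestronglyMeasurable
  have hF : MeasurableSet[ℱ e.s] (B ∩ e.F) := (ℱ.mono ht _ hB).inter e.measurableSet_F
  have h0 := hM.setIntegral_incr e.s_le e.A_mem hF e.h
  rw [setIntegral_congr_ae (ℱ.le t _ hB) ((hM.elemInt_ae_eq e).mono fun ω hω _ => hω),
    integral_smul_const, setIntegral_indicator (ℱ.le _ _ e.measurableSet_F), h0]
  simp

/-- The part of an elementary integrand after time `t`. -/
def _root_.ElemData.after {T : ℝ≥0} (e : ElemData ℱ R T H G) {t : ℝ≥0} (ht : t ≤ T) (h : e.s ≤ t) :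
    ElemData ℱ R T H G :=
  ⟨t, ht, e.F, ℱ.mono h _ e.measurableSet_F, e.A, e.A_mem, e.g, e.h⟩

lemma elemInt_sub_elemInt_after (hM : IsCylMartingaleValuedMeasure P ℱ R M μ lam q) {T t : ℝ≥0}
    (e : ElemData ℱ R T H G) (ht : t ≤ T) (h : e.s ≤ t) :
    (hM.elemInt e - hM.elemInt (e.after ht h) : Lp G 2 P)
      =ᵐ[P] fun ω => e.F.indicator (hM.incr e.s t e.A_mem e.h) ω • e.g := by
  have hadd := Lp.coeFn_add (hM.incr e.s t e.A_mem e.h) (hM.incr t T e.A_mem e.h)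
  rw [hM.incr_add_incr] at hadd
  filter_upwards [Lp.coeFn_sub (hM.elemInt e) (hM.elemInt (e.after ht h)), hM.elemInt_ae_eq e,
    hM.elemInt_ae_eq (e.after ht h), hadd] with ω h1 h2 h3 h4
  rw [h1, Pi.sub_apply, h2, h3]
  by_cases hω : ω ∈ e.F
  · simp [ElemData.after, hω, h4, add_smul]
  · simp [ElemData.after, hω]

lemma coordLp_elem_sub_after (hM : IsCylMartingaleValuedMeasure P ℱ R M μ lam q) {T t : ℝ≥0}
    (e : ElemData ℱ R T H G) (ht : t ≤ T) (h : e.s ≤ t)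
    (h' : MemLambda2 P ℱ μ lam (elemFamily q T e.s t e.F e.A (rankOne ℝ e.g e.h))) :
    hM.coordLp (hM.memLambda2_elemData e) - hM.coordLp (hM.memLambda2_elemData (e.after ht h))
      = hM.coordLp h' := by
  classical
  refine Lp.ext ?_
  filter_upwards [Lp.coeFn_sub (hM.coordLp (hM.memLambda2_elemData e))
      (hM.coordLp (hM.memLambda2_elemData (e.after ht h))),
    hM.coordLp_ae_eq (hM.memLambda2_elemData e),
    hM.coordLp_ae_eq (hM.memLambda2_elemData (e.after ht h)), hM.coordLp_ae_eq h']
    with z h1 h2 h3 h4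
  rw [h1, Pi.sub_apply, h2, h3, h4]
  have hz : (z.1.1.time : ℝ≥0) ≤ T := z.1.1.time.2.2
  simp only [coord, adjoint_elemFamily, real_inner_smul_left, ElemData.after, ← sub_mul]
  congr 1
  simp only [elemWeight_eq_indicator, hz, and_true]
  split_ifs <;> grind

lemma itoMap_rankOne (hM : IsCylMartingaleValuedMeasure P ℱ R M μ lam q) {T t : ℝ≥0}
    (e : ElemData ℱ R T H G) (ht : t ≤ T) (h : e.s ≤ t)
    (h' : MemLambda2 P ℱ μ lam (elemFamily q T e.s t e.F e.A (rankOne ℝ e.g e.h))) :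
    hM.itoMap T G (hM.coordLp h')
      =ᵐ[P] fun ω => e.F.indicator (hM.incr e.s t e.A_mem e.h) ω • e.g := by
  rw [← hM.coordLp_elem_sub_after e ht h h', map_sub, hM.itoMap_elem, hM.itoMap_elem]
  exact hM.elemInt_sub_elemInt_after e ht h

/-- If the integrand starts by time t, it splits into a part over (s,t] with ℱ_t-measurable integral
and a part over (t,T] with zero conditional expectation. If it starts later, both sides vanish; the
truncated integrand is then written with an empty event. -/
lemma condExp_itoMap_elem (hM : IsCylMartingaleValuedMeasure P ℱ R M μ lam q) {T t : ℝ≥0}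
    (ht : t ≤ T) (e : ElemData ℱ R T H G) :
    P[hM.itoMap T G (hM.coordLp (hM.memLambda2_elemData e))|ℱ t]
      =ᵐ[P] hM.itoMap T G (hM.truncLp T t (hM.coordLp (hM.memLambda2_elemData e))) := by
  rcases le_or_gt e.s t with hs | hs
  · have h' := hM.memLambda2_elemFamily (T := T) t e.measurableSet_F e.A_mem
      (isHilbertSchmidt_rankOne e.g e.h)
    rw [hM.truncLp_coordLp_elemFamily t (hM.memLambda2_elemData e) h' fun a ω => by
      constructor
      · tauto
      · rintro ⟨⟨h1, h2⟩, h3⟩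
        exact ⟨⟨h1, h2.trans ht⟩, h2, h3⟩]
    refine EventuallyEq.trans ?_ (hM.itoMap_rankOne e ht hs h').symm
    rw [hM.itoMap_elem]
    have hV : StronglyMeasurable[ℱ t]
        fun ω => e.F.indicator (fun ω => M t e.A e.h ω - M e.s e.A e.h ω) ω • e.g :=
      ((((hM.martingale e.A e.A_mem e.h).1 t).sub
        (((hM.martingale e.A e.A_mem e.h).1 e.s).mono (ℱ.mono hs))).indicator
        (ℱ.mono hs _ e.measurableSet_F)).smul_const e.g
    have hV' : (fun ω => e.F.indicator (hM.incr e.s t e.A_mem e.h) ω • e.g) =ᵐ[P]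
        fun ω => e.F.indicator (fun ω => M t e.A e.h ω - M e.s e.A e.h ω) ω • e.g := by
      filter_upwards [hM.incr_ae_eq e.s t e.A_mem e.h] with ω hω
      by_cases hF : ω ∈ e.F <;> simp [hF, hω]
    have hVi := (hM.memLp_indicator_incr_smul (t := t) e.measurableSet_F e.A_mem e.h
      e.g).integrable one_le_two
    have hi := (Lp.memLp (hM.elemInt (e.after ht hs))).integrable one_le_two
    have e1 : hM.elemInt e =ᵐ[P] (fun ω => e.F.indicator (hM.incr e.s t e.A_mem e.h) ω • e.g) +
        hM.elemInt (e.after ht hs) := by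
      filter_upwards [hM.elemInt_sub_elemInt_after e ht hs,
        Lp.coeFn_sub (hM.elemInt e) (hM.elemInt (e.after ht hs))] with ω h1 h2
      rw [Pi.add_apply, ← h1, h2]
      simp
    have e2 := condExp_of_aestronglyMeasurable' (ℱ.le t) ⟨_, hV, hV'⟩ hVi
    filter_upwards [condExp_congr_ae (m := ℱ t) e1, condExp_add hVi hi (ℱ t), e2,
      hM.condExp_elemInt_eq_zero (e.after ht hs) le_rfl] with ω h1 h2 h3 h4
    rw [h1, h2, Pi.add_apply, h3]
    erw [h4]
    simp
  · have h' := hM.memLambda2_elemFamily (T := T) (s := e.s) e.s (F := ∅)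
      (@MeasurableSet.empty _ (ℱ e.s)) e.A_mem (isHilbertSchmidt_rankOne e.g e.h)
    have h0 : hM.coordLp h' = 0 := by
      refine Lp.ext ?_
      filter_upwards [hM.coordLp_ae_eq h', Lp.coeFn_zero ℝ 2 (coordMeasure ℱ P μ lam T)]
        with z h1 h2
      rw [h1, h2]
      simp [coord, adjoint_elemFamily, elemWeight]
    rw [hM.truncLp_coordLp_elemFamily t (hM.memLambda2_elemData e) h' fun a ω => by
      constructor
      · rintro ⟨⟨h1, -⟩, h2, -⟩
        exact absurd (hs.trans h1) h2.not_gt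
      · rintro ⟨-, h⟩
        exact h.elim, h0, map_zero, hM.itoMap_elem]
    exact (hM.condExp_elemInt_eq_zero e hs.le).trans (Lp.coeFn_zero G 2 P).symm

/-- On `L²` conditional expectation is an orthogonal projection, so both sides are continuous and
linear in `x`, and agreement on elementary integrands suffices. -/
lemma condExp_itoMap (hM : IsCylMartingaleValuedMeasure P ℱ R M μ lam q) {T t : ℝ≥0}
    (ht : t ≤ T) {x : Lp ℝ 2 (coordMeasure ℱ P μ lam T)} (hx : x ∈ hM.elemSpan T G) :
    P[hM.itoMap T G x|ℱ t] =ᵐ[P] hM.itoMap T G (hM.truncLp T t x) := by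
  set E : Lp G 2 P →L[ℝ] Lp G 2 P := (lpMeas G ℝ (ℱ t) 2 P).subtypeL.comp
    (condExpL2 G ℝ (ℱ.le t)) with hE
  have hEc : ∀ y : Lp G 2 P, E y =ᵐ[P] P[y|ℱ t] := fun y => by
    have := (Lp.memLp y).condExpL2_ae_eq_condExp (𝕜 := ℝ) (ℱ.le t)
    rwa [Lp.toLp_coeFn] at this
  have h := hM.eq_of_eq_on_elem (K := E.comp (hM.itoMap T G))
    (L := (hM.itoMap T G).comp (hM.truncLp T t)) (fun e => Lp.ext ?_) hx
  · refine (hEc _).symm.trans ?_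
    rw [← ContinuousLinearMap.comp_apply, h]
    rfl
  · exact (hEc _).trans (hM.condExp_itoMap_elem ht e)

lemma truncLp_mem_elemSpan (hM : IsCylMartingaleValuedMeasure P ℱ R M μ lam q) {T : ℝ≥0} (t : ℝ≥0)
    {x : Lp ℝ 2 (coordMeasure ℱ P μ lam T)} (hx : x ∈ hM.elemSpan T G) :
    hM.truncLp T t x ∈ hM.elemSpan T G := by
  have h1 : hM.elemSpan T G ≤ (hM.elemSpan T G).comap (hM.truncLp T t).toLinearMap := by
    refine Submodule.topologicalClosure_minimal _ (Submodule.span_le.2 ?_)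
      ((Submodule.isClosed_topologicalClosure _).preimage (hM.truncLp T t).continuous)
    rintro _ ⟨e, rfl⟩
    have h' := hM.memLambda2_elemFamily (T := T) (min t T) e.measurableSet_F e.A_mem
      (isHilbertSchmidt_rankOne e.g e.h)
    have := hM.truncLp_coordLp_elemFamily t (hM.memLambda2_elemData e) h' fun a ω => by
      rw [le_min_iff]; tauto
    rw [SetLike.mem_coe, Submodule.mem_comap, ContinuousLinearMap.coe_coe, this]
    exact hM.coordLp_mem_elemSpan h'
  exact h1 hx

lemma truncLp_zero (hM : IsCylMartingaleValuedMeasure P ℱ R M μ lam q) {T : ℝ≥0}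
    (x : Lp ℝ 2 (coordMeasure ℱ P μ lam T)) : hM.truncLp T 0 x = 0 := by
  have := hM.sigmaFinite_μ
  have h0 : ∀ᵐ z ∂(coordMeasure ℱ P μ lam T), 0 < (z.1.1.time : ℝ≥0) :=
    Measure.quasiMeasurePreserving_fst.ae ae_time_pos
  refine Lp.ext ?_
  filter_upwards [cutLp_ae_eq (measurableSet_coord_time_le ℱ T 0) x, h0,
    Lp.coeFn_zero ℝ 2 (coordMeasure ℱ P μ lam T)] with z h1 h2 h3
  rw [h3, truncLp, h1]
  exact Set.indicator_of_notMem
    (s := {z : (PredSpace ℱ T × U) × (ℕ × ℕ) | (z.1.1.time : ℝ≥0) ≤ 0}) h2.not_ge _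

/-- The conditional expectation given ℱ₀ is the integral over the empty interval (0,0]. -/
lemma integral_itoMap (hM : IsCylMartingaleValuedMeasure P ℱ R M μ lam q) {T : ℝ≥0}
    {x : Lp ℝ 2 (coordMeasure ℱ P μ lam T)} (hx : x ∈ hM.elemSpan T G) :
    ∫ ω, hM.itoMap T G x ω ∂P = 0 := by
  rw [← integral_condExp (ℱ.le 0), integral_congr_ae (hM.condExp_itoMap zero_le hx),
    hM.truncLp_zero, map_zero, integral_congr_ae (Lp.coeFn_zero G 2 P)]
  simp

/-- The isometry at time `t`. -/
lemma lintegral_enorm_itoMap_truncLp (hM : IsCylMartingaleValuedMeasure P ℱ R M μ lam q) {T : ℝ≥0}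
    {Φ : OperatorFamily Ω G q T} (hΦ : MemLambda2 P ℱ μ lam Φ) (t : ℝ≥0) :
    ∫⁻ ω, ‖hM.itoMap T G (hM.truncLp T t (hM.coordLp hΦ)) ω‖ₑ ^ 2 ∂P = energy P μ lam Φ t := by
  have := hM.sigmaFinite_μ
  have h1 := hM.norm_itoMap (hM.truncLp_mem_elemSpan t (hM.coordLp_mem_elemSpan hΦ))
  rw [← Lp_enorm_sq_eq_lintegral, ← ofReal_norm, h1, ofReal_norm, truncLp, enorm_cutLp_sq,
    energy_eq_lintegral_coord (hM.lam_lt_top T) (measurable_coord hM.q_measurable hΦ.predictable)]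
  refine setLIntegral_congr_fun_ae (measurableSet_coord_time_le ℱ T t) ?_
  filter_upwards [hM.coordLp_ae_eq hΦ] with z hz _
  rw [hz]

end IsCylMartingaleValuedMeasure

end ItoMap

/-! ### Radonification by Hilbert–Schmidt operators -/

section ParsevalDense

variable {G : Type*} [NormedAddCommGroup G] [InnerProductSpace ℝ G] [CompleteSpace G]
  [SeparableSpace G]

lemma eq_zero_of_forall_inner_parsevalSeq {y : G}
    (h : ∀ m, (inner ℝ y (parsevalSeq G m) : ℝ) = 0) : y = 0 := by
  have := tsum_enorm_inner_parsevalSeq_sq y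
  simpa [h] using this.symm

lemma dense_span_parsevalSeq :
    Dense (Submodule.span ℝ (Set.range (parsevalSeq G)) : Set G) := by
  rw [Submodule.dense_iff_topologicalClosure_eq_top, Submodule.topologicalClosure_eq_top_iff,
    Submodule.eq_bot_iff]
  intro y hy
  exact eq_zero_of_forall_inner_parsevalSeq fun m =>
    (Submodule.mem_orthogonal' _ y).1 hy _ (Submodule.subset_span ⟨m, rfl⟩)

end ParsevalDense

section InnerLp

variable {Ω G : Type*} {mΩ : MeasurableSpace Ω} {P : Measure Ω} [NormedAddCommGroup G]
  [InnerProductSpace ℝ G]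

/-- The map `g ↦ ⟨y, g⟩` from `G` to `L²`, for `y` a square integrable `G`-valued variable. -/
def innerLp (y : Lp G 2 P) : G →L[ℝ] Lp ℝ 2 P :=
  LinearMap.mkContinuous
    { toFun := fun g => (innerSL ℝ g).compLp y
      map_add' := fun g g' => by rw [map_add, ContinuousLinearMap.add_compLp]
      map_smul' := fun c g => by
        rw [map_smul, RingHom.id_apply]
        exact ContinuousLinearMap.smul_compLp c _ y } ‖y‖ fun g => by
    have := ContinuousLinearMap.norm_compLp_le (innerSL ℝ g) y
    rwa [innerSL_apply_norm, mul_comm] at this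

lemma innerLp_ae_eq (y : Lp G 2 P) (g : G) :
    innerLp y g =ᵐ[P] fun ω => (inner ℝ (y ω) g : ℝ) := by
  filter_upwards [ContinuousLinearMap.coeFn_compLp (innerSL ℝ g) y] with ω h
  rw [real_inner_comm]
  exact h

end InnerLp

section Radonification

open InnerProductSpace

variable {Ω U H G : Type*} {mΩ : MeasurableSpace Ω}
  [TopologicalSpace U] [MeasurableSpace U] [BorelSpace U]
  [NormedAddCommGroup H] [InnerProductSpace ℝ H] [CompleteSpace H] [SeparableSpace H]
  [NormedAddCommGroup G] [InnerProductSpace ℝ G] [CompleteSpace G] [SeparableSpace G]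
  {P : Measure Ω} [IsProbabilityMeasure P] {ℱ : Filtration ℝ≥0 mΩ}
  {R : Set (Set U)} {M : ℝ≥0 → Set U → H →ₗ[ℝ] (Ω →ₘ[P] ℝ)}
  {μ : Measure U} {lam : Measure ℝ≥0} {q : ℝ≥0 → U → HilbertianSeminorm H}

namespace IsCylMartingaleValuedMeasure

/-- The covariance formula with the uniform bound on `q` gives K² = C μ(A) λ((s,t]). -/
lemma exists_norm_incr_le (hM : IsCylMartingaleValuedMeasure P ℱ R M μ lam q) {s t : ℝ≥0}
    (hst : s ≤ t) {A : Set U} (hA : A ∈ R) :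
    ∃ K : ℝ, ∀ h, ‖hM.incr s t hA h‖ ≤ K * ‖h‖ := by
  rcases hst.eq_or_lt with rfl | hst
  · exact ⟨0, fun h => by simp [incr_self]⟩
  obtain ⟨C, hC⟩ := hM.exists_form_bound t
  set D : ℝ≥0∞ := μ A * lam (Set.Ioc s t) with hD
  have hDfin : D < ∞ := ENNReal.mul_lt_top (hM.μ_lt_top A hA)
    ((measure_mono (Set.Ioc_subset_Icc_self.trans
      (Set.Icc_subset_Icc_left zero_le))).trans_lt (hM.lam_lt_top t))
  refine ⟨√(C * D.toReal), fun h => ?_⟩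
  have h1 : ‖hM.incr s t hA h‖ₑ ^ 2 ≤ ENNReal.ofReal (C * ‖h‖ ^ 2) * D := by
    rw [hM.enorm_incr_sq hst hA h]
    calc _ ≤ ∫⁻ r in Set.Ioc s t, ∫⁻ u in A, ENNReal.ofReal (C * ‖h‖ ^ 2) ∂μ ∂lam := by
          refine setLIntegral_mono' measurableSet_Ioc fun r hr => ?_
          exact lintegral_mono fun u => ENNReal.ofReal_le_ofReal (hC r hr.2 u h)
      _ = _ := by
          rw [setLIntegral_const, setLIntegral_const, hD, mul_assoc]
  have h2 : ‖hM.incr s t hA h‖ ^ 2 ≤ C * D.toReal * ‖h‖ ^ 2 := by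
    have h3 := ENNReal.toReal_mono (ENNReal.mul_ne_top ENNReal.ofReal_ne_top hDfin.ne) h1
    rw [ENNReal.toReal_mul, ENNReal.toReal_ofReal (by positivity), ENNReal.toReal_pow,
      toReal_enorm] at h3
    linarith
  refine le_of_sq_le_sq ?_ (by positivity)
  rw [mul_pow, Real.sq_sqrt (by positivity)]
  exact h2

/-- The increment `M((s,t],A)` as a continuous linear map from `H` to `L²`. -/
def incrL (hM : IsCylMartingaleValuedMeasure P ℱ R M μ lam q) {s t : ℝ≥0} (hst : s ≤ t)
    {A : Set U} (hA : A ∈ R) : H →L[ℝ] Lp ℝ 2 P :=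
  LinearMap.mkContinuousOfExistsBound
    { toFun := hM.incr s t hA
      map_add' := hM.incr_add s t hA
      map_smul' := hM.incr_smul s t hA } (hM.exists_norm_incr_le hst hA)

lemma measurableSet_row (ℱ : Filtration ℝ≥0 mΩ) (T : ℝ≥0) (m : ℕ) :
    MeasurableSet {z : (PredSpace ℱ T × U) × (ℕ × ℕ) | z.2.1 = m} :=
  (measurable_fst.comp measurable_snd) (measurableSet_singleton m)

/-- Row m of the coordinates sees `S` only through S*g_m, and g_m ⊗ S*g_m has that same row and no
other since the g_m are orthogonal and g_m is a unit vector. -/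
lemma cutLp_row_coordLp (hM : IsCylMartingaleValuedMeasure P ℱ R M μ lam q)
    {T s t : ℝ≥0} {F : Set Ω} {A : Set U} {S : H →L[ℝ] G} {m : ℕ} (hm : parsevalSeq G m ≠ 0)
    (h : MemLambda2 P ℱ μ lam (elemFamily q T s t F A S))
    (h' : MemLambda2 P ℱ μ lam (elemFamily q T s t F A
      (rankOne ℝ (parsevalSeq G m) (ContinuousLinearMap.adjoint S (parsevalSeq G m))))) :
    cutLp (coordMeasure ℱ P μ lam T) (measurableSet_row ℱ T m) (hM.coordLp h)
      = hM.coordLp h' := by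
  refine hM.cutLp_coordLp h h' _ fun z => ?_
  simp only [Set.indicator, Set.mem_ofPred_eq, coord, adjoint_elemFamily, adjoint_rankOne,
    rankOne_apply, map_smul, real_inner_smul_left]
  by_cases hz : z.2.1 = m
  · have := inner_gramSchmidtNormed_self (denseSeq G) hm
    rw [if_pos hz, hz]
    nth_rw 2 [parsevalSeq]
    nth_rw 2 [parsevalSeq]
    rw [this, one_mul]
  · have := inner_gramSchmidtNormed_of_ne (denseSeq G) (Ne.symm hz)
    rw [if_neg hz, parsevalSeq, parsevalSeq, this]
    ring

/-- The g_m-component of the integral depends only on row m of the integrand. On elementary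
integrands both sides are ⟨g,g_m⟩ 1_F M((s,T],A)(h); continuity does the rest. -/
lemma innerLp_itoMap_cutLp_row (hM : IsCylMartingaleValuedMeasure P ℱ R M μ lam q) {T : ℝ≥0}
    {m : ℕ} (hm : parsevalSeq G m ≠ 0) {x : Lp ℝ 2 (coordMeasure ℱ P μ lam T)}
    (hx : x ∈ hM.elemSpan T G) :
    innerLp (hM.itoMap T G x) (parsevalSeq G m) = innerLp (hM.itoMap T G
      (cutLp (coordMeasure ℱ P μ lam T) (measurableSet_row ℱ T m) x)) (parsevalSeq G m) := by
  set J : Lp G 2 P →L[ℝ] Lp ℝ 2 P := (innerSL ℝ (parsevalSeq G m)).compLpL 2 P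
  refine hM.eq_of_eq_on_elem (K := J.comp (hM.itoMap T G)) (L := (J.comp (hM.itoMap T G)).comp
    (cutLp (coordMeasure ℱ P μ lam T) (measurableSet_row ℱ T m))) (fun e => ?_) hx
  have hadj : ContinuousLinearMap.adjoint (rankOne ℝ e.g e.h) (parsevalSeq G m)
      = (inner ℝ e.g (parsevalSeq G m) : ℝ) • e.h := by
    rw [adjoint_rankOne, rankOne_apply]
  set e' : ElemData ℱ R T H G := ⟨e.s, e.s_le, e.F, e.measurableSet_F, e.A, e.A_mem,
    parsevalSeq G m, (inner ℝ e.g (parsevalSeq G m) : ℝ) • e.h⟩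
  have h' := hM.memLambda2_elemData e'
  have hcut := hM.cutLp_row_coordLp hm (hM.memLambda2_elemData e) (by rw [hadj]; exact h')
  have hcut' : cutLp (coordMeasure ℱ P μ lam T) (measurableSet_row ℱ T m)
      (hM.coordLp (hM.memLambda2_elemData e)) = hM.coordLp h' :=
    hcut.trans (hM.coordLp_congr _ _ (by rw [hadj]))
  rw [ContinuousLinearMap.comp_apply, ContinuousLinearMap.comp_apply, hcut',
    ContinuousLinearMap.comp_apply, hM.itoMap_elem, hM.itoMap_elem]
  refine Lp.ext ?_
  have hsm := Lp.coeFn_smul (inner ℝ e.g (parsevalSeq G m) : ℝ) (hM.incr e.s T e.A_mem e.h)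
  rw [← hM.incr_smul] at hsm
  filter_upwards [ContinuousLinearMap.coeFn_compLpL (innerSL ℝ (parsevalSeq G m)) (hM.elemInt e),
    ContinuousLinearMap.coeFn_compLpL (innerSL ℝ (parsevalSeq G m)) (hM.elemInt e'),
    hM.elemInt_ae_eq e, hM.elemInt_ae_eq e', hsm] with ω h1 h2 h3 h4 h5
  rw [h1, h2, h3, h4]
  have hself := inner_gramSchmidtNormed_self (denseSeq G) hm
  have hself' : (inner ℝ (parsevalSeq G m) (parsevalSeq G m) : ℝ) = 1 := hself
  simp only [innerSL_apply_apply, real_inner_smul_right, e']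
  rw [hself', real_inner_comm]
  by_cases hω : ω ∈ e.F
  · rw [Set.indicator_of_mem hω, Set.indicator_of_mem hω, h5, Pi.smul_apply, smul_eq_mul]
    ring
  · rw [Set.indicator_of_notMem hω, Set.indicator_of_notMem hω]
    ring

/-- The integral of `1_{(s,t]} 1_F 1_A S ∘ i*` is the radonification by `S` of
`1_F M((s,t],A)`. -/
lemma inner_itoMap_elemFamily (hM : IsCylMartingaleValuedMeasure P ℱ R M μ lam q) {T s t : ℝ≥0}
    (hst : s ≤ t) (htT : t ≤ T) {F : Set Ω} (hF : MeasurableSet[ℱ s] F) {A : Set U} (hA : A ∈ R)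
    {S : H →L[ℝ] G} (h : MemLambda2 P ℱ μ lam (elemFamily q T s t F A S)) (g : G) :
    ∀ᵐ ω ∂P, (inner ℝ (hM.itoMap T G (hM.coordLp h) ω) g : ℝ)
      = F.indicator (hM.incr s t hA (ContinuousLinearMap.adjoint S g)) ω := by
  -- Both sides are continuous and linear in g. On a Parseval vector, cutting to its row replaces
  -- `S` by a rank one operator, whose integral is explicit.
  have key : innerLp (hM.itoMap T G (hM.coordLp h)) = (cutLp P (ℱ.le s _ hF)).comp
      ((hM.incrL hst hA).comp (ContinuousLinearMap.adjoint S)) := by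
    refine ContinuousLinearMap.ext_on dense_span_parsevalSeq ?_
    rintro _ ⟨m, rfl⟩
    by_cases hm : parsevalSeq G m = 0
    · rw [hm, map_zero, map_zero]
    set e : ElemData ℱ R T H G := ⟨s, hst.trans htT, F, hF, A, hA, parsevalSeq G m,
      ContinuousLinearMap.adjoint S (parsevalSeq G m)⟩
    have h' := hM.memLambda2_elemFamily (T := T) t hF hA (isHilbertSchmidt_rankOne
      (parsevalSeq G m) (ContinuousLinearMap.adjoint S (parsevalSeq G m)))
    rw [hM.innerLp_itoMap_cutLp_row hm (hM.coordLp_mem_elemSpan h),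
      hM.cutLp_row_coordLp hm h h']
    refine Lp.ext ?_
    filter_upwards [innerLp_ae_eq (hM.itoMap T G (hM.coordLp h')) (parsevalSeq G m),
      hM.itoMap_rankOne e htT hst h', cutLp_ae_eq (ℱ.le s _ hF)
        (hM.incr s t hA (ContinuousLinearMap.adjoint S (parsevalSeq G m)))] with ω h1 h2 h3
    rw [h1, h2]
    refine Eq.trans ?_ h3.symm
    have hself := inner_gramSchmidtNormed_self (denseSeq G) hm
    have hself' : (inner ℝ (parsevalSeq G m) (parsevalSeq G m) : ℝ) = 1 := hself
    rw [real_inner_smul_left, hself', mul_one]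
  filter_upwards [innerLp_ae_eq (hM.itoMap T G (hM.coordLp h)) g,
    cutLp_ae_eq (ℱ.le s _ hF) (hM.incr s t hA (ContinuousLinearMap.adjoint S g))] with ω h1 h2
  rw [← h1, key]
  exact h2

/-- The indicator of an `ℱ_s`-measurable event can be taken out of the integral over `(s,t]`. -/
lemma itoMap_elemFamily_indicator (hM : IsCylMartingaleValuedMeasure P ℱ R M μ lam q)
    {T s t : ℝ≥0} (hst : s ≤ t) (htT : t ≤ T) {F : Set Ω} (hF : MeasurableSet[ℱ s] F) {A : Set U}
    (hA : A ∈ R) {S : H →L[ℝ] G} (h : MemLambda2 P ℱ μ lam (elemFamily q T s t F A S))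
    (h' : MemLambda2 P ℱ μ lam (elemFamily q T s t Set.univ A S)) :
    hM.itoMap T G (hM.coordLp h) =ᵐ[P] F.indicator (hM.itoMap T G (hM.coordLp h')) := by
  have h1 := ae_all_iff.2 fun m =>
    hM.inner_itoMap_elemFamily hst htT hF hA h (parsevalSeq G m)
  have h2 := ae_all_iff.2 fun m =>
    hM.inner_itoMap_elemFamily hst htT (@MeasurableSet.univ _ (ℱ s)) hA h' (parsevalSeq G m)
  filter_upwards [h1, h2] with ω h1 h2
  rw [← sub_eq_zero]
  refine eq_zero_of_forall_inner_parsevalSeq fun m => ?_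
  rw [inner_sub_left, h1 m]
  by_cases hω : ω ∈ F
  · rw [Set.indicator_of_mem hω, Set.indicator_of_mem hω, h2 m, Set.indicator_univ, sub_self]
  · rw [Set.indicator_of_notMem hω, Set.indicator_of_notMem hω, inner_zero_left, sub_self]

end IsCylMartingaleValuedMeasure

end Radonification

/-! ### The stochastic integral process -/

section StochasticIntegral

variable {Ω U H G : Type*} {mΩ : MeasurableSpace Ω}
  [TopologicalSpace U] [MeasurableSpace U] [BorelSpace U]
  [NormedAddCommGroup H] [InnerProductSpace ℝ H] [CompleteSpace H] [SeparableSpace H]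
  [NormedAddCommGroup G] [InnerProductSpace ℝ G] [CompleteSpace G] [SeparableSpace G]
  {P : Measure Ω} [IsProbabilityMeasure P] {ℱ : Filtration ℝ≥0 mΩ}
  {R : Set (Set U)} {M : ℝ≥0 → Set U → H →ₗ[ℝ] (Ω →ₘ[P] ℝ)}
  {μ : Measure U} {lam : Measure ℝ≥0} {q : ℝ≥0 → U → HilbertianSeminorm H} {T : ℝ≥0}

namespace IsCylMartingaleValuedMeasure

/-- `X` is a càdlàg version of the stochastic integral process of `Φ`. -/
structure IsIntegralProcess (hM : IsCylMartingaleValuedMeasure P ℱ R M μ lam q)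
    {Φ : OperatorFamily Ω G q T} (hΦ : MemLambda2 P ℱ μ lam Φ)
    (X : Set.Icc (0 : ℝ≥0) T → Ω → G) : Prop where
  isCadlagL2Martingale : IsCadlagL2Martingale ℱ P T X
  ae_eq : ∀ t, X t =ᵐ[P] hM.itoMap T G (hM.truncLp T t (hM.coordLp hΦ))

lemma exists_isIntegralProcess (hM : IsCylMartingaleValuedMeasure P ℱ R M μ lam q)
    (hℱ : UsualConditions ℱ P) {Φ : OperatorFamily Ω G q T} (hΦ : MemLambda2 P ℱ μ lam Φ) :
    ∃ X, hM.IsIntegralProcess hΦ X := by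
  obtain ⟨X, hX, hX'⟩ := exists_cadlag_condExp (T := T) hℱ
    (Lp.memLp (hM.itoMap T G (hM.coordLp hΦ)))
  exact ⟨X, hX, fun t => (hX' t).trans (hM.condExp_itoMap t.2.2 (hM.coordLp_mem_elemSpan hΦ))⟩

namespace IsIntegralProcess

variable {hM : IsCylMartingaleValuedMeasure P ℱ R M μ lam q}
  {Φ Ψ : OperatorFamily Ω G q T} {hΦ : MemLambda2 P ℱ μ lam Φ} {hΨ : MemLambda2 P ℱ μ lam Ψ}
  {X Y Z : Set.Icc (0 : ℝ≥0) T → Ω → G}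

lemma lintegral_enorm_sq (hX : hM.IsIntegralProcess hΦ X) (t : Set.Icc (0 : ℝ≥0) T) :
    ∫⁻ ω, ‖X t ω‖ₑ ^ 2 ∂P = energy P μ lam Φ t := by
  rw [← hM.lintegral_enorm_itoMap_truncLp hΦ t]
  refine lintegral_congr_ae ?_
  filter_upwards [hX.ae_eq t] with ω h
  rw [h]

lemma integral_eq_zero (hX : hM.IsIntegralProcess hΦ X) (t : Set.Icc (0 : ℝ≥0) T) :
    ∫ ω, X t ω ∂P = 0 := by
  rw [integral_congr_ae (hX.ae_eq t)]
  exact hM.integral_itoMap (hM.truncLp_mem_elemSpan t (hM.coordLp_mem_elemSpan hΦ))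

lemma m2Norm_le (hX : hM.IsIntegralProcess hΦ X) :
    m2Norm P T X ≤ 2 * lambda2Norm P μ lam Φ := by
  refine hX.isCadlagL2Martingale.m2Norm_le.trans (le_of_eq ?_)
  rw [hX.lintegral_enorm_sq (endPt T)]
  rfl

lemma linear {a b : ℝ} {hab : MemLambda2 P ℱ μ lam (a • Φ + b • Ψ)}
    (hZ : hM.IsIntegralProcess hab Z) (hX : hM.IsIntegralProcess hΦ X)
    (hY : hM.IsIntegralProcess hΨ Y) :
    ∀ᵐ ω ∂P, ∀ t, Z t ω = a • X t ω + b • Y t ω := by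
  refine indistinguishable_of_modification (Y := fun t ω => a • X t ω + b • Y t ω)
    hZ.isCadlagL2Martingale.right_continuous (fun ω t =>
      ((hX.isCadlagL2Martingale.right_continuous ω t).const_smul a).add
        ((hY.isCadlagL2Martingale.right_continuous ω t).const_smul b)) fun t => ?_
  have h := hZ.ae_eq t
  rw [hM.coordLp_linear hΦ hΨ a b hab, map_add, map_smul, map_smul, map_add, map_smul,
    map_smul] at h
  filter_upwards [h, hX.ae_eq t, hY.ae_eq t,
    Lp.coeFn_add (a • hM.itoMap T G (hM.truncLp T t (hM.coordLp hΦ)))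
      (b • hM.itoMap T G (hM.truncLp T t (hM.coordLp hΨ))),
    Lp.coeFn_smul a (hM.itoMap T G (hM.truncLp T t (hM.coordLp hΦ))),
    Lp.coeFn_smul b (hM.itoMap T G (hM.truncLp T t (hM.coordLp hΨ)))] with ω h1 h2 h3 h4 h5 h6
  rw [h1, h2, h3, h4, Pi.add_apply, h5, h6, Pi.smul_apply, Pi.smul_apply]

/-- The integral process of `1_{(s,t]} 1_A S ∘ i*` is the radonification of
`r ↦ M((s ∧ r, t ∧ r], A)`. -/
lemma isRadonification {s t : ℝ≥0} (hst : s ≤ t) (htT : t ≤ T) {A : Set U} (hA : A ∈ R)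
    {S : H →L[ℝ] G} {h : MemLambda2 P ℱ μ lam (elemFamily q T s t Set.univ A S)}
    (hS : IsHilbertSchmidt S)
    (hX : hM.IsIntegralProcess h X) : IsRadonification ℱ M T s t A S X := by
  refine ⟨hX.isCadlagL2Martingale, fun r g => ?_⟩
  -- (s ∧ r, t ∧ r] is (s,t] cut at r; it is empty when r ≤ s.
  have h' := hM.memLambda2_elemFamily (T := T) (min t r)
    (@MeasurableSet.univ _ (ℱ (min s r))) hA hS
  have hX' := hX.ae_eq r
  rw [hM.truncLp_coordLp_elemFamily r h h' fun a ω => by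
    simp only [le_min_iff, min_lt_iff, Set.mem_univ, and_true]
    constructor
    · rintro ⟨⟨h1, h2⟩, h3⟩
      exact ⟨Or.inl h1, h2, h3⟩
    · rintro ⟨h1 | h1, h2, h3⟩
      · exact ⟨⟨h1, h2⟩, h3⟩
      · exact absurd h3 h1.not_ge] at hX'
  filter_upwards [hX', hM.inner_itoMap_elemFamily (min_le_min_right _ hst)
    ((min_le_left t _).trans htT) MeasurableSet.univ hA h' g] with ω h1 h2
  rw [h1, h2, Set.indicator_univ]
  rfl

end IsIntegralProcess

/-- The stochastic integral over `(0, r]` of `1_{(s,t]} 1_F 1_A S ∘ i*`. -/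
lemma itoMap_truncLp_elemFamily (hM : IsCylMartingaleValuedMeasure P ℱ R M μ lam q)
    {s t : ℝ≥0} (hst : s ≤ t) (htT : t ≤ T) {F : Set Ω} (hF : MeasurableSet[ℱ s] F) {A : Set U}
    (hA : A ∈ R) {S : H →L[ℝ] G} (hS : IsHilbertSchmidt S)
    (h : MemLambda2 P ℱ μ lam (elemFamily q T s t F A S))
    (h' : MemLambda2 P ℱ μ lam (elemFamily q T s t Set.univ A S)) (r : ℝ≥0) :
    hM.itoMap T G (hM.truncLp T r (hM.coordLp h))
      =ᵐ[P] F.indicator (hM.itoMap T G (hM.truncLp T r (hM.coordLp h'))) := by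
  -- The right end s ∨ (t ∧ r) never falls below s, so the left end stays s and `F` remains
  -- measurable at the start; for r < s the interval is empty.
  have hw : ∀ (F : Set Ω) a ω, (s < a ∧ a ≤ t) ∧ a ≤ r ∧ ω ∈ F ↔
      (s < a ∧ a ≤ max s (min t r)) ∧ ω ∈ F := by
    intro F a ω
    constructor
    · rintro ⟨⟨h1, h2⟩, h3, h4⟩
      exact ⟨⟨h1, le_max_of_le_right (le_min h2 h3)⟩, h4⟩
    · rintro ⟨⟨h1, h2⟩, h4⟩
      have h3 := (le_max_iff.1 h2).resolve_left h1.not_ge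
      exact ⟨⟨h1, (le_min_iff.1 h3).1⟩, (le_min_iff.1 h3).2, h4⟩
  have k := hM.memLambda2_elemFamily (T := T) (max s (min t r)) hF hA hS
  have k' := hM.memLambda2_elemFamily (T := T) (max s (min t r))
    (@MeasurableSet.univ _ (ℱ s)) hA hS
  rw [hM.truncLp_coordLp_elemFamily r h k (hw F),
    hM.truncLp_coordLp_elemFamily r h' k' (hw Set.univ)]
  exact hM.itoMap_elemFamily_indicator (le_max_left _ _)
    (max_le (hst.trans htT) ((min_le_left _ _).trans htT)) hF hA k k'

lemma coordLp_sum (hM : IsCylMartingaleValuedMeasure P ℱ R M μ lam q) {ι : Type*} (I : Finset ι)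
    {Φ : ι → OperatorFamily Ω G q T} (hΦ : ∀ i, MemLambda2 P ℱ μ lam (Φ i))
    (h : MemLambda2 P ℱ μ lam (∑ i ∈ I, Φ i)) :
    hM.coordLp h = ∑ i ∈ I, hM.coordLp (hΦ i) := by
  classical
  induction I using Finset.induction_on with
  | empty =>
    refine Lp.ext ?_
    filter_upwards [hM.coordLp_ae_eq h, Lp.coeFn_zero ℝ 2 (coordMeasure ℱ P μ lam T)]
      with z h1 h2
    rw [h1, Finset.sum_empty, Finset.sum_empty, h2]
    simp [coord]
  | insert i I hi ih =>
    have hI := hM.memLambda2_sum I fun i _ => hΦ i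
    have hi' := hM.memLambda2_linear (hΦ i) hI 1 1
    rw [hM.coordLp_congr h hi' (by simp [Finset.sum_insert hi]), Finset.sum_insert hi, ← ih hI,
      hM.coordLp_linear (hΦ i) hI 1 1 hi', one_smul, one_smul]

end IsCylMartingaleValuedMeasure

lemma SimpleForm.toFamily_eq_sum (φ : SimpleForm ℱ R T H G) :
    φ.toFamily q = ∑ p : Fin φ.n × Fin φ.m,
      elemFamily q T (φ.s p.1) (φ.t p.1) (φ.F p.1) (φ.A p.2) (φ.S p.1 p.2) := by
  rw [Fintype.sum_prod_type]
  funext r ω u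
  simp only [Finset.sum_apply]
  rfl

lemma SimpleForm.memLambda2 (hM : IsCylMartingaleValuedMeasure P ℱ R M μ lam q)
    (φ : SimpleForm ℱ R T H G) : MemLambda2 P ℱ μ lam (φ.toFamily q) := by
  rw [φ.toFamily_eq_sum]
  exact hM.memLambda2_sum _ fun p _ =>
    hM.memLambda2_elemFamily _ (φ.measurableSet_F p.1) (φ.A_mem p.2) (φ.hilbertSchmidt p.1 p.2)

/-- The radonifications are integral processes with the event replaced by Ω. At a fixed time the
identity follows from linearity and from taking the indicators of the events outside; these depend
on ω alone, so paths stay right continuous and equality holds for all times simultaneously. -/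
lemma IsCylMartingaleValuedMeasure.IsIntegralProcess.isSimpleIntegral
    {hM : IsCylMartingaleValuedMeasure P ℱ R M μ lam q} (hℱ : UsualConditions ℱ P)
    {φ : SimpleForm ℱ R T H G} {hφ : MemLambda2 P ℱ μ lam (φ.toFamily q)}
    {X : Set.Icc (0 : ℝ≥0) T → Ω → G} (hX : hM.IsIntegralProcess hφ X) :
    IsSimpleIntegral M φ X := by
  have hu : ∀ p : Fin φ.n × Fin φ.m, MemLambda2 P ℱ μ lam
      (elemFamily q T (φ.s p.1) (φ.t p.1) Set.univ (φ.A p.2) (φ.S p.1 p.2)) := fun p =>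
    hM.memLambda2_elemFamily _ (@MeasurableSet.univ _ (ℱ (φ.s p.1))) (φ.A_mem p.2)
      (φ.hilbertSchmidt p.1 p.2)
  have hF : ∀ p : Fin φ.n × Fin φ.m, MemLambda2 P ℱ μ lam
      (elemFamily q T (φ.s p.1) (φ.t p.1) (φ.F p.1) (φ.A p.2) (φ.S p.1 p.2)) := fun p =>
    hM.memLambda2_elemFamily _ (φ.measurableSet_F p.1) (φ.A_mem p.2) (φ.hilbertSchmidt p.1 p.2)
  choose Y hY using fun p => hM.exists_isIntegralProcess hℱ (hu p)
  refine ⟨fun i j => Y (i, j), fun i j => (hY (i, j)).isRadonification (φ.s_lt_t i).le (φ.t_le i)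
    (φ.A_mem j) (φ.hilbertSchmidt i j), ?_⟩
  have hcont : ∀ (p : Fin φ.n × Fin φ.m) ω t,
      ContinuousWithinAt (fun t => (φ.F p.1).indicator (Y p t) ω) (Set.Ioi t) t := by
    intro p ω t
    by_cases hω : ω ∈ φ.F p.1
    · simpa only [Set.indicator_of_mem hω] using
        (hY p).isCadlagL2Martingale.right_continuous ω t
    · simpa only [Set.indicator_of_notMem hω] using continuousWithinAt_const
  have hind := indistinguishable_of_modification (P := P)
    (Y := fun t ω => ∑ p : Fin φ.n × Fin φ.m, (φ.F p.1).indicator (Y p t) ω)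
    hX.isCadlagL2Martingale.right_continuous
    (fun ω t => tendsto_finsetSum _ fun p _ => hcont p ω t) fun t => by
    have h := hX.ae_eq t
    have hsum := hM.memLambda2_sum Finset.univ fun p _ => hF p
    rw [hM.coordLp_congr hφ hsum φ.toFamily_eq_sum, hM.coordLp_sum _ hF hsum, map_sum,
      map_sum] at h
    have hall := ae_all_iff.2 fun p : Fin φ.n × Fin φ.m =>
      hM.itoMap_truncLp_elemFamily (φ.s_lt_t p.1).le (φ.t_le p.1) (φ.measurableSet_F p.1)
        (φ.A_mem p.2) (φ.hilbertSchmidt p.1 p.2) (hF p) (hu p) t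
    have hallY := ae_all_iff.2 fun p => (hY p).ae_eq t
    filter_upwards [h, hall, hallY, Lp.coeFn_finsetSum Finset.univ fun p =>
      hM.itoMap T G (hM.truncLp T t (hM.coordLp (hF p)))] with ω h1 h2 h3 h4
    rw [h1, h4, Finset.sum_apply]
    refine Finset.sum_congr rfl fun p _ => ?_
    rw [h2 p]
    by_cases hω : ω ∈ φ.F p.1
    · rw [Set.indicator_of_mem hω, Set.indicator_of_mem hω, h3 p]
    · rw [Set.indicator_of_notMem hω, Set.indicator_of_notMem hω]
  filter_upwards [hind] with ω hω t
  rw [hω t, Fintype.sum_prod_type]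

end StochasticIntegral

end

theorem mainTheorem1 {Ω U H G : Type*} {mΩ : MeasurableSpace Ω}
    [TopologicalSpace U] [MeasurableSpace U] [BorelSpace U]
    [NormedAddCommGroup H] [InnerProductSpace ℝ H] [CompleteSpace H] [SeparableSpace H]
    [NormedAddCommGroup G] [InnerProductSpace ℝ G] [CompleteSpace G] [SeparableSpace G]
    (P : Measure Ω) [IsProbabilityMeasure P] [P.IsComplete]
    (ℱ : Filtration ℝ≥0 mΩ) (hℱ : UsualConditions ℱ P)
    (R : Set (Set U)) (M : ℝ≥0 → Set U → H →ₗ[ℝ] (Ω →ₘ[P] ℝ))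
    (μ : Measure U) (lam : Measure ℝ≥0) (q : ℝ≥0 → U → HilbertianSeminorm H)
    (hM : IsCylMartingaleValuedMeasure P ℱ R M μ lam q)
    (T : ℝ≥0) (hT : 0 < T) :
    ∃ I : OperatorFamily Ω G q T → Set.Icc (0 : ℝ≥0) T → Ω → G,
      -- `I` maps `Λ²(M,T)` into `M²_T(G)`
      (∀ Φ, MemLambda2 P ℱ μ lam Φ → IsCadlagL2Martingale ℱ P T (I Φ)) ∧
      -- `Λ²(M,T)` is a linear space and `I` is linear (up to indistinguishability)
      (∀ Φ Ψ, MemLambda2 P ℱ μ lam Φ → MemLambda2 P ℱ μ lam Ψ → ∀ a b : ℝ,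
        MemLambda2 P ℱ μ lam (a • Φ + b • Ψ) ∧
        ∀ᵐ ω ∂P, ∀ t, I (a • Φ + b • Ψ) t ω = a • I Φ t ω + b • I Ψ t ω) ∧
      -- `I` is continuous
      (∃ C : ℝ≥0, ∀ Φ, MemLambda2 P ℱ μ lam Φ → m2Norm P T (I Φ) ≤ C * lambda2Norm P μ lam Φ) ∧
      -- `I` extends the stochastic integral of simple integrands
      (∀ φ : SimpleForm ℱ R T H G,
        MemLambda2 P ℱ μ lam (φ.toFamily q) ∧ IsSimpleIntegral M φ (I (φ.toFamily q))) ∧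
      -- mean zero and Itô isometry
      (∀ Φ, MemLambda2 P ℱ μ lam Φ → ∀ t : Set.Icc (0 : ℝ≥0) T,
        ∫ ω, I Φ t ω ∂P = 0 ∧ ∫⁻ ω, ‖I Φ t ω‖ₑ ^ 2 ∂P = energy P μ lam Φ t) := by
  classical
  -- Families outside Λ²(M,T) get the zero process, so that `I` is defined on all families.
  have hex : ∀ Φ : OperatorFamily Ω G q T, ∃ X : Set.Icc (0 : ℝ≥0) T → Ω → G,
      ∀ hΦ : MemLambda2 P ℱ μ lam Φ, hM.IsIntegralProcess hΦ X := fun Φ => by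
    by_cases hΦ : MemLambda2 P ℱ μ lam Φ
    · obtain ⟨X, hX⟩ := hM.exists_isIntegralProcess hℱ hΦ
      exact ⟨X, fun _ => hX⟩
    · exact ⟨0, fun h => absurd h hΦ⟩
  choose I hI using hex
  refine ⟨I, fun Φ hΦ => (hI Φ hΦ).isCadlagL2Martingale, fun Φ Ψ hΦ hΨ a b => ?_,
    ⟨2, fun Φ hΦ => (hI Φ hΦ).m2Norm_le⟩, fun φ => ?_, fun Φ hΦ t =>
      ⟨(hI Φ hΦ).integral_eq_zero t, (hI Φ hΦ).lintegral_enorm_sq t⟩⟩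
  · have hab := hM.memLambda2_linear hΦ hΨ a b
    exact ⟨hab, (hI _ hab).linear (hI Φ hΦ) (hI Ψ hΨ)⟩
  · have hφ := φ.memLambda2 hM
    exact ⟨hφ, (hI _ hφ).isSimpleIntegral hℱ⟩
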